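/- Let $n\ge 2$, let $V:[0,\infty)\to\mathbb R$ be continuous on $[0,\infty)$ and $\mathcal C^\infty$ on $(0,\infty)$, let $\mu$ be a probability measure on $\mathbb R^n$ with Lebesgue density proportional to $e^{-V(\|x\|)}$, and let $\nu$ be the probability measure on $(0,\infty)$ with Lebesgue density proportional to $r^{n-1}e^{-V(r)}$. Let $\sigma:\mathbb R^n\to\mathbb R$ be a radial function (we also write $\sigma(r)$ for $\sigma(x)$ with $\|x\|=r$) such that - (smoothness) $\sigma\in\mathcal C^\infty(\mathbb R^n)$; - (ellipticity) $\sigma(x)>0$ for all $x\in\mathbb R^n$; - (completeness) $(\mathbb R^n,d_\sigma)$ is a complete metric space, where $d_\sigma(x,y)=\sup\{|f(x)-f(y)| : f\in\mathcal C^\infty(\mathbb R^n),\ \sigma\|\nabla f\|\le 1\}$. Consider the operators $$\mathcal L^\sigma_\mu h(x)=\sigma^2(x)\Delta h(x)+\Big(\nabla(\sigma^2)(x)-\sigma^2(x)\frac{V'(\|x\|)}{\|x\|}x\Big)\cdot\nabla h(x),\qquad x\in\mathbb R^n,$$ $$\mathcal L^\sigma_\nu g(r)=\sigma^2(r)g''(r)+\Big((\sigma^2)'(r)-\sigma^2(r)\Big(V'(r)-\frac{n-1}{r}\Big)\Big)g'(r),\qquad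 r>0,$$ where $-\mathcal L^\sigma_\mu$ is realized as the self-adjoint operator on $L^2(\mu)$ associated with the Dirichlet form $\int\sigma^2\,\nabla f_1\cdot\nabla f_2\,d\mu$ with domain the weighted Sobolev space $W^{1,2}_\sigma(\mu)=\{f\in L^2(\mu):\sigma\|\nabla f\|\in L^2(\mu)\}$ (weak gradient on $\mathbb R^n$), and $-\mathcal L^\sigma_\nu$ is realized (Neumann realization) as the self-adjoint operator on $L^2(\nu)$ associated with the form $\int_0^\infty\sigma^2 g_1'g_2'\,d\nu$ with domain $W^{1,2}_\sigma(\nu)=\{g\in L^2(\nu):\sigma g'\in L^2(\nu)\}$ (weak derivative on $(0,\infty)$). The spectral gap $\lambda_1(A)$ of such an operator $A$ is the largest $\lambda$ such that the spectrum of $A$ is contained in $\{0\}\cup[\lambda,\infty)$. Then $$\min\left\{\lambda_1(-\mathcal L^\sigma_\nu),\ \frac{n-1}{\int_{\mathbb R^n}\frac{\|x\|^2}{\sigma^2(x)}\,\mu(dx)}\right\}\ \le\ \lambda_1(-\mathcal L^\sigma_\mu)\ \le\ \min\left\{\lambda_1(-\mathcal L^\sigma_\nu),\ \frac{n\int_{\mathbb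 R^n}\sigma^2(x)\,\mu(dx)}{\int_{\mathbb R^n}\|x\|^2\,\mu(dx)}\right\}.$$ The integrals are taken in $[0,\infty]$ (with $a/\infty=0$ for finite $a$ and $\infty/a=\infty$ for finite $a>0$). The lower bound and the inequality $\lambda_1(-\mathcal L^\sigma_\mu)\le\lambda_1(-\mathcal L^\sigma_\nu)$ hold without any integrability assumption, and the full upper bound holds whenever $\int\sigma^2d\mu$ and $\int\|x\|^2d\mu$ are not both infinite. -/

import Mathlib

open MeasureTheory Set Filter Topology
open scoped ENNReal NNReal ContDiff InnerProductSpace Gradient Laplacian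

noncomputable section

section General

variable {E : Type*} [NormedAddCommGroup E] [InnerProductSpace ℝ E] [FiniteDimensional ℝ E]
  [MeasurableSpace E] [BorelSpace E]

/-- `G` is the weak (distributional) gradient of `f` on the open set `U`. -/
def HasWeakGradient (U : Set E) (f : E → ℝ) (G : E → E) : Prop :=
  LocallyIntegrableOn f U volume ∧ LocallyIntegrableOn G U volume ∧
    ∀ φ : E → ℝ, ContDiff ℝ ∞ φ → HasCompactSupport φ → tsupport φ ⊆ U →
      ∫ x, f x • ∇ φ x = - ∫ x, φ x • G x

/-- `f` belongs to the weighted Sobolev space `W_σ^{1,2}(m)` of functions on `U` that are in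
`L²(m)`, with weak gradient `G` on `U` such that `σ ‖G‖` is in `L²(m)`. -/
structure IsWeightedSobolev (U : Set E) (m : Measure E) (σ : E → ℝ)
    (f : Lp ℝ 2 m) (G : E → E) : Prop where
  weakGradient : HasWeakGradient U f G
  memLp : MemLp (fun x => σ x • G x) 2 m

/-- The graph of the non-negative self-adjoint operator `-L` on `L²(m)` associated with the
Dirichlet form `(f, h) ↦ ∫ σ² ∇f · ∇h dm` with domain `W_σ^{1,2}(m)`: `f` is in the domain of
`-L` and `-L f = g`. No boundary condition is put on the form domain, which is the Neumann
realization. -/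
def GeneratorGraph (U : Set E) (m : Measure E) (σ : E → ℝ) (f g : Lp ℝ 2 m) : Prop :=
  ∃ G : E → E, IsWeightedSobolev U m σ f G ∧
    ∀ (h : Lp ℝ 2 m) (H : E → E), IsWeightedSobolev U m σ h H →
      ∫ x, σ x ^ 2 * ⟪G x, H x⟫_ℝ ∂m = ∫ x, g x * h x ∂m

/-- The resolvent set of the operator `A` on `X` with graph `Γ`: the `l` such that `A - l` maps the
domain of `A` bijectively onto `X` with a bounded inverse `R`. -/
def graphResolventSet {X : Type*} [NormedAddCommGroup X] [NormedSpace ℝ X]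
    (Γ : X → X → Prop) : Set ℝ :=
  {l : ℝ | ∃ R : X →L[ℝ] X, ∀ u f : X, Γ f (l • f + u) ↔ f = R u}

/-- The (real) spectrum of the operator on `X` with graph `Γ`. -/
def graphSpectrum {X : Type*} [NormedAddCommGroup X] [NormedSpace ℝ X]
    (Γ : X → X → Prop) : Set ℝ :=
  (graphResolventSet Γ)ᶜ

/-- The spectral gap `λ₁(-L)`: the largest `l` such that the spectrum of `-L` is contained in
`{0} ∪ [l, ∞)`. -/
def spectralGap (U : Set E) (m : Measure E) (σ : E → ℝ) : ℝ≥0∞ :=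
  ⨆ (l : ℝ≥0) (_ : graphSpectrum (GeneratorGraph U m σ) ⊆ {0} ∪ Ici (l : ℝ)), (l : ℝ≥0∞)

/-- The distance `d_σ(x, y) = sup {|f x - f y| : f ∈ C^∞, σ ‖∇f‖ ≤ 1}`. -/
def weightDist (σ : E → ℝ) (x y : E) : ℝ≥0∞ :=
  ⨆ (f : E → ℝ) (_ : ContDiff ℝ ∞ f) (_ : ∀ z, σ z * ‖∇ f z‖ ≤ 1), ENNReal.ofReal |f x - f y|

/-- Smoothness, ellipticity and completeness of the weight `σ`. -/
structure AdmissibleWeight (σ : E → ℝ) : Prop where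
  smooth : ContDiff ℝ ∞ σ
  elliptic : ∀ x, 0 < σ x
  /-- every Cauchy sequence for `d_σ` converges for `d_σ` -/
  complete : ∀ u : ℕ → E,
    (∀ ε : ℝ≥0∞, 0 < ε → ∃ N, ∀ i ≥ N, ∀ j ≥ N, weightDist σ (u i) (u j) < ε) →
      ∃ x, Tendsto (fun i => weightDist σ (u i) x) atTop (𝓝 0)

end General

/-- The spectral gap `λ₁(-L_μ^σ)` of the full dynamics on `ℝⁿ`. -/
def fullGap (n : ℕ) (μ : Measure (EuclideanSpace ℝ (Fin n))) (σ : EuclideanSpace ℝ (Fin n) → ℝ) :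
    ℝ≥0∞ :=
  spectralGap univ μ σ

/-- The (Neumann) spectral gap `λ₁(-L_ν^σ)` of the radial dynamics on `(0, ∞)`; `s` is the radial
profile of the weight. -/
def radialGap (ν : Measure ℝ) (s : ℝ → ℝ) : ℝ≥0∞ :=
  spectralGap (Ioi 0) ν s

/-- The operator `L_μ^σ h = σ² Δh + (∇(σ²) - σ² (V'(‖x‖) / ‖x‖) x) · ∇h` on `ℝⁿ`. -/
def fullOp (n : ℕ) (V : ℝ → ℝ) (σ h : EuclideanSpace ℝ (Fin n) → ℝ)
    (x : EuclideanSpace ℝ (Fin n)) : ℝ :=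
  σ x ^ 2 * Δ h x +
    ⟪∇ (fun y => σ y ^ 2) x - (σ x ^ 2 * (deriv V ‖x‖ / ‖x‖)) • x, ∇ h x⟫_ℝ

/-- The operator `L_ν^σ g = σ² g'' + ((σ²)' - σ² (V' - (n - 1) / r)) g'` on `(0, ∞)`. -/
def radialOp (n : ℕ) (V s g : ℝ → ℝ) (r : ℝ) : ℝ :=
  s r ^ 2 * deriv (deriv g) r +
    (deriv (fun t => s t ^ 2) r - s r ^ 2 * (deriv V r - ((n : ℝ) - 1) / r)) * deriv g r

theorem contDiff_of_forall_tsupport {E : Type*} [NormedAddCommGroup E] [NormedSpace ℝ E]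
    {h : E → ℝ} {E' : Type*} [NormedAddCommGroup E']
    [NormedSpace ℝ E'] {Φ : E → E'} (h1 : ∀ x ∈ tsupport h, ContDiffAt ℝ ∞ Φ x)
    (h0 : ∀ x, x ∉ tsupport h → Φ x = 0) : ContDiff ℝ ∞ Φ := by
  refine contDiff_iff_contDiffAt.2 fun x => ?_
  by_cases hx : x ∈ tsupport h
  · exact h1 x hx
  · refine (contDiffAt_const (c := (0 : E'))).congr_of_eventuallyEq ?_
    filter_upwards [(isClosed_tsupport h).isOpen_compl.mem_nhds hx] with y hy
    exact h0 y hy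

section Link

variable {E : Type*} [NormedAddCommGroup E] [InnerProductSpace ℝ E] [FiniteDimensional ℝ E]
  [MeasurableSpace E] [BorelSpace E]

theorem HasWeakGradient.integral_div {U : Set E} {f : E → ℝ} {G : E → E}
    (hG : HasWeakGradient U f G) {ι : Type*} [Fintype ι] (b : OrthonormalBasis ι ℝ E)
    (X : ι → E → ℝ) (h1 : ∀ i, ContDiff ℝ ∞ (X i)) (h2 : ∀ i, HasCompactSupport (X i))
    (h3 : ∀ i, tsupport (X i) ⊆ U) :
    ∫ x, f x * ∑ i, fderiv ℝ (X i) x (b i) = - ∫ x, ∑ i, X i x * ⟪b i, G x⟫_ℝ := by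
  obtain ⟨hf, hG, hw⟩ := hG
  have i1 : ∀ i, Integrable (fun x => f x • ∇ (X i) x) := by
    intro i
    have hK : IsCompact (tsupport (X i)) := h2 i
    have hc : Continuous (∇ (X i)) :=
      (InnerProductSpace.toDual ℝ E).symm.continuous.comp ((h1 i).continuous_fderiv (by simp))
    refine (integrableOn_iff_integrable_of_support_subset (s := tsupport (X i)) ?_).1 ?_
    · intro x hx
      by_contra hxs
      apply hx
      have : fderiv ℝ (X i) x = 0 := by
        by_contra h0
        exact hxs (support_fderiv_subset ℝ h0)
      simp [gradient, this]
    · exact (hf.integrableOn_compact_subset (h3 i) hK).smul_continuousOn hc.continuousOn hK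
  have i2 : ∀ i, Integrable (fun x => X i x • G x) := by
    intro i
    have hK : IsCompact (tsupport (X i)) := h2 i
    refine (integrableOn_iff_integrable_of_support_subset (s := tsupport (X i)) ?_).1 ?_
    · intro x hx
      by_contra hxs
      apply hx
      simp [image_eq_zero_of_notMem_tsupport hxs]
    · exact (hG.integrableOn_compact_subset (h3 i) hK).continuousOn_smul
        (h1 i).continuous.continuousOn hK
  have e1 : ∀ i x, f x * fderiv ℝ (X i) x (b i) = ⟪b i, f x • ∇ (X i) x⟫_ℝ := by
    intro i x
    rw [real_inner_smul_right, real_inner_comm, inner_gradient_left]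
  have e2 : ∀ i x, X i x * ⟪b i, G x⟫_ℝ = ⟪b i, X i x • G x⟫_ℝ := by
    intro i x
    rw [real_inner_smul_right]
  simp_rw [Finset.mul_sum, e1, e2]
  rw [integral_finsetSum _ (fun i _ => (i1 i).const_inner _),
    integral_finsetSum _ (fun i _ => (i2 i).const_inner _), ← Finset.sum_neg_distrib]
  refine Finset.sum_congr rfl fun i _ => ?_
  rw [integral_inner (i1 i), integral_inner (i2 i), hw _ (h1 i) (h2 i) (h3 i), inner_neg_right]

theorem hasWeakGradient_of_smooth {U : Set E} {h f : E → ℝ}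
    (h1 : ContDiff ℝ ∞ h) (hf : f =ᵐ[volume.restrict U] h) :
    HasWeakGradient U f (∇ h) := by
  have hc : Continuous (∇ h) :=
      (InnerProductSpace.toDual ℝ E).symm.continuous.comp (h1.continuous_fderiv (by simp))
  refine ⟨?_, hc.locallyIntegrable.locallyIntegrableOn U, ?_⟩
  · intro x hx
    obtain ⟨t, ht, hti⟩ := (h1.continuous.locallyIntegrable (μ := volume)).locallyIntegrableOn U x hx
    refine ⟨t ∩ U, Filter.inter_mem ht self_mem_nhdsWithin, ?_⟩
    exact (hti.mono_set inter_subset_left).congr_fun_ae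
      (ae_mono (Measure.restrict_mono inter_subset_right le_rfl) hf.symm)
  · intro φ p1 p2 p3
    have hcφ : Continuous (∇ φ) :=
      (InnerProductSpace.toDual ℝ E).symm.continuous.comp (p1.continuous_fderiv (by simp))
    have z : ∀ x, x ∉ tsupport φ → ∇ φ x = 0 := by
      intro x hx
      have : fderiv ℝ φ x = 0 := by
        by_contra h0
        exact hx (support_fderiv_subset ℝ h0)
      simp [gradient, this]
    have e0 : ∫ x, f x • ∇ φ x = ∫ x, h x • ∇ φ x := by
      rw [← setIntegral_eq_integral_of_forall_compl_eq_zero (s := U)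
          (f := fun x => f x • ∇ φ x),
        ← setIntegral_eq_integral_of_forall_compl_eq_zero (s := U)
          (f := fun x => h x • ∇ φ x)]
      · refine integral_congr_ae ?_
        filter_upwards [hf] with x hx
        rw [hx]
      · intro x hx
        rw [z x (fun h => hx (p3 h)), smul_zero]
      · intro x hx
        rw [z x (fun h => hx (p3 h)), smul_zero]
    rw [e0]
    have k1 : HasCompactSupport (∇ φ) := by
      exact HasCompactSupport.intro p2 z
    have i1 : Integrable (fun x => h x • ∇ φ x) :=
      (h1.continuous.smul hcφ).integrable_of_hasCompactSupport k1.smul_left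
    have i2 : Integrable (fun x => φ x • ∇ h x) :=
      (p1.continuous.smul hc).integrable_of_hasCompactSupport p2.smul_right
    refine ext_inner_left ℝ fun v => ?_
    rw [inner_neg_right, ← integral_inner i1, ← integral_inner i2]
    simp_rw [real_inner_smul_right, inner_gradient_right, conj_trivial]
    have := integral_mul_fderiv_eq_neg_fderiv_mul_of_integrable (μ := (volume : Measure E))
      (f := h) (g := φ) (v := v) ?_ ?_ ?_ (fun x _ => h1.differentiable (by simp) x)
      (fun x _ => p1.differentiable (by simp) x)
    · simp_rw [this, mul_comm]
    · have := i2.const_inner (𝕜 := ℝ) v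
      simp_rw [real_inner_smul_right, inner_gradient_right, conj_trivial] at this
      simpa only [mul_comm] using this
    · have := i1.const_inner (𝕜 := ℝ) v
      simpa only [real_inner_smul_right, inner_gradient_right, conj_trivial] using this
    · exact (h1.continuous.mul p1.continuous).integrable_of_hasCompactSupport p2.mul_left

/-- Integration by parts: on smooth compactly supported functions, the generator of the Dirichlet
form is given by the differential expression of the dynamics. -/
theorem generatorGraph_of_smooth {U : Set E} (hU : IsOpen U) {m : Measure E} [IsFiniteMeasure m]
    {σ W h : E → ℝ} {c : ℝ} (hc : 0 < c) (hW : ContinuousOn W U)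
    (hm : m = (volume.restrict U).withDensity fun x => ENNReal.ofReal (c * Real.exp (-W x)))
    (h1 : ContDiff ℝ ∞ h) (h2 : HasCompactSupport h) (h3 : tsupport h ⊆ U)
    (hσ : ∀ x ∈ tsupport h, ContDiffAt ℝ ∞ σ x) (hW' : ∀ x ∈ tsupport h, ContDiffAt ℝ ∞ W x)
    (f g : Lp ℝ 2 m) (hf : f =ᵐ[m] h)
    (hg : g =ᵐ[m] fun x => -(σ x ^ 2 * Δ h x +
      ⟪∇ (fun y => σ y ^ 2) x - σ x ^ 2 • ∇ W x, ∇ h x⟫_ℝ)) :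
    GeneratorGraph U m σ f g := by
  have hρm : AEMeasurable (fun x => ENNReal.ofReal (c * Real.exp (-W x))) (volume.restrict U) := by
    refine AEMeasurable.ennreal_ofReal ?_
    exact (ContinuousOn.aemeasurable (by fun_prop) hU.measurableSet)
  have hac : volume.restrict U ≪ m := by
    rw [hm]
    refine withDensity_absolutelyContinuous' hρm (Eventually.of_forall fun x => ?_)
    simp only [ne_eq, ENNReal.ofReal_eq_zero, not_le]
    positivity
  have hint : ∀ F : E → ℝ, ∫ x, F x ∂m = ∫ x in U, (c * Real.exp (-W x)) * F x := by
    intro F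
    rw [hm, integral_withDensity_eq_integral_toReal_smul₀ hρm (by simp)]
    refine integral_congr_ae (Eventually.of_forall fun x => ?_)
    simp only [smul_eq_mul]
    rw [ENNReal.toReal_ofReal (by positivity)]
  have z : ∀ x, x ∉ tsupport h → fderiv ℝ h x = 0 := by
    intro x hx
    by_contra h0
    exact hx (support_fderiv_subset ℝ h0)
  have z' : ∀ x, x ∉ tsupport h → ∇ h x = 0 := by
    intro x hx
    simp [gradient, z x hx]
  have hdh : ContDiff ℝ ∞ (fderiv ℝ h) := h1.fderiv_right (by simp)
  have hgr : ContDiff ℝ ∞ (∇ h) :=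
    (InnerProductSpace.toDual ℝ E).symm.toContinuousLinearEquiv.contDiff.comp hdh
  refine ⟨∇ h, ⟨hasWeakGradient_of_smooth h1 (hac.ae_le hf), ?_⟩, ?_⟩
  · have hcont : Continuous (fun x => σ x • ∇ h x) := by
      have : ContDiff ℝ ∞ (fun x => σ x • ∇ h x) := by
        exact contDiff_of_forall_tsupport (fun x hx => (hσ x hx).smul hgr.contDiffAt)
          fun x hx => by simp [z' x hx]
      exact this.continuous
    have hcs : HasCompactSupport (fun x => σ x • ∇ h x) :=
      HasCompactSupport.intro h2 fun x hx => by simp [z' x hx]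
    obtain ⟨C, hC⟩ := hcs.exists_bound_of_continuous hcont
    exact MemLp.of_bound hcont.aestronglyMeasurable C (Eventually.of_forall hC)
  · intro k K hk
    set b := stdOrthonormalBasis ℝ E
    set a : E → ℝ := fun x => c * Real.exp (-W x) * σ x ^ 2 with ha
    set X : _ → E → ℝ := fun i x => a x * fderiv ℝ h x (b i) with hX
    have haC : ∀ x ∈ tsupport h, ContDiffAt ℝ ∞ a x := fun x hx =>
      (contDiffAt_const.mul (Real.contDiff_exp.contDiffAt.comp x (hW' x hx).neg)).mul
        ((hσ x hx).pow 2)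
    have zX : ∀ i x, x ∉ tsupport h → X i x = 0 := by
      intro i x hx
      simp [hX, z x hx]
    have sX : ∀ i, tsupport (X i) ⊆ tsupport h := fun i =>
      closure_minimal (fun y hy => by
        by_contra hy'
        exact hy (zX i y hy')) (isClosed_tsupport h)
    have key := hk.weakGradient.integral_div b X
      (fun i => contDiff_of_forall_tsupport (fun x hx =>
        (haC x hx).mul (hdh.clm_apply contDiff_const).contDiffAt) (zX i))
      (fun i => HasCompactSupport.intro h2 fun x hx => zX i x hx)
      (fun i => (sX i).trans h3)
    have l1 : ∫ x, σ x ^ 2 * ⟪∇ h x, K x⟫_ℝ ∂m = ∫ x, ∑ i, X i x * ⟪b i, K x⟫_ℝ := by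
      rw [hint, setIntegral_eq_integral_of_forall_compl_eq_zero]
      · refine integral_congr_ae (Eventually.of_forall fun x => ?_)
        simp only [hX, ha]
        rw [← b.sum_inner_mul_inner, Finset.mul_sum, Finset.mul_sum]
        refine Finset.sum_congr rfl fun i _ => ?_
        rw [inner_gradient_left]
        ring
      · intro x hx
        simp [z' x (fun h => hx (h3 h))]
    have l2 : ∫ x, g x * k x ∂m = - ∫ x, k x * ∑ i, fderiv ℝ (X i) x (b i) := by
      have : ∫ x, g x * k x ∂m = ∫ x, -(σ x ^ 2 * Δ h x +
          ⟪∇ (fun y => σ y ^ 2) x - σ x ^ 2 • ∇ W x, ∇ h x⟫_ℝ) * k x ∂m := by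
        refine integral_congr_ae ?_
        filter_upwards [hg] with x hx
        rw [hx]
      rw [this, hint, ← integral_neg,
        ← setIntegral_eq_integral_of_forall_compl_eq_zero (s := U)
          (f := fun x => -(k x * ∑ i, fderiv ℝ (X i) x (b i)))]
      · refine integral_congr_ae (Eventually.of_forall fun x => ?_)
        by_cases hx : x ∈ tsupport h
        · have dW : DifferentiableAt ℝ W x := (hW' x hx).differentiableAt (by simp)
          have dσ : DifferentiableAt ℝ (fun y => σ y ^ 2) x :=
            ((hσ x hx).pow 2).differentiableAt (by simp)
          have dE : HasFDerivAt (fun y => c * Real.exp (-W y))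
              (c • (Real.exp (-W x) • -fderiv ℝ W x)) x :=
            (dW.hasFDerivAt.neg.exp).const_mul c
          have da := dE.mul dσ.hasFDerivAt
          have dX : ∀ i, fderiv ℝ (X i) x (b i) =
              a x * fderiv ℝ (fderiv ℝ h) x (b i) (b i) + fderiv ℝ h x (b i) *
              (c * Real.exp (-W x) * (fderiv ℝ (fun y => σ y ^ 2) x (b i)
                - σ x ^ 2 * fderiv ℝ W x (b i))) := by
            intro i
            have d2 : HasFDerivAt (fun y => fderiv ℝ h y (b i))
                ((fderiv ℝ (fderiv ℝ h) x).flip (b i)) x := by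
              have := (hdh.differentiable (by simp) x).hasFDerivAt.clm_apply
                (hasFDerivAt_const (b i) x)
              simpa using this
            have := (da.mul d2).fderiv
            have e : fderiv ℝ (X i) x = _ := this
            rw [e]
            simp [ha]
            ring
          simp_rw [dX]
          rw [Finset.sum_add_distrib, ← Finset.mul_sum]
          rw [InnerProductSpace.laplacian_eq_iteratedFDeriv_orthonormalBasis h b]
          simp only [iteratedFDeriv_two_apply, Matrix.cons_val_zero, Matrix.cons_val_one]
          rw [← b.sum_inner_mul_inner (∇ (fun y => σ y ^ 2) x - σ x ^ 2 • ∇ W x) (∇ h x)]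
          simp only [inner_sub_left, real_inner_smul_left, inner_gradient_left,
            inner_gradient_right, ha, conj_trivial]
          have : ∑ i, fderiv ℝ h x (b i) *
              (c * Real.exp (-W x) * (fderiv ℝ (fun y => σ y ^ 2) x (b i)
                - σ x ^ 2 * fderiv ℝ W x (b i))) = c * Real.exp (-W x) *
              ∑ i, (fderiv ℝ (fun y => σ y ^ 2) x (b i)
                - σ x ^ 2 * fderiv ℝ W x (b i)) * fderiv ℝ h x (b i) := by
            rw [Finset.mul_sum]
            exact Finset.sum_congr rfl fun i _ => by ring
          rw [this]
          ring
        · have hev : h =ᶠ[𝓝 x] fun _ => 0 := notMem_tsupport_iff_eventuallyEq.1 hx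
          have hl : Δ h x = 0 := by
            rw [(InnerProductSpace.laplacian_congr_nhds hev).eq_of_nhds]
            simp
          have hXz : ∀ i, fderiv ℝ (X i) x = 0 := by
            intro i
            have : X i =ᶠ[𝓝 x] fun _ => 0 := by
              filter_upwards [(isClosed_tsupport h).isOpen_compl.mem_nhds hx] with y hy
              exact zX i y hy
            rw [this.fderiv_eq]
            simp
          simp [hl, z' x hx, hXz]
      · intro x hx
        have hx' : x ∉ tsupport h := fun h => hx (h3 h)
        have hXz : ∀ i, fderiv ℝ (X i) x = 0 := by
          intro i
          have : X i =ᶠ[𝓝 x] fun _ => 0 := by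
            filter_upwards [(isClosed_tsupport h).isOpen_compl.mem_nhds hx'] with y hy
            exact zX i y hy
          rw [this.fderiv_eq]
          simp
        simp [hXz]
    rw [l1, l2, key, neg_neg]

end Link

/-- The operator behind `fullGap` extends `-L_μ^σ` from smooth compactly supported functions. -/
theorem generatorGraph_fullOp {n : ℕ} {V : ℝ → ℝ} (hV0 : ContinuousOn V (Ici 0))
    (hV : ContDiffOn ℝ ∞ V (Ioi 0)) {μ : Measure (EuclideanSpace ℝ (Fin n))}
    [IsFiniteMeasure μ] {c : ℝ} (hc : 0 < c)
    (hμ : μ = volume.withDensity (fun x => ENNReal.ofReal (c * Real.exp (-V ‖x‖))))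
    {σ h : EuclideanSpace ℝ (Fin n) → ℝ} (hσ : ContDiff ℝ ∞ σ)
    (h1 : ContDiff ℝ ∞ h) (h2 : HasCompactSupport h)
    (h3 : ∀ x ∈ tsupport h, ContDiffAt ℝ ∞ (fun y : EuclideanSpace ℝ (Fin n) => V ‖y‖) x)
    (f g : Lp ℝ 2 μ) (hf : f =ᵐ[μ] h) (hg : g =ᵐ[μ] fun x => -fullOp n V σ h x) :
    GeneratorGraph univ μ σ f g := by
  refine generatorGraph_of_smooth (W := fun x => V ‖x‖) isOpen_univ hc
    (hV0.comp continuous_norm.continuousOn fun x _ => norm_nonneg x)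
    (by rw [Measure.restrict_univ]; exact hμ) h1 h2 (subset_univ _)
    (fun x _ => hσ.contDiffAt) h3 f g hf (hg.trans (Eventually.of_forall fun x => ?_))
  by_cases hx : x ∈ tsupport h
  · have key : ∇ (fun y : EuclideanSpace ℝ (Fin n) => V ‖y‖) x = (deriv V ‖x‖ / ‖x‖) • x := by
      have hd := (h3 x hx).differentiableAt (by simp)
      rcases eq_or_ne x 0 with rfl | h0
      · have h4 := hd.hasFDerivAt
        have h5 : HasFDerivAt (fun y : EuclideanSpace ℝ (Fin n) => V ‖y‖)
            ((fderiv ℝ (fun y : EuclideanSpace ℝ (Fin n) => V ‖y‖) 0).comp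
              (-(ContinuousLinearMap.id ℝ (EuclideanSpace ℝ (Fin n))))) 0 := by
          have h6 := (hasFDerivAt_id (𝕜 := ℝ) (0 : EuclideanSpace ℝ (Fin n))).neg
          have h7 := HasFDerivAt.comp (𝕜 := ℝ) (0 : EuclideanSpace ℝ (Fin n))
            (by simpa using h4) h6
          refine h7.congr_of_eventuallyEq (Eventually.of_forall fun y => ?_)
          simp
        have h8 := h4.unique h5
        have h9 : fderiv ℝ (fun y : EuclideanSpace ℝ (Fin n) => V ‖y‖) 0 = 0 := by
          ext v
          have := DFunLike.congr_fun h8 v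
          simp only [ContinuousLinearMap.comp_apply, neg_apply,
            ContinuousLinearMap.id_apply, map_neg] at this
          simp only [zero_apply]
          linarith
        simp [gradient, h9]
      · have hp : 0 < ‖x‖ := norm_pos_iff.2 h0
        have h4 : HasDerivAt V (deriv V ‖x‖) ‖x‖ :=
          ((hV.contDiffAt (Ioi_mem_nhds hp)).differentiableAt (by simp)).hasDerivAt
        have h5 : HasFDerivAt (fun y : EuclideanSpace ℝ (Fin n) => ‖y‖) (fderiv ℝ (‖·‖) x) x :=
          (contDiffAt_norm (n := 1) ℝ h0).differentiableAt (by simp) |>.hasFDerivAt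
        have h6 := h4.comp_hasFDerivAt x h5
        refine ext_inner_right ℝ fun v => ?_
        rw [inner_gradient_left, real_inner_smul_left]
        have h7 : fderiv ℝ (fun y : EuclideanSpace ℝ (Fin n) => V ‖y‖) x = _ := h6.fderiv
        rw [h7]
        have h8 : HasFDerivAt (fun y : EuclideanSpace ℝ (Fin n) => ‖y‖ ^ 2) _ x :=
          (hasStrictFDerivAt_norm_sq x).hasFDerivAt
        have h9 := h8.unique (h5.pow 2)
        have h10 := DFunLike.congr_fun h9 v
        simp at h10
        simp only [smul_apply, smul_eq_mul]
        rw [div_mul_eq_mul_div, eq_div_iff hp.ne']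
        linear_combination (-deriv V ‖x‖ / 2) * h10
    simp only [fullOp, key, smul_smul]
  · have : fderiv ℝ h x = 0 := by
      by_contra h0
      exact hx (support_fderiv_subset ℝ h0)
    have : ∇ h x = 0 := by simp [gradient, this]
    simp [fullOp, this]

/-- The operator behind `radialGap` extends `-L_ν^σ` from smooth functions with compact support in
`(0, ∞)`. -/
theorem generatorGraph_radialOp {n : ℕ} (hn : 1 ≤ n) {V : ℝ → ℝ} (hV : ContDiffOn ℝ ∞ V (Ioi 0))
    {ν : Measure ℝ} [IsFiniteMeasure ν] {c : ℝ} (hc : 0 < c)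
    (hν : ν = (volume.restrict (Ioi 0)).withDensity
      (fun r => ENNReal.ofReal (c * (r ^ (n - 1) * Real.exp (-V r)))))
    {s h : ℝ → ℝ} (hs : ContDiffOn ℝ ∞ s (Ioi 0))
    (h1 : ContDiff ℝ ∞ h) (h2 : HasCompactSupport h) (h3 : tsupport h ⊆ Ioi 0)
    (f g : Lp ℝ 2 ν) (hf : f =ᵐ[ν] h) (hg : g =ᵐ[ν] fun r => -radialOp n V s h r) :
    GeneratorGraph (Ioi 0) ν s f g := by
  have hW : ContDiffOn ℝ ∞ (fun r => V r - ((n : ℝ) - 1) * Real.log r) (Ioi 0) :=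
    hV.sub (contDiffOn_const.mul
      (Real.contDiffOn_log.mono fun x hx => (ne_of_gt hx : x ≠ 0)))
  have hpos : ∀ᵐ r ∂ν, r ∈ Ioi (0 : ℝ) := by
    rw [hν]
    exact (withDensity_absolutelyContinuous _ _).ae_le (ae_restrict_mem measurableSet_Ioi)
  refine generatorGraph_of_smooth (W := fun r => V r - ((n : ℝ) - 1) * Real.log r) isOpen_Ioi hc
    hW.continuousOn ?_ h1 h2 h3
    (fun x hx => hs.contDiffAt (Ioi_mem_nhds (h3 hx)))
    (fun x hx => hW.contDiffAt (Ioi_mem_nhds (h3 hx))) f g hf (hg.trans ?_)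
  · rw [hν]
    refine withDensity_congr_ae ?_
    filter_upwards [ae_restrict_mem measurableSet_Ioi] with r hr
    have hr : 0 < r := hr
    have : r ^ (n - 1) = Real.exp (((n : ℝ) - 1) * Real.log r) := by
      rw [← Real.rpow_natCast, Real.rpow_def_of_pos hr, Nat.cast_sub hn, mul_comm]
      simp
    rw [this, ← Real.exp_add]
    ring_nf
  · filter_upwards [hpos] with r hr
    have dV : DifferentiableAt ℝ V r :=
      (hV.contDiffAt (Ioi_mem_nhds hr)).differentiableAt (by simp)
    have dW : deriv (fun r => V r - ((n : ℝ) - 1) * Real.log r) r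
        = deriv V r - ((n : ℝ) - 1) / r := by
      have := (dV.hasDerivAt.sub
        ((Real.hasDerivAt_log (ne_of_gt hr)).const_mul ((n : ℝ) - 1))).deriv
      rw [div_eq_mul_inv]
      exact this
    rw [InnerProductSpace.laplacian_eq_iteratedDeriv_real, gradient_eq_deriv', gradient_eq_deriv',
      gradient_eq_deriv', dW, radialOp, iteratedDeriv_succ, iteratedDeriv_one]
    simp only [smul_eq_mul, RCLike.inner_apply, conj_trivial]
    ring

end

/-! Both spectral gaps are first rewritten as Poincaré constants; what remains is a comparison of
variances and energies. In polar coordinates $x=r\theta$ the measure $\mu$ is the product of the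
uniform law $\kappa$ on the unit sphere and of $\nu$, and the energy density splits orthogonally as
$\sigma^2(\partial_r f)^2+\sigma^2|\nabla_{\tan}f|^2$.

Lower bound. With $F(\theta)=\int f(r\theta)\,\nu(dr)$, one has $\mathrm{Var}_\mu f=\int
\mathrm{Var}_\nu f(\cdot\,\theta)\,\kappa(d\theta)+\mathrm{Var}_\kappa F$. The Poincaré inequality
of $\nu$ on almost every ray controls the first term by the radial energy
(`mul_integral_slice_variance_le`). For the second, the sphere has Poincaré constant $n-1$ and
$\nabla F(\theta)=\int r\,\nabla_{\tan}f(r\theta)\,\nu(dr)$; writing $r=(r/\sigma)\,\sigma$ and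
using Cauchy–Schwarz, $(n-1)\mathrm{Var}_\kappa F\le\int
(r/\sigma)^2d\nu\cdot\int\sigma^2|\nabla_{\tan}f|^2d\mu$ (`variance_angular_le`). A constant below
both terms of the minimum therefore works for the sum (`poincareInequality_full`).

Upper bound. A Sobolev function $g$ of the radius lifts to $g(\|x\|)$ with the same variance and
energy, the origin being removable since $n\ge2$ (`poincareInequality_radial`). Linear functions
have mean zero by symmetry and unit gradient; summing over an orthonormal basis bounds the gap by
$n\int\sigma^2d\mu/\int\|x\|^2d\mu$ (`mul_lintegral_norm_sq_le`), bounded odd truncations replacing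
them when they are not square integrable.

The spherical inequality comes from the Gaussian one. For a centred $F$, homogeneous of degree zero,
the function $|x|F(x)$ has Gaussian variance $n\int F^2d\kappa$ and energy $\int
F^2d\kappa+\int|\nabla F|^2d\kappa$, which gives the constant $n-1$. The Gaussian inequality is
proved in dimension one by completing a square, then tensorised.

Gap and Poincaré inequality are matched for abstract forms $\|w\|^2$ on a closed space of pairs
$(f,w)$: Poincaré makes the shifted form coercive off the constants, so Lax–Milgram produces the
resolvent; conversely $N=1-(1+A)^{-1}$ is bounded and a hole in its spectrum gives the inequality on
the closure of its range. Weighted Sobolev spaces fit this scheme through the pairs $(f,\sigma\nabla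
f)$, and mollification carries all pointwise computations over to weak gradients. -/

noncomputable section

/-! ### Spectral gap and Poincaré inequality for closed forms on Hilbert spaces. -/

section SpectralGap

variable {H : Type*} [NormedAddCommGroup H] [InnerProductSpace ℝ H]

/-- Cauchy–Schwarz for a positive symmetric operator. -/
theorem inner_apply_sq_le_of_nonneg {N : H →L[ℝ] H} (hs : ∀ x y, ⟪N x, y⟫_ℝ = ⟪x, N y⟫_ℝ)
    (hp : ∀ x, 0 ≤ ⟪N x, x⟫_ℝ) (x y : H) :
    ⟪N x, y⟫_ℝ ^ 2 ≤ ⟪N x, x⟫_ℝ * ⟪N y, y⟫_ℝ := by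
  have key : ∀ t : ℝ, 0 ≤ ⟪N x, x⟫_ℝ * (t * t) + (2 * ⟪N x, y⟫_ℝ) * t + ⟪N y, y⟫_ℝ := by
    intro t
    have h := hp (t • x + y)
    have e : ⟪N y, x⟫_ℝ = ⟪N x, y⟫_ℝ := by rw [hs, real_inner_comm]
    simp only [map_add, map_smul, inner_add_left, inner_add_right, real_inner_smul_left,
      real_inner_smul_right, e] at h
    linarith
  have := discrim_le_zero key
  unfold discrim at this
  nlinarith

/-- Cauchy–Schwarz for the form of `N`, tested at `y = N x`. It converts a lower bound on `‖N x‖`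
into one on the quadratic form. -/
theorem norm_apply_sq_le_of_nonneg {N : H →L[ℝ] H} (hs : ∀ x y, ⟪N x, y⟫_ℝ = ⟪x, N y⟫_ℝ)
    (hp : ∀ x, 0 ≤ ⟪N x, x⟫_ℝ) (x : H) : ‖N x‖ ^ 2 ≤ ‖N‖ * ⟪N x, x⟫_ℝ := by
  have h := inner_apply_sq_le_of_nonneg hs hp x (N x)
  rw [real_inner_self_eq_norm_sq] at h
  have h2 : ⟪N (N x), N x⟫_ℝ ≤ ‖N‖ * ‖N x‖ ^ 2 := by
    refine (real_inner_le_norm _ _).trans ?_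
    have := N.le_opNorm (N x)
    nlinarith [norm_nonneg (N x)]
  rcases (sq_nonneg ‖N x‖).eq_or_lt with h0 | h0
  · rw [← h0]; exact mul_nonneg (norm_nonneg _) (hp x)
  · have h3 : (‖N x‖ ^ 2) ^ 2 ≤ (‖N‖ * ⟪N x, x⟫_ℝ) * ‖N x‖ ^ 2 :=
      h.trans (by nlinarith [mul_le_mul_of_nonneg_left h2 (hp x)])
    nlinarith

/-- The supremum of the quadratic form of a symmetric operator `Q` is in its approximate spectrum:
if `Q - q` is bounded below whenever `q > 0` is an upper bound of the form, then `Q ≤ 0`. -/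
theorem inner_apply_nonpos_of_bddBelow {Q : H →L[ℝ] H} (hs : ∀ x y, ⟪Q x, y⟫_ℝ = ⟪x, Q y⟫_ℝ)
    {b : ℝ} (hb : ∀ x, ⟪Q x, x⟫_ℝ ≤ b * ‖x‖ ^ 2)
    (h : ∀ q, 0 < q → q ≤ b → ∃ c > 0, ∀ x, c * ‖x‖ ≤ ‖q • x - Q x‖) (x : H) :
    ⟪Q x, x⟫_ℝ ≤ 0 := by
  set A : Set ℝ := {q | 0 ≤ q ∧ ∀ x, ⟪Q x, x⟫_ℝ ≤ q * ‖x‖ ^ 2} with hA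
  have hbdd : BddBelow A := ⟨0, fun q hq => hq.1⟩
  have hne : A.Nonempty := ⟨max b 0, le_max_right _ _, fun x => (hb x).trans
    (mul_le_mul_of_nonneg_right (le_max_left _ _) (sq_nonneg _))⟩
  -- If this infimum were positive, then with `P = q - Q ≥ 0` bounded below, `‖P x‖² ≤ ‖P‖ ⟪P x, x⟫`
  -- would force `⟪P x, x⟫ ≥ c² / (‖P‖ + 1) * ‖x‖²`, that is, a strictly smaller upper bound for the
  -- form of `Q`.
  set q := sInf A with hq
  have hq0 : 0 ≤ q := le_csInf hne fun q hq => hq.1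
  have hqx : ∀ x, ⟪Q x, x⟫_ℝ ≤ q * ‖x‖ ^ 2 := by
    intro x
    rcases (sq_nonneg ‖x‖).eq_or_lt with h0 | h0
    · have : x = 0 := by simpa using h0.symm
      simp [this]
    · rw [← div_le_iff₀ h0]
      exact le_csInf hne fun p hp => (div_le_iff₀ h0).2 (hp.2 x)
  rcases hq0.eq_or_lt with h0 | h0
  · have := hqx x
    rwa [← h0, zero_mul] at this
  exfalso
  have hqb : q ≤ b ∨ b < q := le_or_gt q b
  rcases hqb with hqb | hqb
  · obtain ⟨c, hc, hcx⟩ := h q h0 hqb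
    set P : H →L[ℝ] H := q • ContinuousLinearMap.id ℝ H - Q with hP
    have hPx : ∀ x, P x = q • x - Q x := fun x => by simp [hP]
    have hPi : ∀ x, ⟪P x, x⟫_ℝ = q * ‖x‖ ^ 2 - ⟪Q x, x⟫_ℝ := fun x => by
      rw [hPx, inner_sub_left, real_inner_smul_left, real_inner_self_eq_norm_sq]
    have hPs : ∀ x y, ⟪P x, y⟫_ℝ = ⟪x, P y⟫_ℝ := fun x y => by
      rw [hPx, hPx, inner_sub_left, inner_sub_right, hs, real_inner_smul_left,
        real_inner_smul_right]
    have hPp : ∀ x, 0 ≤ ⟪P x, x⟫_ℝ := fun x => by rw [hPi]; linarith [hqx x]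
    have hPn : ∀ x, c ^ 2 * ‖x‖ ^ 2 ≤ (‖P‖ + 1) * ⟪P x, x⟫_ℝ := fun x => by
      have h1 := norm_apply_sq_le_of_nonneg hPs hPp x
      have h2 := hcx x
      rw [← hPx] at h2
      have h3 : (c * ‖x‖) ^ 2 ≤ ‖P x‖ ^ 2 := by
        gcongr
      nlinarith [hPp x]
    have hpos : 0 < ‖P‖ + 1 := by positivity
    have hd : 0 < c ^ 2 / (‖P‖ + 1) := by positivity
    have hmem : max (q - c ^ 2 / (‖P‖ + 1)) 0 ∈ A := by
      refine ⟨le_max_right _ _, fun x => ?_⟩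
      have h1 := hPn x
      rw [hPi] at h1
      have h2 : c ^ 2 / (‖P‖ + 1) * ‖x‖ ^ 2 ≤ q * ‖x‖ ^ 2 - ⟪Q x, x⟫_ℝ := by
        rw [div_mul_eq_mul_div, div_le_iff₀ hpos]
        linarith
      have h3 : (q - c ^ 2 / (‖P‖ + 1)) * ‖x‖ ^ 2 ≤
          max (q - c ^ 2 / (‖P‖ + 1)) 0 * ‖x‖ ^ 2 :=
        mul_le_mul_of_nonneg_right (le_max_left _ _) (sq_nonneg _)
      nlinarith
    have := csInf_le hbdd hmem
    rw [← hq] at this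
    rcases le_max_iff.1 this with h1 | h1 <;> linarith
  · have hmem : max b 0 ∈ A := ⟨le_max_right _ _, fun x => (hb x).trans
      (mul_le_mul_of_nonneg_right (le_max_left _ _) (sq_nonneg _))⟩
    have := csInf_le hbdd hmem
    rw [← hq] at this
    rcases le_max_iff.1 this with h1 | h1 <;> linarith

/-- If a positive operator `N` has no spectrum in `(0, δ)`, then `δ N ≤ N²`. -/
theorem inner_apply_le_norm_sq_of_gap {N : H →L[ℝ] H} (hs : ∀ x y, ⟪N x, y⟫_ℝ = ⟪x, N y⟫_ℝ)
    {δ : ℝ} (hδ : 0 < δ) (hgap : ∀ d, 0 < d → d < δ → ∃ c > 0, ∀ x, c * ‖x‖ ≤ ‖N x - d • x‖)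
    (x : H) :
    δ * ⟪N x, x⟫_ℝ ≤ ‖N x‖ ^ 2 := by
  set Q : H →L[ℝ] H := δ • N - N.comp N with hQ
  have hQx : ∀ x, Q x = δ • N x - N (N x) := fun x => by simp [hQ]
  have hQi : ∀ x, ⟪Q x, x⟫_ℝ = δ * ⟪N x, x⟫_ℝ - ‖N x‖ ^ 2 := fun x => by
    rw [hQx, inner_sub_left, real_inner_smul_left, hs (N x), real_inner_self_eq_norm_sq]
  -- The bound `(δ / 2) ^ 2` is the maximum of `t ↦ δ t - t²`.
  have := inner_apply_nonpos_of_bddBelow (Q := Q) (b := (δ / 2) ^ 2) ?_ ?_ ?_ x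
  · rw [hQi] at this; linarith
  · intro x y
    rw [hQx, hQx, inner_sub_left, inner_sub_right, real_inner_smul_left, real_inner_smul_right,
      hs, hs, hs x (N y)]
    
  · intro x
    rw [hQi]
    have h1 := real_inner_le_norm (N x) x
    nlinarith [sq_nonneg (‖N x‖ - δ / 2 * ‖x‖)]
  · intro q hq0 hqb
    -- The numbers `δ / 2 ± t` are the roots of `X² - δ X + q`, so `q - Q` factors as the product of
    -- `N` minus each root. Since `q > 0`, both roots lie strictly inside `(0, δ)`, where `N` has no
    -- spectrum.
    set t := Real.sqrt ((δ / 2) ^ 2 - q) with ht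
    have ht2 : t ^ 2 = (δ / 2) ^ 2 - q := Real.sq_sqrt (by linarith)
    have ht0 : 0 ≤ t := Real.sqrt_nonneg _
    have htd : t < δ / 2 := by nlinarith
    obtain ⟨c1, hc1, h1⟩ := hgap (δ / 2 + t) (by linarith) (by linarith)
    obtain ⟨c2, hc2, h2⟩ := hgap (δ / 2 - t) (by linarith) (by linarith)
    refine ⟨c1 * c2, by positivity, fun x => ?_⟩
    have e : q • x - Q x = N (N x - (δ / 2 - t) • x) - (δ / 2 + t) • (N x - (δ / 2 - t) • x) := by
      rw [hQx]
      simp only [map_sub, map_smul, smul_sub, smul_smul]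
      have : q = (δ / 2 + t) * (δ / 2 - t) := by nlinarith
      rw [this]
      module
    rw [e]
    calc c1 * c2 * ‖x‖ = c1 * (c2 * ‖x‖) := by ring
      _ ≤ c1 * ‖N x - (δ / 2 - t) • x‖ := by gcongr; exact h2 x
      _ ≤ _ := h1 _

variable {K : Type*} [NormedAddCommGroup K] [InnerProductSpace ℝ K]

/-- The graph of the operator associated with the quadratic form `(f, w) ↦ ‖w‖²` on the space `D`
of pairs. -/
def FormGraph (D : Submodule ℝ (WithLp 2 (H × K))) (f g : H) : Prop :=
  ∃ w, WithLp.toLp 2 (f, w) ∈ D ∧ ∀ q ∈ D, ⟪w, q.snd⟫_ℝ = ⟪g, q.fst⟫_ℝ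

theorem FormGraph.sub {D : Submodule ℝ (WithLp 2 (H × K))} {f g f' g' : H}
    (h : FormGraph D f g) (h' : FormGraph D f' g') : FormGraph D (f - f') (g - g') := by
  obtain ⟨w, hw, hq⟩ := h
  obtain ⟨w', hw', hq'⟩ := h'
  refine ⟨w - w', D.sub_mem hw hw', fun q hqD => ?_⟩
  rw [inner_sub_left, inner_sub_left, hq q hqD, hq' q hqD]

variable [CompleteSpace H] [CompleteSpace K]

/-- Lax–Milgram for the shifted form. -/
theorem exists_solution_of_coercive {D : Submodule ℝ (WithLp 2 (H × K))}
    (hD : IsClosed (D : Set (WithLp 2 (H × K)))) {l c : ℝ} (hc : 0 < c)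
    (hcoer : ∀ q ∈ D, c * (‖q.fst‖ ^ 2 + ‖q.snd‖ ^ 2) ≤ ‖q.snd‖ ^ 2 - l * ‖q.fst‖ ^ 2) :
    ∃ S : H →L[ℝ] WithLp 2 (H × K), ∀ u, S u ∈ D ∧
      ∀ q ∈ D, ⟪(S u).snd, q.snd⟫_ℝ - l * ⟪(S u).fst, q.fst⟫_ℝ = ⟪u, q.fst⟫_ℝ := by
  have : CompleteSpace D := hD.completeSpace_coe
  set F : D →L[ℝ] H := (WithLp.fstL 2 ℝ H K).comp D.subtypeL with hF
  set G : D →L[ℝ] K := (WithLp.sndL 2 ℝ H K).comp D.subtypeL with hG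
  set B : D →L[ℝ] D →L[ℝ] ℝ :=
    (innerSL ℝ).bilinearComp G G - l • (innerSL ℝ).bilinearComp F F with hB
  have hBx : ∀ p q : D, B p q = ⟪p.1.snd, q.1.snd⟫_ℝ - l * ⟪p.1.fst, q.1.fst⟫_ℝ := by
    intro p q
    simp [hB, hF, hG]
  have hco : IsCoercive B := by
    refine ⟨c, hc, fun q => ?_⟩
    rw [hBx, real_inner_self_eq_norm_sq, real_inner_self_eq_norm_sq]
    have h1 := hcoer q.1 q.2
    have h2 : ‖q‖ ^ 2 = ‖q.1.fst‖ ^ 2 + ‖q.1.snd‖ ^ 2 := WithLp.prod_norm_sq_eq_of_L2 q.1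
    rw [mul_assoc, ← sq, h2]
    exact h1
  -- The adjoint of the first projection sends `u` to the Riesz representative in `D` of `q ↦ ⟪u,
  -- q.fst⟫`.
  set Φ : H →L[ℝ] D := (F.adjoint) with hΦ
  refine ⟨D.subtypeL.comp ((hco.continuousLinearEquivOfBilin.symm : D →L[ℝ] D).comp Φ),
    fun u => ⟨Subtype.mem _, fun q hq => ?_⟩⟩
  have h := hco.continuousLinearEquivOfBilin_apply
    (hco.continuousLinearEquivOfBilin.symm (Φ u)) ⟨q, hq⟩
  rw [ContinuousLinearEquiv.apply_symm_apply, hBx, hΦ, ContinuousLinearMap.adjoint_inner_left] at h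
  exact h.symm

/-- Off the line spanned by `e` the form shifted by `l` is coercive, so Lax–Milgram inverts `A - l`
there; on that line `A = 0`, so the inverse is `-l⁻¹`. The two pieces add up to the resolvent. -/
theorem mem_graphResolventSet_of_poincare {D : Submodule ℝ (WithLp 2 (H × K))}
    (hD : IsClosed (D : Set (WithLp 2 (H × K)))) {e : H} (he : ‖e‖ = 1)
    (heD : WithLp.toLp 2 (e, (0 : K)) ∈ D) {a l : ℝ}
    (hP : ∀ q ∈ D, ⟪e, q.fst⟫_ℝ = 0 → a * ‖q.fst‖ ^ 2 ≤ ‖q.snd‖ ^ 2) (hl0 : l ≠ 0) (hl : l < a) :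
    l ∈ graphResolventSet (FormGraph D) := by
  set D' : Submodule ℝ (WithLp 2 (H × K)) :=
    D ⊓ LinearMap.ker (((innerSL ℝ e).comp (WithLp.fstL 2 ℝ H K) : WithLp 2 (H × K) →L[ℝ] ℝ) :
      WithLp 2 (H × K) →ₗ[ℝ] ℝ) with hD'
  have hmem : ∀ q, q ∈ D' ↔ q ∈ D ∧ ⟪e, q.fst⟫_ℝ = 0 := by
    intro q
    simp [hD', LinearMap.mem_ker]
  have hD'c : IsClosed (D' : Set (WithLp 2 (H × K))) := by
    have : (D' : Set (WithLp 2 (H × K))) = (D : Set _) ∩ {q | ⟪e, q.fst⟫_ℝ = 0} := by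
      ext q; exact hmem q
    rw [this]
    refine hD.inter (isClosed_eq ?_ continuous_const)
    exact continuous_const.inner (WithLp.fstL 2 ℝ H K).continuous
  obtain ⟨c, hc, hcoer⟩ : ∃ c > 0, ∀ q ∈ D',
      c * (‖q.fst‖ ^ 2 + ‖q.snd‖ ^ 2) ≤ ‖q.snd‖ ^ 2 - l * ‖q.fst‖ ^ 2 := by
    rcases lt_or_gt_of_ne hl0 with hneg | hpos
    · refine ⟨min 1 (-l), lt_min one_pos (by linarith), fun q _ => ?_⟩
      nlinarith [min_le_left 1 (-l), min_le_right 1 (-l), sq_nonneg ‖q.fst‖, sq_nonneg ‖q.snd‖]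
    -- This constant is the best one when `‖q.snd‖² = a ‖q.fst‖²`, the worst case allowed by the
    -- Poincaré inequality.
    · refine ⟨(a - l) / (a + 1), div_pos (by linarith) (by linarith), fun q hq => ?_⟩
      have h := hP q ((hmem q).1 hq).1 ((hmem q).1 hq).2
      rw [div_mul_eq_mul_div, div_le_iff₀ (by linarith)]
      nlinarith
  obtain ⟨S, hS⟩ := exists_solution_of_coercive hD'c hc hcoer
  have hee : ⟪e, e⟫_ℝ = 1 := by rw [real_inner_self_eq_norm_sq, he, one_pow]
  set R : H →L[ℝ] H := (WithLp.fstL 2 ℝ H K).comp S - l⁻¹ • (innerSL ℝ e).smulRight e with hR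
  have hRx : ∀ u, R u = (S u).fst - (l⁻¹ * ⟪e, u⟫_ℝ) • e := by
    intro u
    simp [hR, smul_smul]
  have hex : ∀ u, FormGraph D (R u) (l • R u + u) := by
    intro u
    obtain ⟨hm, ht⟩ := hS u
    obtain ⟨hm1, hm2⟩ := (hmem _).1 hm
    refine ⟨(S u).snd, ?_, fun q hq => ?_⟩
    · have := D.sub_mem hm1 (D.smul_mem (l⁻¹ * ⟪e, u⟫_ℝ) heD)
      have e1 : WithLp.toLp 2 (R u, (S u).snd) =
          S u - (l⁻¹ * ⟪e, u⟫_ℝ) • WithLp.toLp 2 (e, (0 : K)) := by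
        rw [hRx]
        change _ = WithLp.toLp 2 ((S u).fst - (l⁻¹ * ⟪e, u⟫_ℝ) • e,
          (S u).snd - (l⁻¹ * ⟪e, u⟫_ℝ) • (0 : K))
        rw [smul_zero, sub_zero]
      rwa [e1]
    -- The equation holds against `D'` only; subtracting the component of `q` along `(e, 0)` reduces
    -- any test pair to that case.
    · have hq' : q - ⟪e, q.fst⟫_ℝ • WithLp.toLp 2 (e, (0 : K)) ∈ D' := by
        refine (hmem _).2 ⟨D.sub_mem hq (D.smul_mem _ heD), ?_⟩
        change ⟪e, q.fst - ⟪e, q.fst⟫_ℝ • e⟫_ℝ = 0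
        rw [inner_sub_right, real_inner_smul_right, hee, mul_one, sub_self]
      have : ⟪(S u).snd, q.snd - ⟪e, q.fst⟫_ℝ • (0 : K)⟫_ℝ
          - l * ⟪(S u).fst, q.fst - ⟪e, q.fst⟫_ℝ • e⟫_ℝ = ⟪u, q.fst - ⟪e, q.fst⟫_ℝ • e⟫_ℝ :=
        ht _ hq'
      simp only [smul_zero, sub_zero, inner_sub_right, real_inner_smul_right] at this
      have hm3 : ⟪(S u).fst, e⟫_ℝ = 0 := by rw [real_inner_comm]; exact hm2
      rw [hRx]
      simp only [inner_add_left, inner_sub_left, real_inner_smul_left, smul_sub, smul_smul]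
      have h4 : l * (l⁻¹ * ⟪e, u⟫_ℝ) = ⟪u, e⟫_ℝ := by rw [real_inner_comm]; field_simp
      rw [hm3] at this
      rw [h4]
      linarith
  refine ⟨R, fun u f => ⟨fun hf => ?_, fun hf => hf ▸ hex u⟩⟩
  -- Uniqueness: the difference `d` satisfies `A d = l d`. Testing with `(e, 0)` makes it orthogonal
  -- to `e`, and testing with itself contradicts coercivity unless `d = 0`.
  have hd := hf.sub (hex u)
  set d := f - R u with hdd
  have e1 : l • f + u - (l • R u + u) = l • d := by rw [hdd]; module
  rw [e1] at hd
  obtain ⟨w, hw, ht⟩ := hd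
  have h1 : ⟪w, (0 : K)⟫_ℝ = ⟪l • d, e⟫_ℝ := ht _ heD
  have h2 : ⟪w, w⟫_ℝ = ⟪l • d, d⟫_ℝ := ht _ hw
  simp only [inner_zero_right, real_inner_smul_left] at h1 h2
  rw [real_inner_self_eq_norm_sq, real_inner_self_eq_norm_sq] at h2
  have h3 : ⟪e, d⟫_ℝ = 0 := by
    rw [real_inner_comm]
    rcases mul_eq_zero.1 h1.symm with h | h
    · exact absurd h hl0
    · exact h
  have h4 : c * (‖d‖ ^ 2 + ‖w‖ ^ 2) ≤ ‖w‖ ^ 2 - l * ‖d‖ ^ 2 := hcoer _ ((hmem _).2 ⟨hw, h3⟩)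
  have h5 : ‖d‖ ^ 2 ≤ 0 := by nlinarith [sq_nonneg ‖w‖]
  have h6 : d = 0 := by
    have := sq_nonneg ‖d‖
    have : ‖d‖ ^ 2 = 0 := le_antisymm h5 this
    simpa using this
  exact sub_eq_zero.1 h6

/-- No spectral theorem for unbounded operators is required: `R = (1 + A)⁻¹` is bounded, and a hole
`(0, a)` in the spectrum of `A` becomes a hole `(0, a / (1 + a))` for the positive operator `N = 1 -
R`. The resulting form bound holds on the closure of the range of `N`, which is the orthogonal
complement of its kernel and so contains everything orthogonal to `e`. -/
theorem poincare_of_forall_mem_graphResolventSet {D : Submodule ℝ (WithLp 2 (H × K))}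
    (hD : IsClosed (D : Set (WithLp 2 (H × K)))) {e : H}
    (hker : ∀ f, WithLp.toLp 2 (f, (0 : K)) ∈ D → ∃ t : ℝ, f = t • e) {a : ℝ} (ha : 0 < a)
    (hres : ∀ l, 0 < l → l < a → l ∈ graphResolventSet (FormGraph D))
    {q : WithLp 2 (H × K)} (hq : q ∈ D) (hqe : ⟪e, q.fst⟫_ℝ = 0) :
    a * ‖q.fst‖ ^ 2 ≤ ‖q.snd‖ ^ 2 := by
  obtain ⟨S, hS⟩ := exists_solution_of_coercive hD (l := -1) (c := 1) one_pos
    (fun q _ => by linarith)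
  set R : H →L[ℝ] H := (WithLp.fstL 2 ℝ H K).comp S with hR
  have hRx : ∀ u, R u = (S u).fst := fun u => rfl
  have hSt : ∀ u, ∀ q ∈ D, ⟪(S u).snd, q.snd⟫_ℝ + ⟪R u, q.fst⟫_ℝ = ⟪u, q.fst⟫_ℝ := by
    intro u q hq
    rw [hRx, ← (hS u).2 q hq]; ring
  have hRs : ∀ x y, ⟪R x, y⟫_ℝ = ⟪x, R y⟫_ℝ := by
    intro x y
    have h1 := hSt x (S y) (hS y).1
    have h2 := hSt y (S x) (hS x).1
    rw [← hRx] at h1 h2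
    rw [← h1, real_inner_comm, ← h2, real_inner_comm, real_inner_comm (R x)]
  have hRi : ∀ x, ⟪R x, x⟫_ℝ = ‖(S x).snd‖ ^ 2 + ‖R x‖ ^ 2 := by
    intro x
    have h1 := hSt x (S x) (hS x).1
    rw [← hRx, real_inner_self_eq_norm_sq, real_inner_self_eq_norm_sq] at h1
    rw [h1, real_inner_comm]
  have hRn : ∀ x, ‖R x‖ ≤ ‖x‖ := by
    intro x
    have h1 := hRi x
    have h2 := real_inner_le_norm (R x) x
    by_contra! h
    nlinarith [sq_nonneg ‖(S x).snd‖, norm_nonneg x]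
  set N : H →L[ℝ] H := ContinuousLinearMap.id ℝ H - R with hN
  have hNx : ∀ x, N x = x - R x := fun x => by simp [hN]
  have hNs : ∀ x y, ⟪N x, y⟫_ℝ = ⟪x, N y⟫_ℝ := by
    intro x y
    rw [hNx, hNx, inner_sub_left, inner_sub_right, hRs]
  have hNp : ∀ x, 0 ≤ ⟪N x, x⟫_ℝ := by
    intro x
    rw [hNx, inner_sub_left, real_inner_self_eq_norm_sq]
    have h2 := real_inner_le_norm (R x) x
    nlinarith [hRn x, norm_nonneg x]
  set δ := a / (1 + a) with hδ
  have hδ0 : 0 < δ := by positivity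
  have hgap : ∀ d, 0 < d → d < δ → ∃ c > 0, ∀ x, c * ‖x‖ ≤ ‖N x - d • x‖ := by
    intro d hd0 hd
    have hd1 : d < 1 := hd.trans (by rw [hδ, div_lt_one (by linarith)]; linarith)
    -- Inverse of the map `t ↦ t / (1 + t)` from the spectrum of `A` to that of `N`.
    set l := d / (1 - d) with hl
    have hl0 : 0 < l := div_pos hd0 (by linarith)
    have hla : l < a := by
      rw [hl, div_lt_iff₀ (by linarith)]
      rw [hδ, lt_div_iff₀ (by linarith)] at hd
      linarith
    have hl1 : (1 + l) * (1 - d) = 1 := by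
      have : 1 - d ≠ 0 := by linarith
      rw [hl]; field_simp; ring
    obtain ⟨T, hT⟩ := hres l hl0 hla
    -- With `u = N x - d x`, the vector `R x` solves `(A - l)(R x) = (1 + l) u`, so the resolvent
    -- `T` at `l` recovers `R x`, and then `x`, from `u` alone.
    have hx : ∀ x, x = (1 + l) • ((1 + l) • T (N x - d • x) + (N x - d • x)) := by
      intro x
      set u := N x - d • x with hu
      have e1 : R x = (1 - d) • x - u := by rw [hu, hNx]; module
      have hΓ : FormGraph D (R x) (x - R x) := by
        refine ⟨(S x).snd, (hS x).1, fun q hq => ?_⟩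
        rw [inner_sub_left, ← hSt x q hq]; ring
      have e2 : x - R x = l • R x + (1 + l) • u := by
        have : x = ((1 + l) * (1 - d)) • x := by rw [hl1, one_smul]
        have h3 : x = (1 + l) • (R x + u) := by
          rw [e1]; nth_rewrite 1 [this]; module
        nth_rewrite 1 [h3]; module
      rw [e2] at hΓ
      have := (hT _ _).1 hΓ
      rw [map_smul] at this
      rw [← this, e1]
      nth_rewrite 1 [← one_smul ℝ x, ← hl1]
      module
    refine ⟨((1 + l) * ((1 + l) * ‖T‖ + 1))⁻¹, by positivity, fun x => ?_⟩
    rw [inv_mul_le_iff₀ (by positivity)]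
    set u := N x - d • x with hu
    rw [hx x, norm_smul, ← hu, Real.norm_of_nonneg (by linarith), mul_assoc]
    gcongr
    refine (norm_add_le _ _).trans ?_
    rw [norm_smul, Real.norm_of_nonneg (by linarith)]
    nlinarith [T.le_opNorm u]
  have h2 := inner_apply_le_norm_sq_of_gap hNs hδ0 hgap
  -- From `δ N ≤ N²` to `δ ≤ N` on the range: Cauchy–Schwarz for the form of `N` gives `‖N x‖⁴ ≤ ⟪N
  -- (N x), N x⟫ ⟪N x, x⟫`.
  have hrange : ∀ x, δ * ‖N x‖ ^ 2 ≤ ⟪N (N x), N x⟫_ℝ := by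
    intro x
    have h3 := inner_apply_sq_le_of_nonneg hNs hNp (N x) x
    have h4 : ⟪N (N x), x⟫_ℝ = ‖N x‖ ^ 2 := by rw [hNs, real_inner_self_eq_norm_sq]
    rw [h4] at h3
    rcases (sq_nonneg ‖N x‖).eq_or_lt with h0 | h0
    · rw [← h0, mul_zero]; exact hNp _
    · have h5 : δ * (‖N x‖ ^ 2) ^ 2 ≤ ⟪N (N x), N x⟫_ℝ * ‖N x‖ ^ 2 := by
        have := mul_le_mul_of_nonneg_left (h2 x) (hNp (N x))
        nlinarith
      nlinarith
  have hclos : ∀ y ∈ closure (Set.range N), δ * ‖y‖ ^ 2 ≤ ⟪N y, y⟫_ℝ := by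
    intro y hy
    refine closure_minimal (s := Set.range N) (t := {y | δ * ‖y‖ ^ 2 ≤ ⟪N y, y⟫_ℝ}) ?_ ?_ hy
    · rintro _ ⟨x, rfl⟩; exact hrange x
    · exact isClosed_le (by fun_prop) (N.continuous.inner continuous_id)
  have hqcl : q.fst ∈ closure (Set.range N) := by
    have hcl : closure (Set.range N) = ((LinearMap.range (N : H →ₗ[ℝ] H)).topologicalClosure :
        Set H) := by
      rw [Submodule.topologicalClosure_coe]; rfl
    rw [hcl, SetLike.mem_coe, ← Submodule.orthogonal_orthogonal_eq_closure,
      Submodule.mem_orthogonal]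
    intro u hu
    have hu0 : N u = 0 := by
      have := (Submodule.mem_orthogonal _ _).1 hu (N (N u)) ⟨N u, rfl⟩
      rw [hNs, real_inner_self_eq_norm_sq] at this
      simpa using this
    rw [hNx, sub_eq_zero] at hu0
    have h6 := hRi u
    rw [← hu0, real_inner_self_eq_norm_sq] at h6
    have h7 : (S u).snd = 0 := by
      have : ‖(S u).snd‖ ^ 2 = 0 := by linarith
      simpa using this
    have h8 : WithLp.toLp 2 (u, (0 : K)) ∈ D := by
      have h9 := (hS u).1
      have : S u = WithLp.toLp 2 (u, (0 : K)) := by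
        change WithLp.toLp 2 ((S u).fst, (S u).snd) = _
        rw [h7, ← hRx, ← hu0]
      rwa [this] at h9
    obtain ⟨t, ht⟩ := hker u h8
    rw [ht, real_inner_smul_left, hqe, mul_zero]
  have h3 := hclos _ hqcl
  set f := q.fst with hf
  rw [hNx, inner_sub_left, real_inner_self_eq_norm_sq, hRi] at h3
  have h4 := hSt f q hq
  rw [← hf, real_inner_self_eq_norm_sq] at h4
  have h5 := real_inner_le_norm (S f).snd q.snd
  have h6 := real_inner_le_norm (R f) f
  set s1 := ‖(S f).snd‖
  set r1 := ‖R f‖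
  set fn := ‖f‖
  set w := ‖q.snd‖
  -- This is `(1 + a) ⟪R f, f⟫ ≤ ‖f‖²`. Testing the equation of `R f` with `q` itself and applying
  -- Cauchy–Schwarz to the full form norm turns it into the bound for `q`.
  have h7 : (1 + a) * (s1 ^ 2 + r1 ^ 2) ≤ fn ^ 2 := by
    have : δ * (1 + a) = a := by rw [hδ]; field_simp
    nlinarith
  have h8 : (fn ^ 2) ^ 2 ≤ (s1 ^ 2 + r1 ^ 2) * (w ^ 2 + fn ^ 2) := by
    have h9 : fn ^ 2 ≤ s1 * w + r1 * fn := by linarith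
    have h10 : (fn ^ 2) ^ 2 ≤ (s1 * w + r1 * fn) ^ 2 := by gcongr
    nlinarith [sq_nonneg (s1 * fn - r1 * w)]
  rcases (sq_nonneg fn).eq_or_lt with h0 | h0
  · rw [← h0, mul_zero]; positivity
  · have h9 : (1 + a) * (fn ^ 2) ^ 2 ≤ fn ^ 2 * (w ^ 2 + fn ^ 2) := by
      nlinarith [mul_le_mul_of_nonneg_right h7 (by positivity : 0 ≤ w ^ 2 + fn ^ 2)]
    nlinarith

end SpectralGap

end


noncomputable section

/-! ### Mollification of functions and of weak gradients. -/

section Mollification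

open scoped Convolution
open ContinuousLinearMap (lsmul)

variable {E : Type*} [NormedAddCommGroup E] [InnerProductSpace ℝ E] [FiniteDimensional ℝ E]
  [MeasurableSpace E] [BorelSpace E] {F : Type*} [NormedAddCommGroup F]

/-- Continuity of translations in `L²`. -/
theorem tendsto_eLpNorm_translate_sub {f : E → F} (hf : MemLp f 2 volume) :
    Tendsto (fun t : E => eLpNorm (fun x => f (x - t) - f x) 2 volume) (𝓝 0) (𝓝 0) := by
  set g : E → C(E, E) := fun t => ⟨fun x => x - t, by fun_prop⟩ with hg
  have hgc : Continuous g := by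
    refine ContinuousMap.continuous_of_continuous_uncurry _ ?_
    change Continuous fun p : E × E => p.2 - p.1
    fun_prop
  have hgm : ∀ t, MeasurePreserving (g t) (volume : Measure E) volume :=
    fun t => measurePreserving_sub_right volume t
  have : Fact ((1 : ℝ≥0∞) ≤ 2) := ⟨by norm_num⟩
  have h1 := (tendsto_const_nhds (x := hf.toLp f)).compMeasurePreservingLp
    (hgc.tendsto 0) hgm (hgm 0) (by norm_num)
  have h2 : Lp.compMeasurePreserving (g 0) (hgm 0) (hf.toLp f) = hf.toLp f := by
    rw [Lp.toLp_compMeasurePreserving]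
    congr 1
    ext x
    simp [hg]
  rw [h2, tendsto_iff_edist_tendsto_0] at h1
  refine h1.congr fun t => ?_
  rw [Lp.toLp_compMeasurePreserving, Lp.edist_toLp_toLp]
  rfl

variable [NormedSpace ℝ F] [CompleteSpace F]

theorem eLpNorm_two_sq {α : Type*} [MeasurableSpace α] {μ : Measure α} {F : Type*}
    [NormedAddCommGroup F] (f : α → F) : eLpNorm f 2 μ ^ 2 = ∫⁻ x, ‖f x‖ₑ ^ 2 ∂μ := by
  have := eLpNorm_nnreal_pow_eq_lintegral (f := f) (μ := μ) (p := 2) (by norm_num)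
  simpa using this

theorem lintegral_sq_le_of_isProbabilityMeasure {α : Type*} [MeasurableSpace α] {μ : Measure α}
    [IsProbabilityMeasure μ] {f : α → ℝ≥0∞} (hf : AEMeasurable f μ) :
    (∫⁻ x, f x ∂μ) ^ 2 ≤ ∫⁻ x, f x ^ 2 ∂μ := by
  have := ENNReal.lintegral_mul_le_Lp_mul_Lq μ Real.HolderConjugate.two_two hf
    (aemeasurable_const (b := (1 : ℝ≥0∞)))
  simp only [Pi.mul_apply, mul_one, ENNReal.one_rpow, lintegral_const, measure_univ] at this
  calc (∫⁻ x, f x ∂μ) ^ 2 ≤ ((∫⁻ x, f x ^ (2 : ℝ) ∂μ) ^ (1 / 2 : ℝ)) ^ 2 := by gcongr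
    _ = ∫⁻ x, f x ^ 2 ∂μ := by
      rw [← ENNReal.rpow_natCast, ← ENNReal.rpow_mul]
      simp

/-- Mollification converges in `L²`. -/
theorem tendsto_eLpNorm_convolution_sub {φ : ℕ → ContDiffBump (0 : E)}
    (hφ : Tendsto (fun j => (φ j).rOut) atTop (𝓝 0)) {f : E → F} (hf : MemLp f 2 volume) :
    Tendsto (fun j => eLpNorm
      (fun x => ((φ j).normed volume ⋆[lsmul ℝ ℝ, volume] f : E → F) x - f x) 2 volume)
      atTop (𝓝 0) := by
  -- A genuinely measurable representative is needed for `(x, t) ↦ f (x - t)` to be jointly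
  -- measurable, hence for Tonelli.
  wlog hm : StronglyMeasurable f generalizing f
  · have h1 := this (hf.ae_eq hf.1.ae_eq_mk) hf.1.stronglyMeasurable_mk
    refine h1.congr fun j => ?_
    rw [convolution_congr (f' := (φ j).normed volume) (g' := f) _ (EventuallyEq.refl _ _)
      hf.1.ae_eq_mk.symm]
    refine eLpNorm_congr_ae ?_
    filter_upwards [hf.1.ae_eq_mk] with x hx
    rw [hx]
  have hfl : LocallyIntegrable f volume := hf.locallyIntegrable (by norm_num)
  have ht := tendsto_eLpNorm_translate_sub hf
  rw [ENNReal.tendsto_nhds_zero] at ht ⊢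
  intro ε hε
  obtain ⟨r, hr, hball⟩ := Metric.eventually_nhds_iff_ball.1 (ht ε hε)
  filter_upwards [hφ.eventually (gt_mem_nhds hr)] with j hj
  set ρ := (φ j).normed (volume : Measure E) with hρ
  have hρc : Continuous ρ := (φ j).continuous_normed
  set P : Measure E := volume.withDensity fun t => ENNReal.ofReal (ρ t) with hP
  have hρm : Measurable fun t => ENNReal.ofReal (ρ t) := hρc.measurable.ennreal_ofReal
  have hPp : IsProbabilityMeasure P := by
    refine ⟨?_⟩
    rw [hP, withDensity_apply _ MeasurableSet.univ, Measure.restrict_univ,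
      ← ofReal_integral_eq_lintegral_ofReal (φ j).integrable_normed
        (Eventually.of_forall (φ j).nonneg_normed), (φ j).integral_normed, ENNReal.ofReal_one]
  have hmu : Measurable fun p : E × E => ‖f (p.1 - p.2) - f p.1‖ₑ :=
    ((hm.comp_measurable (measurable_fst.sub measurable_snd)).sub
      (hm.comp_measurable measurable_fst)).enorm
  -- Jensen for the probability measure with density `ρ`: the error at `x` is an average of `f (x -
  -- t) - f x`. Integrating in `x` then leaves only translations by less than `r`.
  have hpt : ∀ x, ‖(ρ ⋆[lsmul ℝ ℝ, volume] f : E → F) x - f x‖ₑ ^ 2 ≤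
      ∫⁻ t, ‖f (x - t) - f x‖ₑ ^ 2 ∂P := by
    intro x
    have e1 : (ρ ⋆[lsmul ℝ ℝ, volume] f : E → F) x - f x = ∫ t, ρ t • (f (x - t) - f x) := by
      simp_rw [smul_sub]
      rw [integral_sub, (φ j).integral_normed_smul, convolution_lsmul]
      · exact (φ j).hasCompactSupport_normed.convolutionExists_left (lsmul ℝ ℝ) hρc hfl x
      · exact ((φ j).integrable_normed).smul_const _
    have e2 : ‖(ρ ⋆[lsmul ℝ ℝ, volume] f : E → F) x - f x‖ₑ ≤ ∫⁻ t, ‖f (x - t) - f x‖ₑ ∂P := by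
      rw [e1]
      refine (enorm_integral_le_lintegral_enorm _).trans_eq ?_
      have hmx : Measurable fun t => ‖f (x - t) - f x‖ₑ :=
        hmu.comp (measurable_const.prodMk measurable_id)
      rw [hP, lintegral_withDensity_eq_lintegral_mul _ hρm hmx]
      refine lintegral_congr fun t => ?_
      rw [enorm_smul, Real.enorm_eq_ofReal ((φ j).nonneg_normed t)]
      rfl
    calc _ ≤ (∫⁻ t, ‖f (x - t) - f x‖ₑ ∂P) ^ 2 := by gcongr
      _ ≤ _ := lintegral_sq_le_of_isProbabilityMeasure
        (hmu.comp (measurable_const.prodMk measurable_id)).aemeasurable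
  have hsq : eLpNorm (fun x => (ρ ⋆[lsmul ℝ ℝ, volume] f : E → F) x - f x) 2 volume ^ 2
      ≤ ε ^ 2 := by
    rw [eLpNorm_two_sq]
    calc _ ≤ ∫⁻ x, ∫⁻ t, ‖f (x - t) - f x‖ₑ ^ 2 ∂P := lintegral_mono hpt
      _ = ∫⁻ t, ∫⁻ x, ‖f (x - t) - f x‖ₑ ^ 2 ∂volume ∂P :=
        lintegral_lintegral_swap (hmu.pow_const 2).aemeasurable
      _ ≤ ∫⁻ t, ε ^ 2 ∂P := by
        refine lintegral_mono_ae ?_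
        rw [hP, ae_withDensity_iff hρm]
        refine Eventually.of_forall fun t ht => ?_
        have h3 : t ∈ Metric.ball (0 : E) r := by
          have : t ∈ Function.support ρ := by
            intro h0
            exact ht (by rw [h0, ENNReal.ofReal_zero])
          rw [hρ, (φ j).support_normed_eq] at this
          exact Metric.ball_subset_ball hj.le this
        have h4 := hball t h3
        rw [← eLpNorm_two_sq]
        gcongr
      _ = ε ^ 2 := by simp
  exact (ENNReal.pow_le_pow_left_iff (by norm_num)).1 hsq

omit [MeasurableSpace E] [BorelSpace E] in
theorem gradient_eq_zero_of_notMem_tsupport {φ : E → ℝ} {x : E} (hx : x ∉ tsupport φ) :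
    ∇ φ x = 0 := by
  have : fderiv ℝ φ x = 0 := by
    by_contra h0
    exact hx (support_fderiv_subset ℝ h0)
  simp [gradient, this]

omit [MeasurableSpace E] [BorelSpace E] in
theorem continuous_gradient {φ : E → ℝ} (hφ : ContDiff ℝ ∞ φ) : Continuous (∇ φ) :=
  (InnerProductSpace.toDual ℝ E).symm.continuous.comp (hφ.continuous_fderiv (by simp))

/-- The gradient of the mollification of `f` is the mollification of its weak gradient. -/
theorem HasWeakGradient.gradient_convolution {U : Set E} {f : E → ℝ} {G : E → E}
    (h : HasWeakGradient U f G) {K : Set E} (hK : MeasurableSet K) (hKU : K ⊆ U)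
    (hf : IntegrableOn f K) (φ : ContDiffBump (0 : E)) {x : E}
    (hx : Metric.closedBall x φ.rOut ⊆ K) :
    ∇ (φ.normed volume ⋆[lsmul ℝ ℝ, volume] K.indicator f) x =
      (φ.normed volume ⋆[lsmul ℝ ℝ, volume] K.indicator G : E → E) x := by
  set ρ := φ.normed (volume : Measure E) with hρ
  -- The weak gradient is tested against the reflected kernel centred at `x`; the reflection
  -- supplies a sign that cancels the one in the definition. The kernel lives in `K`, so truncating
  -- `f` and `G` outside `K` changes nothing.
  set ψ : E → ℝ := fun t => ρ (x - t) with hψ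
  have hρs : ContDiff ℝ ∞ ρ := φ.contDiff_normed
  have hψs : ContDiff ℝ ∞ ψ := hρs.comp (contDiff_const.sub contDiff_id)
  have hψt : tsupport ψ ⊆ Metric.closedBall x φ.rOut := by
    refine closure_minimal (fun t ht => ?_) Metric.isClosed_closedBall
    have : x - t ∈ Function.support ρ := ht
    rw [hρ, φ.support_normed_eq, mem_ball_zero_iff] at this
    rw [mem_closedBall_iff_norm']
    exact this.le
  have hψc : HasCompactSupport ψ :=
    (isCompact_closedBall x φ.rOut).of_isClosed_subset (isClosed_tsupport _) hψt
  have hψU : tsupport ψ ⊆ U := hψt.trans (hx.trans hKU)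
  have hfl : LocallyIntegrable (K.indicator f) volume :=
    (hf.integrable_indicator hK).locallyIntegrable
  have hψg : ∀ t, fderiv ℝ ψ t = -fderiv ℝ ρ (x - t) := by
    intro t
    have h1 : HasFDerivAt (fun t => x - t) (-(ContinuousLinearMap.id ℝ E)) t := by
      simpa using (hasFDerivAt_id t).const_sub x
    have h2 := ((hρs.differentiable (by simp)) (x - t)).hasFDerivAt.comp t h1
    have h3 : fderiv ℝ ψ t = (fderiv ℝ ρ (x - t)).comp (-(ContinuousLinearMap.id ℝ E)) := h2.fderiv
    rw [h3]
    ext v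
    simp
  have hgr : ∀ t, ∇ ψ t = -(∇ ρ (x - t)) := by
    intro t
    simp [gradient, hψg]
  have hder := φ.hasCompactSupport_normed.hasFDerivAt_convolution_left (lsmul ℝ ℝ)
    (hρs.of_le (by simp)) hfl x
  have hRHS : (ρ ⋆[lsmul ℝ ℝ, volume] K.indicator G : E → E) x = ∫ t, ψ t • G t := by
    rw [convolution_lsmul_swap]
    refine integral_congr_ae (Eventually.of_forall fun t => ?_)
    by_cases ht : t ∈ K
    · simp [ht, hψ]
    · have : ψ t = 0 := image_eq_zero_of_notMem_tsupport fun h => ht (hx (hψt h))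
      simp only [hψ] at this
      simp [ht, this, hψ]
  have hLHS : ∫ t, f t • ∇ ψ t = ∫ t, K.indicator f t • ∇ ψ t := by
    refine integral_congr_ae (Eventually.of_forall fun t => ?_)
    by_cases ht : t ∈ K
    · simp [ht]
    · simp [gradient_eq_zero_of_notMem_tsupport fun h => ht (hx (hψt h))]
  have hint : Integrable (fun t => K.indicator f t • ∇ ψ t) := by
    have hb : ∃ C, ∀ t, ‖∇ ψ t‖ ≤ C := by
      refine HasCompactSupport.exists_bound_of_continuous (f := ∇ ψ) ?_ (continuous_gradient hψs)
      exact HasCompactSupport.intro hψc fun t ht => gradient_eq_zero_of_notMem_tsupport ht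
    obtain ⟨C, hC⟩ := hb
    exact (hf.integrable_indicator hK).smul_bdd C (continuous_gradient hψs).aestronglyMeasurable
      (Eventually.of_forall hC)
  have hci := (φ.hasCompactSupport_normed.fderiv ℝ).convolutionExists_left
    (ContinuousLinearMap.precompL E (lsmul ℝ ℝ)) (hρs.continuous_fderiv (by simp)) hfl x
  have hint' := hci.integrable_swap
  refine ext_inner_left ℝ fun v => ?_
  rw [hRHS, ← neg_eq_iff_eq_neg.2 (h.2.2 ψ hψs hψc hψU), hLHS, inner_neg_right,
    ← integral_inner hint, inner_gradient_right, hder.fderiv, convolution_eq_swap,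
    ContinuousLinearMap.integral_apply hint', ← integral_neg, conj_trivial]
  refine integral_congr_ae (Eventually.of_forall fun t => ?_)
  simp only [real_inner_smul_right, hgr, inner_neg_right, inner_gradient_right, conj_trivial]
  rw [ContinuousLinearMap.precompL_apply]
  rw [← hρ]
  simp [mul_comm]

/-- Local approximation in `L²` of a function and its weak gradient by smooth functions. -/
theorem HasWeakGradient.exists_smooth_approx {U : Set E} (hU : IsOpen U) {f : E → ℝ} {G : E → E}
    (h : HasWeakGradient U f G)
    (hf : ∀ K ⊆ U, IsCompact K → MemLp f 2 (volume.restrict K))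
    (hG : ∀ K ⊆ U, IsCompact K → MemLp G 2 (volume.restrict K))
    {K : Set E} (hK : IsCompact K) (hKU : K ⊆ U) :
    ∃ u : ℕ → E → ℝ, (∀ j, ContDiff ℝ ∞ (u j)) ∧
      Tendsto (fun j => eLpNorm (u j - f) 2 (volume.restrict K)) atTop (𝓝 0) ∧
      Tendsto (fun j => eLpNorm (∇ (u j) - G) 2 (volume.restrict K)) atTop (𝓝 0) ∧
      (G =ᵐ[volume.restrict U] 0 → ∀ j, ∀ x ∈ K, ∇ (u j) x = 0) := by
  obtain ⟨δ, hδ, hδU⟩ := hK.exists_cthickening_subset_open hU hKU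
  set K' := Metric.cthickening δ K with hK'
  have hK'c : IsCompact K' := hK.cthickening
  have hKK' : K ⊆ K' := Metric.self_subset_cthickening K
  have hm : MeasurableSet K' := hK'c.isClosed.measurableSet
  -- Outer radii at most `δ` keep every ball centred in `K` inside the thickening `K'`, where the
  -- gradient of the mollification is the mollified weak gradient.
  set φ : ℕ → ContDiffBump (0 : E) := fun j =>
    ⟨δ / (j + 2), δ / (j + 1), by positivity, by gcongr; linarith⟩ with hφ
  have hφ0 : Tendsto (fun j => (φ j).rOut) atTop (𝓝 0) := by
    have := (tendsto_one_div_add_atTop_nhds_zero_nat (𝕜 := ℝ)).const_mul δ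
    simpa [hφ, div_eq_mul_inv] using this
  have hφδ : ∀ j, (φ j).rOut ≤ δ := fun j => by
    simp only [hφ]
    exact div_le_self hδ.le (by linarith [(Nat.cast_nonneg j : (0 : ℝ) ≤ j)])
  have hf' : MemLp (K'.indicator f) 2 volume := (memLp_indicator_iff_restrict hm).2 (hf K' hδU hK'c)
  have hG' : MemLp (K'.indicator G) 2 volume := (memLp_indicator_iff_restrict hm).2 (hG K' hδU hK'c)
  have hfin : IsFiniteMeasure (volume.restrict K') := ⟨by simpa using hK'c.measure_lt_top⟩
  have hfi : IntegrableOn f K' := (hf K' hδU hK'c).integrable (by norm_num)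
  have hgr : ∀ j, ∀ x ∈ K, ∇ ((φ j).normed volume ⋆[lsmul ℝ ℝ, volume] K'.indicator f) x =
      ((φ j).normed volume ⋆[lsmul ℝ ℝ, volume] K'.indicator G : E → E) x := fun j x hx =>
    h.gradient_convolution hm hδU hfi (φ j)
      ((Metric.closedBall_subset_closedBall (hφδ j)).trans
        (Metric.closedBall_subset_cthickening hx δ))
  refine ⟨fun j => (φ j).normed volume ⋆[lsmul ℝ ℝ, volume] K'.indicator f, fun j => ?_, ?_, ?_, ?_⟩
  · exact (φ j).hasCompactSupport_normed.contDiff_convolution_left _ (φ j).contDiff_normed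
      (hf'.locallyIntegrable (by norm_num))
  · refine tendsto_of_tendsto_of_tendsto_of_le_of_le tendsto_const_nhds
      (tendsto_eLpNorm_convolution_sub hφ0 hf') (fun j => bot_le) fun j => ?_
    refine le_trans (le_of_eq ?_) (eLpNorm_mono_measure _
      (Measure.restrict_le_self (s := K)))
    refine eLpNorm_congr_ae ?_
    filter_upwards [ae_restrict_mem hK.measurableSet] with x hx
    simp [hKK' hx]
  · refine tendsto_of_tendsto_of_tendsto_of_le_of_le tendsto_const_nhds
      (tendsto_eLpNorm_convolution_sub hφ0 hG') (fun j => bot_le) fun j => ?_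
    refine le_trans (le_of_eq ?_) (eLpNorm_mono_measure _
      (Measure.restrict_le_self (s := K)))
    refine eLpNorm_congr_ae ?_
    filter_upwards [ae_restrict_mem hK.measurableSet] with x hx
    simp [hKK' hx, hgr j x hx]
  · intro h0 j x hx
    have h1 : K'.indicator G =ᵐ[volume] 0 := by
      have := (ae_restrict_iff' hm).1 (ae_mono (Measure.restrict_mono hδU le_rfl) h0)
      filter_upwards [this] with y hy
      by_cases hyK : y ∈ K'
      · simp [hyK, hy hyK]
      · simp [hyK]
    rw [hgr j x hx, convolution_congr (f' := (φ j).normed volume) (g' := 0) _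
      (EventuallyEq.refl _ _) h1]
    simp

end Mollification

end


noncomputable section

/-! ### Variances and constants in the square integrable space. -/

section General

variable {α : Type*} [MeasurableSpace α] {m : Measure α}

theorem integral_sq_eq_norm_sq {F : Type*} [NormedAddCommGroup F] [InnerProductSpace ℝ F]
    (f : Lp F 2 m) : ∫ x, ‖f x‖ ^ 2 ∂m = ‖f‖ ^ 2 := by
  rw [← real_inner_self_eq_norm_sq, L2.inner_def]
  exact integral_congr_ae (Eventually.of_forall fun x => (real_inner_self_eq_norm_sq _).symm)

theorem integral_sub_const_sq [IsProbabilityMeasure m] {f : α → ℝ} (hf : MemLp f 2 m) (a : ℝ) :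
    ∫ x, (f x - a) ^ 2 ∂m =
      ∫ x, f x ^ 2 ∂m - (∫ x, f x ∂m) ^ 2 + (∫ x, f x ∂m - a) ^ 2 := by
  have h1 : Integrable f m := hf.integrable (by norm_num)
  have h2 : Integrable (fun x => f x ^ 2) m := hf.integrable_sq
  have h3 : Integrable (fun x => 2 * a * f x) m := h1.const_mul _
  have e : ∀ x, (f x - a) ^ 2 = f x ^ 2 - 2 * a * f x + a ^ 2 := fun x => by ring
  simp_rw [e]
  have h4 : Integrable (fun x => f x ^ 2 - 2 * a * f x) m := h2.sub h3
  rw [integral_add h4 (integrable_const _), integral_sub h2 h3, integral_const_mul]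
  simp
  ring

theorem integral_sub_integral_sq [IsProbabilityMeasure m] {f : α → ℝ} (hf : MemLp f 2 m) :
    ∫ x, (f x - ∫ y, f y ∂m) ^ 2 ∂m = ∫ x, f x ^ 2 ∂m - (∫ x, f x ∂m) ^ 2 := by
  rw [integral_sub_const_sq hf, sub_self]
  ring

theorem inner_one_eq [IsProbabilityMeasure m] (f : Lp ℝ 2 m) :
    ⟪(memLp_const (1 : ℝ)).toLp (fun _ : α => (1 : ℝ)), f⟫_ℝ = ∫ x, f x ∂m := by
  rw [L2.inner_def]
  refine integral_congr_ae ?_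
  filter_upwards [(memLp_const (1 : ℝ) (p := 2) (μ := m)).coeFn_toLp] with x hx
  rw [hx]
  simp

end General

/-! ### Weighted Sobolev spaces: closed form, constants, and the gap as Poincaré constant. -/

section WeightedSobolev

variable {E : Type*} [NormedAddCommGroup E] [InnerProductSpace ℝ E] [FiniteDimensional ℝ E]
  [MeasurableSpace E] [BorelSpace E]

section WeakGradient

variable {U : Set E} {f : E → ℝ} {G : E → E}

theorem HasWeakGradient.integrable_smul_gradient (h : HasWeakGradient U f G) {φ : E → ℝ}
    (h1 : ContDiff ℝ ∞ φ) (h2 : HasCompactSupport φ) (h3 : tsupport φ ⊆ U) :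
    Integrable (fun x => f x • ∇ φ x) := by
  have hK : IsCompact (tsupport φ) := h2
  refine (integrableOn_iff_integrable_of_support_subset (s := tsupport φ) ?_).1 ?_
  · intro x hx
    by_contra hxs
    exact hx (by simp [gradient_eq_zero_of_notMem_tsupport hxs])
  · exact (h.1.integrableOn_compact_subset h3 hK).smul_continuousOn
      (continuous_gradient h1).continuousOn hK

theorem HasWeakGradient.integrable_smul (h : HasWeakGradient U f G) {φ : E → ℝ}
    (h1 : ContDiff ℝ ∞ φ) (h2 : HasCompactSupport φ) (h3 : tsupport φ ⊆ U) :
    Integrable (fun x => φ x • G x) := by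
  have hK : IsCompact (tsupport φ) := h2
  refine (integrableOn_iff_integrable_of_support_subset (s := tsupport φ) ?_).1 ?_
  · intro x hx
    by_contra hxs
    exact hx (by simp [image_eq_zero_of_notMem_tsupport hxs])
  · exact (h.2.1.integrableOn_compact_subset h3 hK).continuousOn_smul h1.continuous.continuousOn hK

theorem LocallyIntegrableOn.congr_ae {F : Type*} [NormedAddCommGroup F] {u v : E → F}
    (h : LocallyIntegrableOn u U volume) (huv : u =ᵐ[volume.restrict U] v) :
    LocallyIntegrableOn v U volume := by
  intro x hx
  obtain ⟨t, ht, hti⟩ := h x hx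
  refine ⟨t ∩ U, Filter.inter_mem ht self_mem_nhdsWithin, ?_⟩
  exact (hti.mono_set inter_subset_left).congr_fun_ae
    (ae_mono (Measure.restrict_mono inter_subset_right le_rfl) huv)

theorem integral_eq_of_ae_restrict {F : Type*} [NormedAddCommGroup F] [NormedSpace ℝ F]
    {u v : E → F} (hu : ∀ x ∉ U, u x = 0) (hv : ∀ x ∉ U, v x = 0)
    (huv : u =ᵐ[volume.restrict U] v) : ∫ x, u x = ∫ x, v x := by
  rw [← setIntegral_eq_integral_of_forall_compl_eq_zero (s := U) (f := u) hu,
    ← setIntegral_eq_integral_of_forall_compl_eq_zero (s := U) (f := v) hv]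
  exact integral_congr_ae huv

theorem HasWeakGradient.congr (h : HasWeakGradient U f G) {f' : E → ℝ} {G' : E → E}
    (hf : f =ᵐ[volume.restrict U] f') (hG : G =ᵐ[volume.restrict U] G') :
    HasWeakGradient U f' G' := by
  refine ⟨LocallyIntegrableOn.congr_ae h.1 hf, LocallyIntegrableOn.congr_ae h.2.1 hG,
    fun φ h1 h2 h3 => ?_⟩
  have e1 : ∫ x, f x • ∇ φ x = ∫ x, f' x • ∇ φ x := by
    refine integral_eq_of_ae_restrict (U := U) ?_ ?_ ?_
    · intro x hx; simp [gradient_eq_zero_of_notMem_tsupport fun h => hx (h3 h)]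
    · intro x hx; simp [gradient_eq_zero_of_notMem_tsupport fun h => hx (h3 h)]
    · filter_upwards [hf] with x hx; rw [hx]
  have e2 : ∫ x, φ x • G x = ∫ x, φ x • G' x := by
    refine integral_eq_of_ae_restrict (U := U) ?_ ?_ ?_
    · intro x hx; simp [image_eq_zero_of_notMem_tsupport fun h => hx (h3 h)]
    · intro x hx; simp [image_eq_zero_of_notMem_tsupport fun h => hx (h3 h)]
    · filter_upwards [hG] with x hx; rw [hx]
  rw [← e1, ← e2, h.2.2 φ h1 h2 h3]

theorem HasWeakGradient.add {f' : E → ℝ} {G' : E → E} (h : HasWeakGradient U f G)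
    (h' : HasWeakGradient U f' G') :
    HasWeakGradient U (fun x => f x + f' x) (fun x => G x + G' x) := by
  refine ⟨h.1.add h'.1, h.2.1.add h'.2.1, fun φ h1 h2 h3 => ?_⟩
  simp_rw [add_smul, smul_add]
  rw [integral_add (h.integrable_smul_gradient h1 h2 h3) (h'.integrable_smul_gradient h1 h2 h3),
    integral_add (h.integrable_smul h1 h2 h3) (h'.integrable_smul h1 h2 h3), h.2.2 φ h1 h2 h3,
    h'.2.2 φ h1 h2 h3, neg_add]

theorem hasWeakGradient_const (c : ℝ) : HasWeakGradient U (fun _ : E => c) (fun _ => 0) := by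
  have h := hasWeakGradient_of_smooth (U := U) (f := fun _ : E => c) (contDiff_const (c := c))
    (EventuallyEq.refl _ _)
  refine h.congr (EventuallyEq.refl _ _) (Eventually.of_forall fun x => ?_)
  simp [gradient]

end WeakGradient

/-- A measure with positive continuous density and a positive continuous weight, on an open set
exhausted by compact convex sets. -/
structure RegularWeight (U : Set E) (m : Measure E) (σ : E → ℝ) : Prop where
  isOpen : IsOpen U
  density : ∃ ρ : E → ℝ, ContinuousOn ρ U ∧ (∀ x ∈ U, 0 < ρ x) ∧
    m = (volume.restrict U).withDensity fun x => ENNReal.ofReal (ρ x)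
  continuousOn : ContinuousOn σ U
  pos : ∀ x ∈ U, 0 < σ x
  exhaustion : ∃ K : ℕ → Set E, Monotone K ∧ (∀ k, IsCompact (K k) ∧ Convex ℝ (K k) ∧ K k ⊆ U) ∧
    U ⊆ (⋃ k, K k) ∧ (interior (K 0)).Nonempty

namespace RegularWeight

variable {U : Set E} {m : Measure E} {σ : E → ℝ}

theorem volume_absolutelyContinuous (h : RegularWeight U m σ) : volume.restrict U ≪ m := by
  obtain ⟨ρ, hρ, hρ0, hm⟩ := h.density
  rw [hm]
  refine withDensity_absolutelyContinuous'
    (hρ.aemeasurable h.isOpen.measurableSet).ennreal_ofReal ?_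
  filter_upwards [ae_restrict_mem h.isOpen.measurableSet] with x hx
  simpa using hρ0 x hx

theorem absolutelyContinuous_volume (h : RegularWeight U m σ) : m ≪ volume.restrict U := by
  obtain ⟨ρ, hρ, hρ0, hm⟩ := h.density
  rw [hm]
  exact withDensity_absolutelyContinuous _ _

theorem ae_mem (h : RegularWeight U m σ) : ∀ᵐ x ∂m, x ∈ U :=
  h.absolutelyContinuous_volume.ae_le (ae_restrict_mem h.isOpen.measurableSet)

theorem restrict_eq {ρ : E → ℝ}
    (hm : m = (volume.restrict U).withDensity fun x => ENNReal.ofReal (ρ x))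
    {K : Set E} (hK : IsCompact K) (hKU : K ⊆ U) :
    m.restrict K = (volume.restrict K).withDensity fun x => ENNReal.ofReal (ρ x) := by
  rw [hm, restrict_withDensity hK.measurableSet, Measure.restrict_restrict hK.measurableSet,
    inter_eq_left.2 hKU]

/-- A positive continuous density has a positive minimum on a compact set. Together with the reverse
comparison below, this makes local Lebesgue estimates and local estimates for `m` interchangeable.
-/
theorem exists_volume_restrict_le (h : RegularWeight U m σ) {K : Set E} (hK : IsCompact K)
    (hKU : K ⊆ U) : ∃ C : ℝ≥0∞, C ≠ ⊤ ∧ volume.restrict K ≤ C • m := by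
  obtain ⟨ρ, hρ, hρ0, hm⟩ := h.density
  obtain ⟨a, ha, hρa⟩ : ∃ a : ℝ, 0 < a ∧ ∀ x ∈ K, a ≤ ρ x := by
    rcases K.eq_empty_or_nonempty with rfl | hne
    · exact ⟨1, one_pos, by simp⟩
    · obtain ⟨x, hx, hmin⟩ := hK.exists_isMinOn hne (hρ.mono hKU)
      exact ⟨ρ x, hρ0 x (hKU hx), fun y hy => hmin hy⟩
  have ha' : ENNReal.ofReal a ≠ 0 := by simpa using ha
  refine ⟨(ENNReal.ofReal a)⁻¹, by simpa using ha, ?_⟩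
  have h1 : ENNReal.ofReal a • volume.restrict K ≤ m := by
    calc ENNReal.ofReal a • volume.restrict K
        = (volume.restrict K).withDensity fun _ => ENNReal.ofReal a := by
          rw [withDensity_const]
      _ ≤ (volume.restrict K).withDensity fun x => ENNReal.ofReal (ρ x) := by
          refine withDensity_mono ?_
          filter_upwards [ae_restrict_mem hK.measurableSet] with x hx
          exact ENNReal.ofReal_le_ofReal (hρa x hx)
      _ = m.restrict K := (RegularWeight.restrict_eq hm hK hKU).symm
      _ ≤ m := Measure.restrict_le_self
  calc volume.restrict K = (ENNReal.ofReal a)⁻¹ • (ENNReal.ofReal a • volume.restrict K) := by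
        rw [smul_smul, ENNReal.inv_mul_cancel ha' ENNReal.ofReal_ne_top, one_smul]
    _ ≤ (ENNReal.ofReal a)⁻¹ • m := by gcongr

theorem exists_restrict_le_volume (h : RegularWeight U m σ) {K : Set E} (hK : IsCompact K)
    (hKU : K ⊆ U) : ∃ C : ℝ≥0∞, C ≠ ⊤ ∧ m.restrict K ≤ C • volume.restrict K := by
  obtain ⟨ρ, hρ, hρ0, hm⟩ := h.density
  obtain ⟨a, hρa⟩ := hK.exists_bound_of_continuousOn (hρ.mono hKU)
  refine ⟨ENNReal.ofReal a, ENNReal.ofReal_ne_top, ?_⟩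
  rw [RegularWeight.restrict_eq hm hK hKU, ← withDensity_const]
  refine withDensity_mono ?_
  filter_upwards [ae_restrict_mem hK.measurableSet] with x hx
  exact ENNReal.ofReal_le_ofReal ((le_abs_self _).trans (hρa x hx))

theorem memLp_restrict {F : Type*} [NormedAddCommGroup F] (h : RegularWeight U m σ) {u : E → F}
    (hu : MemLp u 2 m) {K : Set E} (hK : IsCompact K) (hKU : K ⊆ U) :
    MemLp u 2 (volume.restrict K) := by
  obtain ⟨C, hC, hle⟩ := h.exists_volume_restrict_le hK hKU
  exact hu.of_measure_le_smul hC hle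

theorem aestronglyMeasurable_inv_smul (h : RegularWeight U m σ) {w : E → E}
    (hw : AEStronglyMeasurable w m) : AEStronglyMeasurable (fun x => (σ x)⁻¹ • w x) m := by
  refine AEStronglyMeasurable.smul (AEStronglyMeasurable.mono_ac h.absolutelyContinuous_volume ?_)
    hw
  exact (h.continuousOn.inv₀ fun x hx => (h.pos x hx).ne').aestronglyMeasurable
    h.isOpen.measurableSet

/-- `G` is locally square integrable if `σ G` is. -/
theorem memLp_restrict_of_smul (h : RegularWeight U m σ) {w : E → E}
    (hw : MemLp w 2 m) {K : Set E} (hK : IsCompact K) (hKU : K ⊆ U) :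
    MemLp (fun x => (σ x)⁻¹ • w x) 2 (volume.restrict K) := by
  obtain ⟨C, hC⟩ := hK.exists_bound_of_continuousOn
    ((h.continuousOn.mono hKU).inv₀ fun x hx => (h.pos x (hKU hx)).ne')
  refine (h.memLp_restrict hw hK hKU).of_le_mul (c := C) ?_ ?_
  · refine AEStronglyMeasurable.mono_ac ?_ (h.aestronglyMeasurable_inv_smul hw.1)
    exact (Measure.absolutelyContinuous_of_le (Measure.restrict_mono hKU le_rfl)).trans
      h.volume_absolutelyContinuous
  · filter_upwards [ae_restrict_mem hK.measurableSet] with x hx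
    rw [norm_smul]
    exact mul_le_mul_of_nonneg_right (hC x hx) (norm_nonneg _)

theorem inv_smul_smul_ae (h : RegularWeight U m σ) (G : E → E) :
    (fun x => (σ x)⁻¹ • (σ x • G x)) =ᵐ[volume.restrict U] G := by
  filter_upwards [ae_restrict_mem h.isOpen.measurableSet] with x hx
  rw [inv_smul_smul₀ (h.pos x hx).ne']

theorem memLp_restrict_gradient (h : RegularWeight U m σ) {G : E → E}
    (hw : MemLp (fun x => σ x • G x) 2 m) {K : Set E} (hK : IsCompact K) (hKU : K ⊆ U) :
    MemLp G 2 (volume.restrict K) :=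
  (memLp_congr_ae (ae_mono (Measure.restrict_mono hKU le_rfl) (h.inv_smul_smul_ae G))).1
    (h.memLp_restrict_of_smul hw hK hKU)

theorem locallyIntegrableOn {F : Type*} [NormedAddCommGroup F] (h : RegularWeight U m σ) {u : E → F}
    (hu : ∀ K ⊆ U, IsCompact K → MemLp u 2 (volume.restrict K)) :
    LocallyIntegrableOn u U volume := by
  rw [locallyIntegrableOn_iff h.isOpen.isLocallyClosed]
  intro K hKU hK
  have : IsFiniteMeasure (volume.restrict K) := ⟨by simpa using hK.measure_lt_top⟩
  exact (hu K hKU hK).integrable (by norm_num)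

theorem integral_eq (h : RegularWeight U m σ) {ρ : E → ℝ} (hρ : ContinuousOn ρ U)
    (hρ0 : ∀ x ∈ U, 0 < ρ x)
    (hm : m = (volume.restrict U).withDensity fun x => ENNReal.ofReal (ρ x)) (u : E → ℝ) :
    ∫ x, u x ∂m = ∫ x in U, ρ x * u x := by
  rw [hm, integral_withDensity_eq_integral_toReal_smul₀
    (hρ.aemeasurable h.isOpen.measurableSet).ennreal_ofReal (by simp)]
  refine integral_congr_ae ?_
  filter_upwards [ae_restrict_mem h.isOpen.measurableSet] with x hx
  rw [ENNReal.toReal_ofReal (hρ0 x hx).le, smul_eq_mul]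

theorem memLp_of_tsupport (h : RegularWeight U m σ) [IsFiniteMeasure m] {F : Type*}
    [NormedAddCommGroup F] {u : E → F} {K : Set E} (hK : IsCompact K) (hKU : K ⊆ U)
    (hu : ContinuousOn u U) (h0 : ∀ x ∉ K, u x = 0) : MemLp u 2 m := by
  obtain ⟨C, hC⟩ := hK.exists_bound_of_continuousOn (hu.mono hKU)
  refine MemLp.of_bound (C := max C 0) ?_ (Eventually.of_forall fun x => ?_)
  · have : SecondCountableTopologyEither E F := inferInstance
    exact (hu.aestronglyMeasurable h.isOpen.measurableSet).mono_ac h.absolutelyContinuous_volume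
  · by_cases hx : x ∈ K
    · exact (hC x hx).trans (le_max_left _ _)
    · rw [h0 x hx, norm_zero]; exact le_max_right _ _

/-- Testing a weak gradient is given by continuous functionals on `L²(m)`. -/
theorem exists_test (h : RegularWeight U m σ) [IsFiniteMeasure m] {φ : E → ℝ}
    (h1 : ContDiff ℝ ∞ φ) (h2 : HasCompactSupport φ) (h3 : tsupport φ ⊆ U) (v : E) :
    ∃ (A : Lp ℝ 2 m) (B : Lp E 2 m), ∀ (f : Lp ℝ 2 m) (w : Lp E 2 m),
      ⟪A, f⟫_ℝ = ∫ x, ⟪v, f x • ∇ φ x⟫_ℝ ∧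
      ⟪B, w⟫_ℝ = ∫ x, ⟪v, φ x • ((σ x)⁻¹ • w x)⟫_ℝ := by
  obtain ⟨ρ, hρ, hρ0, hm⟩ := h.density
  have hK : IsCompact (tsupport φ) := h2
  have hρi : ContinuousOn (fun x => (ρ x)⁻¹) U := hρ.inv₀ fun x hx => (hρ0 x hx).ne'
  have hσi : ContinuousOn (fun x => (σ x)⁻¹) U := h.continuousOn.inv₀ fun x hx => (h.pos x hx).ne'
  -- Dividing by `ρ` rewrites a Lebesgue integral as one against `m`; the compact support of `φ` in
  -- `U` keeps `ρ⁻¹` and `σ⁻¹` bounded where they occur.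
  have hA : MemLp (fun x => (ρ x)⁻¹ * ⟪v, ∇ φ x⟫_ℝ) 2 m :=
    h.memLp_of_tsupport hK h3
      (hρi.mul (continuous_const.inner (continuous_gradient h1)).continuousOn)
      fun x hx => by simp [gradient_eq_zero_of_notMem_tsupport hx]
  have hB : MemLp (fun x => ((ρ x)⁻¹ * (φ x * (σ x)⁻¹)) • v) 2 m :=
    h.memLp_of_tsupport hK h3
      ((hρi.mul (h1.continuous.continuousOn.mul hσi)).smul continuousOn_const)
      fun x hx => by simp [image_eq_zero_of_notMem_tsupport hx]
  refine ⟨hA.toLp _, hB.toLp _, fun f w => ⟨?_, ?_⟩⟩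
  · rw [L2.inner_def]
    have e1 : ∫ x, ⟪hA.toLp _ x, f x⟫_ℝ ∂m = ∫ x, (ρ x)⁻¹ * ⟪v, f x • ∇ φ x⟫_ℝ ∂m := by
      refine integral_congr_ae ?_
      filter_upwards [hA.coeFn_toLp] with x hx
      rw [hx, real_inner_smul_right]
      simp
      ring
    rw [e1, h.integral_eq hρ hρ0 hm, ← setIntegral_eq_integral_of_forall_compl_eq_zero (s := U)
      (f := fun x => ⟪v, f x • ∇ φ x⟫_ℝ)]
    · refine integral_congr_ae ?_
      filter_upwards [ae_restrict_mem h.isOpen.measurableSet] with x hx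
      rw [mul_inv_cancel_left₀ (hρ0 x hx).ne']
    · intro x hx
      simp [gradient_eq_zero_of_notMem_tsupport fun h => hx (h3 h)]
  · rw [L2.inner_def]
    have e1 : ∫ x, ⟪hB.toLp _ x, w x⟫_ℝ ∂m = ∫ x, (ρ x)⁻¹ * ⟪v, φ x • ((σ x)⁻¹ • w x)⟫_ℝ ∂m := by
      refine integral_congr_ae ?_
      filter_upwards [hB.coeFn_toLp] with x hx
      rw [hx, real_inner_smul_right, real_inner_smul_right, real_inner_smul_left]
      ring
    rw [e1, h.integral_eq hρ hρ0 hm, ← setIntegral_eq_integral_of_forall_compl_eq_zero (s := U)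
      (f := fun x => ⟪v, φ x • ((σ x)⁻¹ • w x)⟫_ℝ)]
    · refine integral_congr_ae ?_
      filter_upwards [ae_restrict_mem h.isOpen.measurableSet] with x hx
      rw [mul_inv_cancel_left₀ (hρ0 x hx).ne']
    · intro x hx
      simp [image_eq_zero_of_notMem_tsupport fun h => hx (h3 h)]

/-- The pairs `(f, σ ∇f)` for `f` in the weighted Sobolev space form a closed subspace. -/
theorem exists_closed_submodule (h : RegularWeight U m σ) [IsFiniteMeasure m] :
    ∃ D : Submodule ℝ (WithLp 2 (Lp ℝ 2 m × Lp E 2 m)),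
      IsClosed (D : Set (WithLp 2 (Lp ℝ 2 m × Lp E 2 m))) ∧
      ∀ q, q ∈ D ↔ HasWeakGradient U q.fst fun x => (σ x)⁻¹ • q.snd x := by
  set T : Set (E → ℝ) := {φ | ContDiff ℝ ∞ φ ∧ HasCompactSupport φ ∧ tsupport φ ⊆ U} with hT
  have htest := fun (p : T × E) => h.exists_test p.1.2.1 p.1.2.2.1 p.1.2.2.2 p.2
  choose A B hAB using htest
  have hloc1 : ∀ q : WithLp 2 (Lp ℝ 2 m × Lp E 2 m), LocallyIntegrableOn q.fst U volume :=
    fun q => h.locallyIntegrableOn fun K hKU hK => h.memLp_restrict (Lp.memLp q.fst) hK hKU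
  have hloc2 : ∀ q : WithLp 2 (Lp ℝ 2 m × Lp E 2 m),
      LocallyIntegrableOn (fun x => (σ x)⁻¹ • q.snd x) U volume :=
    fun q => h.locallyIntegrableOn fun K hKU hK => h.memLp_restrict_of_smul (Lp.memLp q.snd) hK hKU
  set L : T × E → (WithLp 2 (Lp ℝ 2 m × Lp E 2 m) →L[ℝ] ℝ) := fun p =>
    (innerSL ℝ (A p)).comp (WithLp.fstL 2 ℝ _ _) + (innerSL ℝ (B p)).comp (WithLp.sndL 2 ℝ _ _)
    with hL
  -- Being a weak gradient is a family of continuous linear equations in `(f, w)` with `w = σ ∇f`,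
  -- one for each test function and direction, so the space is an intersection of closed kernels.
  refine ⟨⨅ p, LinearMap.ker (L p : WithLp 2 (Lp ℝ 2 m × Lp E 2 m) →ₗ[ℝ] ℝ), ?_, fun q => ?_⟩
  · rw [Submodule.coe_iInf]
    exact isClosed_iInter fun p => (L p).isClosed_ker
  · rw [Submodule.mem_iInf]
    have hLq : ∀ p : T × E, L p q = (∫ x, ⟪p.2, q.fst x • ∇ p.1.1 x⟫_ℝ) +
        ∫ x, ⟪p.2, p.1.1 x • ((σ x)⁻¹ • q.snd x)⟫_ℝ := fun p => by
      have := hAB p q.fst q.snd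
      simp only [hL]
      rw [← this.1, ← this.2]
      rfl
    have i1 : ∀ φ ∈ T, Integrable (fun x => q.fst x • ∇ φ x) := by
      intro φ hφ
      have hK : IsCompact (tsupport φ) := hφ.2.1
      refine (integrableOn_iff_integrable_of_support_subset (s := tsupport φ) ?_).1 ?_
      · intro x hx
        by_contra hxs
        exact hx (by simp [gradient_eq_zero_of_notMem_tsupport hxs])
      · exact ((hloc1 q).integrableOn_compact_subset hφ.2.2 hK).smul_continuousOn
          (continuous_gradient hφ.1).continuousOn hK
    have i2 : ∀ φ ∈ T, Integrable (fun x => φ x • ((σ x)⁻¹ • q.snd x)) := by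
      intro φ hφ
      have hK : IsCompact (tsupport φ) := hφ.2.1
      refine (integrableOn_iff_integrable_of_support_subset (s := tsupport φ) ?_).1 ?_
      · intro x hx
        by_contra hxs
        exact hx (by simp [image_eq_zero_of_notMem_tsupport hxs])
      · exact ((hloc2 q).integrableOn_compact_subset hφ.2.2 hK).continuousOn_smul
          hφ.1.continuous.continuousOn hK
    have hLq' : ∀ p : T × E, L p q = ⟪p.2, (∫ x, q.fst x • ∇ p.1.1 x) +
        ∫ x, p.1.1 x • ((σ x)⁻¹ • q.snd x)⟫_ℝ := fun p => by
      rw [hLq, integral_inner (i1 _ p.1.2), integral_inner (i2 _ p.1.2), inner_add_right]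
    constructor
    · intro hq
      refine ⟨hloc1 q, hloc2 q, fun φ h1 h2 h3 => ?_⟩
      rw [eq_neg_iff_add_eq_zero]
      refine ext_inner_left ℝ fun v => ?_
      rw [inner_zero_right]
      have := hq (⟨φ, h1, h2, h3⟩, v)
      rw [LinearMap.mem_ker] at this
      rw [← this]
      exact (hLq' (⟨φ, h1, h2, h3⟩, v)).symm
    · intro hq p
      rw [LinearMap.mem_ker]
      refine (hLq' p).trans ?_
      rw [hq.2.2 p.1.1 p.1.2.1 p.1.2.2.1 p.1.2.2.2, neg_add_cancel, inner_zero_right]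

/-- A function with vanishing weak gradient is constant. -/
theorem exists_ae_eq_const (h : RegularWeight U m σ) {f : E → ℝ} {G : E → E}
    (hf : MemLp f 2 m) (hG : HasWeakGradient U f G) (hG0 : G =ᵐ[volume.restrict U] 0) :
    ∃ c : ℝ, f =ᵐ[m] fun _ => c := by
  obtain ⟨K, hmono, hK, hUK, hint⟩ := h.exhaustion
  have hint' : ∀ k, (interior (K k)).Nonempty := fun k =>
    hint.mono (interior_mono (hmono (Nat.zero_le k)))
  have hvol : ∀ k, volume.restrict (K k) ≠ 0 := fun k hk => by
    rw [Measure.restrict_eq_zero] at hk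
    exact (isOpen_interior.measure_pos volume (hint' k)).ne'
      (measure_mono_null interior_subset hk)
  have hloc : ∀ k, ∃ c : ℝ, f =ᵐ[volume.restrict (K k)] fun _ => c := by
    intro k
    obtain ⟨hKc, hKconv, hKU⟩ := hK k
    have hfin : IsFiniteMeasure (volume.restrict (K k)) := ⟨by simpa using hKc.measure_lt_top⟩
    have hfK := h.memLp_restrict hf hKc hKU
    obtain ⟨u, hu, hlim, -, hz⟩ := hG.exists_smooth_approx h.isOpen
      (fun K hKU hK => h.memLp_restrict hf hK hKU)
      (fun K hKU hK => (memLp_congr_ae (ae_mono (Measure.restrict_mono hKU le_rfl) hG0)).2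
        MemLp.zero) hKc hKU
    obtain ⟨x0, hx0⟩ := hint' k
    -- The gradients of the approximants vanish exactly on `K k`, not merely in the limit, and `K k`
    -- is convex with nonempty interior; each approximant is thus constant there.
    have hconst : ∀ j, ∀ x ∈ K k, u j x = u j x0 := by
      intro j x hx
      refine hKconv.is_const_of_fderivWithin_eq_zero (𝕜 := ℝ)
        ((hu j).differentiable (by simp)).differentiableOn (fun y hy => ?_) hx (interior_subset hx0)
      have hud : UniqueDiffOn ℝ (K k) := uniqueDiffOn_convex hKconv (hint' k)
      rw [((hu j).differentiable (by simp) y).fderivWithin (hud y hy)]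
      have := hz hG0 j y hy
      simpa [gradient] using this
    set V := (volume.restrict (K k)).real univ with hV
    have : NeZero (volume.restrict (K k)) := ⟨hvol k⟩
    have hVpos : 0 < V := by
      rw [hV, measureReal_def]
      exact ENNReal.toReal_pos (by simpa using hvol k) (measure_ne_top _ _)
    set c := ⨍ x in K k, f x with hc
    refine ⟨c, ?_⟩
    have hlim1 : Tendsto (fun j => ∫ x in K k, u j x) atTop (𝓝 (∫ x in K k, f x)) := by
      refine tendsto_integral_of_L1' f hfK.1 ?_ ?_
      · exact Eventually.of_forall fun j =>
          ((hu j).continuous.continuousOn.integrableOn_compact hKc)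
      · have hb : ∀ j, eLpNorm (u j - f) 1 (volume.restrict (K k)) ≤
            eLpNorm (u j - f) 2 (volume.restrict (K k)) *
              (volume.restrict (K k)) univ ^ (1 / (1 : ℝ≥0∞).toReal - 1 / (2 : ℝ≥0∞).toReal) :=
          fun j => eLpNorm_le_eLpNorm_mul_rpow_measure_univ (by norm_num)
            ((hu j).continuous.aestronglyMeasurable.sub hfK.1)
        refine tendsto_of_tendsto_of_tendsto_of_le_of_le tendsto_const_nhds ?_
          (fun j => bot_le) hb
        have := ENNReal.Tendsto.mul_const (b := (volume.restrict (K k)) univ ^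
          (1 / (1 : ℝ≥0∞).toReal - 1 / (2 : ℝ≥0∞).toReal)) hlim (Or.inr ?_)
        · simpa using this
        · exact ENNReal.rpow_ne_top_of_nonneg (by norm_num) (measure_ne_top _ _)
    have hlimc : Tendsto (fun j => u j x0) atTop (𝓝 c) := by
      have e : ∀ j, u j x0 = V⁻¹ * ∫ x in K k, u j x := fun j => by
        rw [setIntegral_congr_fun hKc.measurableSet (fun x hx => hconst j x hx)]
        simp only [integral_const, smul_eq_mul]
        rw [← hV]
        field_simp
      simp_rw [e]
      rw [hc, setAverage_eq]
      have := hlim1.const_mul V⁻¹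
      simpa [hV, smul_eq_mul] using this
    have hz2 : eLpNorm ((fun _ => c) - f) 2 (volume.restrict (K k)) = 0 := by
      refine tendsto_nhds_unique (f := fun _ : ℕ =>
        eLpNorm ((fun _ => c) - f) 2 (volume.restrict (K k))) (l := atTop) tendsto_const_nhds ?_
      have hle : ∀ j, eLpNorm ((fun _ => c) - f) 2 (volume.restrict (K k)) ≤
          eLpNorm (fun _ : E => c - u j x0) 2 (volume.restrict (K k)) +
          eLpNorm (u j - f) 2 (volume.restrict (K k)) := by
        intro j
        refine le_trans (le_of_eq (eLpNorm_congr_ae ?_)) (eLpNorm_add_le (μ := volume.restrict (K k))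
          (f := fun _ : E => c - u j x0) (g := u j - f) aestronglyMeasurable_const
          ((hu j).continuous.aestronglyMeasurable.sub hfK.1) (by norm_num))
        filter_upwards [ae_restrict_mem hKc.measurableSet] with x hx
        simp [hconst j x hx]
      refine tendsto_of_tendsto_of_tendsto_of_le_of_le tendsto_const_nhds ?_ (fun j => bot_le) hle
      have h0 : Tendsto (fun j => eLpNorm (fun _ : E => c - u j x0) 2 (volume.restrict (K k)))
          atTop (𝓝 0) := by
        have e : ∀ j, eLpNorm (fun _ : E => c - u j x0) 2 (volume.restrict (K k)) =
            ‖c - u j x0‖ₑ * (volume.restrict (K k)) univ ^ (1 / (2 : ℝ≥0∞).toReal) := fun j =>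
          eLpNorm_const _ (by norm_num) (hvol k)
        simp_rw [e]
        have h5 : Tendsto (fun j => ‖c - u j x0‖ₑ) atTop (𝓝 0) := by
          have := (tendsto_const_nhds (x := c)).sub hlimc
          rw [sub_self] at this
          have := this.enorm
          simpa using this
        have := ENNReal.Tendsto.mul_const (b := (volume.restrict (K k)) univ ^
          (1 / (2 : ℝ≥0∞).toReal)) h5 (Or.inr ?_)
        · simpa using this
        · exact ENNReal.rpow_ne_top_of_nonneg (by norm_num) (measure_ne_top _ _)
      simpa using h0.add hlim
    rw [eLpNorm_eq_zero_iff (aestronglyMeasurable_const.sub hfK.1) (by norm_num)] at hz2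
    filter_upwards [hz2] with x hx
    simp only [Pi.sub_apply, Pi.zero_apply] at hx
    linarith
  choose c hc using hloc
  -- All the sets contain `K 0`, which has positive volume, so the constants agree.
  have hcc : ∀ k, c k = c 0 := by
    intro k
    have h1 := ae_mono (Measure.restrict_mono (hmono (Nat.zero_le k)) le_rfl) (hc k)
    have : (ae (volume.restrict (K 0))).NeBot := ae_neBot.2 (hvol 0)
    obtain ⟨x, hx1, hx2⟩ := (Filter.Eventually.and h1 (hc 0)).exists
    exact hx1.symm.trans hx2
  refine ⟨c 0, h.absolutelyContinuous_volume.ae_le ?_⟩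
  have : ∀ᵐ x ∂(volume.restrict (⋃ k, K k)), f x = c 0 := by
    rw [ae_restrict_iUnion_iff]
    intro k
    filter_upwards [hc k] with x hx
    rw [hx, hcc]
  exact ae_mono (Measure.restrict_mono hUK le_rfl) this

/-- The Poincaré inequality with constant `l` for the weighted Dirichlet form. -/
def _root_.PoincareInequality (U : Set E) (m : Measure E) (σ : E → ℝ) (l : ℝ) : Prop :=
  ∀ (f : E → ℝ) (G : E → E), MemLp f 2 m → HasWeakGradient U f G →
    MemLp (fun x => σ x • G x) 2 m →
      l * (∫ x, f x ^ 2 ∂m - (∫ x, f x ∂m) ^ 2) ≤ ∫ x, σ x ^ 2 * ‖G x‖ ^ 2 ∂m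

/-- Because `σ` is positive on `U`, a gradient can be recovered from `w = σ ∇f`. In these variables
the Dirichlet form is the inner product of second components, and the abstract spectral results
apply. -/
theorem generatorGraph_iff (h : RegularWeight U m σ)
    {D : Submodule ℝ (WithLp 2 (Lp ℝ 2 m × Lp E 2 m))}
    (hD : ∀ q, q ∈ D ↔ HasWeakGradient U q.fst fun x => (σ x)⁻¹ • q.snd x) (f g : Lp ℝ 2 m) :
    GeneratorGraph U m σ f g ↔ FormGraph D f g := by
  have key : ∀ (w : Lp E 2 m) (G : E → E), w =ᵐ[m] (fun x => σ x • G x) →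
      (fun x => (σ x)⁻¹ • w x) =ᵐ[volume.restrict U] G := by
    intro w G hw
    filter_upwards [h.volume_absolutelyContinuous.ae_le hw, h.inv_smul_smul_ae G] with x h1 h2
    rw [h1, h2]
  have key2 : ∀ (w v : Lp E 2 m) (G H : E → E), w =ᵐ[m] (fun x => σ x • G x) →
      v =ᵐ[m] (fun x => σ x • H x) → ∫ x, σ x ^ 2 * ⟪G x, H x⟫_ℝ ∂m = ⟪w, v⟫_ℝ := by
    intro w v G H hw hv
    rw [L2.inner_def]
    refine integral_congr_ae ?_
    filter_upwards [hw, hv] with x h1 h2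
    rw [h1, h2, real_inner_smul_left, real_inner_smul_right]
    ring
  have key3 : ∀ u v : Lp ℝ 2 m, ∫ x, u x * v x ∂m = ⟪u, v⟫_ℝ := by
    intro u v
    rw [L2.inner_def]
    refine integral_congr_ae (Eventually.of_forall fun x => ?_)
    simp [mul_comm]
  have key4 : ∀ w : Lp E 2 m, w =ᵐ[m] fun x => σ x • ((σ x)⁻¹ • w x) := by
    intro w
    filter_upwards [h.ae_mem] with x hx
    rw [smul_inv_smul₀ (h.pos x hx).ne']
  constructor
  · rintro ⟨G, hG, ht⟩
    refine ⟨hG.memLp.toLp _, (hD _).2 (hG.weakGradient.congr (EventuallyEq.refl _ _)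
      (key _ G hG.memLp.coeFn_toLp).symm), fun q hq => ?_⟩
    have := ht q.fst _ ⟨(hD q).1 hq, (memLp_congr_ae (key4 q.snd)).1 (Lp.memLp _)⟩
    rw [key3, key2 _ _ _ _ hG.memLp.coeFn_toLp (key4 q.snd)] at this
    exact this
  · rintro ⟨w, hw, ht⟩
    refine ⟨fun x => (σ x)⁻¹ • w x, ⟨(hD _).1 hw, (memLp_congr_ae (key4 w)).1 (Lp.memLp _)⟩,
      fun u H hu => ?_⟩
    have h1 : WithLp.toLp 2 (u, hu.memLp.toLp _) ∈ D :=
      (hD _).2 (hu.weakGradient.congr (EventuallyEq.refl _ _)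
        (key _ H hu.memLp.coeFn_toLp).symm)
    have := ht _ h1
    rw [key3, key2 _ _ _ _ (key4 w) hu.memLp.coeFn_toLp]
    exact this

theorem _root_.PoincareInequality.mono [IsProbabilityMeasure m] {l l' : ℝ}
    (h : PoincareInequality U m σ l) (hl : l' ≤ l) : PoincareInequality U m σ l' := by
  intro f G hf hG hσG
  refine le_trans (mul_le_mul_of_nonneg_right hl ?_) (h f G hf hG hσG)
  rw [← integral_sub_integral_sq hf]
  exact integral_nonneg fun x => sq_nonneg _

/-- A Poincaré inequality gives a lower bound on the spectral gap. -/
theorem le_spectralGap (h : RegularWeight U m σ) [IsProbabilityMeasure m] {l : ℝ≥0}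
    (hl : PoincareInequality U m σ l) : (l : ℝ≥0∞) ≤ spectralGap U m σ := by
  obtain ⟨D, hDc, hD⟩ := h.exists_closed_submodule
  have hΓ : GeneratorGraph U m σ = FormGraph D := by
    ext f g; exact h.generatorGraph_iff hD f g
  refine le_iSup₂_of_le l ?_ le_rfl
  rw [hΓ]
  -- The constant function spans the kernel; orthogonality to it means mean zero, which makes the
  -- squared mean in the Poincaré inequality disappear.
  set e : Lp ℝ 2 m := (memLp_const (1 : ℝ)).toLp (fun _ : E => (1 : ℝ)) with he
  have he1 : (e : E → ℝ) =ᵐ[m] fun _ => 1 := (memLp_const (1 : ℝ)).coeFn_toLp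
  have hen : ‖e‖ = 1 := by
    have h1 : ‖e‖ ^ 2 = 1 := by
      rw [← integral_sq_eq_norm_sq]
      have : ∫ x, ‖e x‖ ^ 2 ∂m = ∫ x, (1 : ℝ) ∂m := by
        refine integral_congr_ae ?_
        filter_upwards [he1] with x hx
        rw [hx]; norm_num
      rw [this]; simp
    nlinarith [norm_nonneg e]
  have heD : WithLp.toLp 2 (e, (0 : Lp E 2 m)) ∈ D := by
    refine (hD _).2 ((hasWeakGradient_const (U := U) (1 : ℝ)).congr
      (h.volume_absolutelyContinuous.ae_eq he1).symm
      (h.volume_absolutelyContinuous.ae_le ?_))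
    exact Eventually.of_forall fun x => by simp
  have hP : ∀ q ∈ D, ⟪e, q.fst⟫_ℝ = 0 → (l : ℝ) * ‖q.fst‖ ^ 2 ≤ ‖q.snd‖ ^ 2 := by
    intro q hq hq0
    rw [he, inner_one_eq] at hq0
    have e1 : (q.snd : E → E) =ᵐ[m] fun x => σ x • ((σ x)⁻¹ • q.snd x) := by
      filter_upwards [h.ae_mem] with x hx
      rw [smul_inv_smul₀ (h.pos x hx).ne']
    have := hl q.fst _ (Lp.memLp _) ((hD q).1 hq) ((memLp_congr_ae e1).1 (Lp.memLp _))
    rw [hq0] at this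
    have e2 : ∫ x, σ x ^ 2 * ‖(σ x)⁻¹ • q.snd x‖ ^ 2 ∂m = ∫ x, ‖q.snd x‖ ^ 2 ∂m := by
      refine integral_congr_ae ?_
      filter_upwards [e1] with x hx
      nth_rewrite 2 [hx]
      rw [norm_smul (σ x), mul_pow, Real.norm_eq_abs, sq_abs]
    have e3 : ∫ x, q.fst x ^ 2 ∂m = ‖q.fst‖ ^ 2 := by
      rw [← integral_sq_eq_norm_sq]
      simp
    rw [e2, integral_sq_eq_norm_sq, e3] at this
    simpa using this
  intro a ha
  by_contra hcon
  simp only [mem_union, mem_singleton_iff, mem_Ici, not_or, not_le] at hcon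
  exact ha (mem_graphResolventSet_of_poincare hDc hen heD hP hcon.1 hcon.2)

/-- The Poincaré inequality holds with any constant below the spectral gap. -/
theorem poincareInequality_of_lt_spectralGap (h : RegularWeight U m σ) [IsProbabilityMeasure m]
    {l : ℝ≥0} (hl : (l : ℝ≥0∞) < spectralGap U m σ) : PoincareInequality U m σ l := by
  obtain ⟨D, hDc, hD⟩ := h.exists_closed_submodule
  have hΓ : GeneratorGraph U m σ = FormGraph D := by
    ext f g; exact h.generatorGraph_iff hD f g
  obtain ⟨a, ha⟩ := lt_iSup_iff.1 hl
  obtain ⟨hs, hla⟩ := lt_iSup_iff.1 ha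
  rw [hΓ] at hs
  have hla : l < a := by exact_mod_cast hla
  have ha0 : (0 : ℝ) < a := lt_of_le_of_lt l.2 (by exact_mod_cast hla)
  -- The gap is a supremum, so a constant strictly below it is dominated by an admissible `a`, for
  -- which the whole interval `(0, a)` lies in the resolvent set.
  suffices PoincareInequality U m σ a from this.mono (by exact_mod_cast hla.le)
  intro f G hf hG hσG
  set e : Lp ℝ 2 m := (memLp_const (1 : ℝ)).toLp (fun _ : E => (1 : ℝ)) with he
  have he1 : (e : E → ℝ) =ᵐ[m] fun _ => 1 := (memLp_const (1 : ℝ)).coeFn_toLp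
  set c := ∫ x, f x ∂m with hc
  have hfc : MemLp (fun x => f x + (-c)) 2 m := hf.add (memLp_const _)
  set q : WithLp 2 (Lp ℝ 2 m × Lp E 2 m) := WithLp.toLp 2 (hfc.toLp _, hσG.toLp _) with hq
  have hqD : q ∈ D := by
    refine (hD q).2 ((hG.add (hasWeakGradient_const (-c))).congr
      (h.volume_absolutelyContinuous.ae_eq hfc.coeFn_toLp).symm ?_)
    filter_upwards [h.volume_absolutelyContinuous.ae_le hσG.coeFn_toLp, h.inv_smul_smul_ae G]
      with x h1 h2
    rw [add_zero]
    change G x = (σ x)⁻¹ • (hσG.toLp _) x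
    rw [h1, h2]
  have hres : ∀ b : ℝ, 0 < b → b < a → b ∈ graphResolventSet (FormGraph D) := by
    intro b hb0 hba
    by_contra hcon
    rcases hs hcon with h1 | h1
    · exact hb0.ne' h1
    · exact absurd h1 (not_le.2 hba)
  -- This is where the connectedness built into the convex exhaustion enters: zero energy forces a
  -- constant.
  have hker : ∀ f, WithLp.toLp 2 (f, (0 : Lp E 2 m)) ∈ D → ∃ t : ℝ, f = t • e := by
    intro u hu
    have h1 := (hD _).1 hu
    obtain ⟨t, ht⟩ := h.exists_ae_eq_const (Lp.memLp u) h1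
      (h.volume_absolutelyContinuous.ae_le (Eventually.of_forall fun x => by simp))
    refine ⟨t, Lp.ext ?_⟩
    filter_upwards [ht, Lp.coeFn_smul t e, he1] with x h1 h2 h3
    rw [h1, h2, Pi.smul_apply, h3]
    simp
  have hqe : ⟪e, q.fst⟫_ℝ = 0 := by
    rw [he, inner_one_eq]
    have : ∫ x, (hfc.toLp _) x ∂m = ∫ x, f x + (-c) ∂m := integral_congr_ae hfc.coeFn_toLp
    refine this.trans ?_
    rw [integral_add (hf.integrable (by norm_num)) (integrable_const _)]
    simp [hc]
  have := poincare_of_forall_mem_graphResolventSet hDc hker ha0 hres hqD hqe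
  rw [← integral_sq_eq_norm_sq, ← integral_sq_eq_norm_sq] at this
  have e1 : ∫ x, ‖q.fst x‖ ^ 2 ∂m = ∫ x, f x ^ 2 ∂m - c ^ 2 := by
    rw [hc, ← integral_sub_integral_sq hf]
    refine integral_congr_ae ?_
    filter_upwards [hfc.coeFn_toLp] with x hx
    change ‖(hfc.toLp _) x‖ ^ 2 = _
    rw [hx, Real.norm_eq_abs, sq_abs]
    rfl
  have e2 : ∫ x, ‖q.snd x‖ ^ 2 ∂m = ∫ x, σ x ^ 2 * ‖G x‖ ^ 2 ∂m := by
    refine integral_congr_ae ?_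
    filter_upwards [hσG.coeFn_toLp] with x hx
    change ‖(hσG.toLp _) x‖ ^ 2 = _
    rw [hx, norm_smul, mul_pow, Real.norm_eq_abs, sq_abs]
  rwa [e1, e2] at this

end RegularWeight

end WeightedSobolev

end


noncomputable section

/-! ### Polar coordinates as a product of measures. -/

section Polar

variable {E : Type*} [NormedAddCommGroup E] [InnerProductSpace ℝ E] [FiniteDimensional ℝ E]
  [MeasurableSpace E] [BorelSpace E] [Nontrivial E]

/-- Integration in polar coordinates. -/
theorem lintegral_polar {F : E → ℝ≥0∞} (hF : Measurable F) :
    ∫⁻ x, F x = ∫⁻ θ, (∫⁻ r in Ioi (0 : ℝ),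
      ENNReal.ofReal (r ^ (Module.finrank ℝ E - 1)) * F (r • (θ : E)))
        ∂(volume : Measure E).toSphere := by
  have h0 : (volume : Measure E).restrict {0}ᶜ = volume :=
    Measure.restrict_eq_self_of_ae_mem (by
      rw [ae_iff]; simp)
  have hmp := (volume : Measure E).measurePreserving_homeomorphUnitSphereProd
  calc ∫⁻ x, F x = ∫⁻ x in ({0}ᶜ : Set E), F x := by rw [h0]
    _ = ∫⁻ x : ({0}ᶜ : Set E), F x ∂(volume.comap Subtype.val) :=
        (lintegral_subtype_comap (measurableSet_singleton _).compl F).symm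
    _ = ∫⁻ z, F ((z.2 : ℝ) • (z.1 : E)) ∂((volume : Measure E).toSphere.prod
          (Measure.volumeIoiPow (Module.finrank ℝ E - 1))) := by
        rw [← hmp.lintegral_comp (by fun_prop)]
        refine lintegral_congr fun x => ?_
        have h := congrArg Subtype.val ((homeomorphUnitSphereProd E).symm_apply_apply x)
        rw [homeomorphUnitSphereProd_symm_apply_coe] at h
        rw [h]
    _ = _ := by
        rw [lintegral_prod _ (by fun_prop)]
        refine lintegral_congr fun θ => ?_
        rw [Measure.volumeIoiPow, lintegral_withDensity_eq_lintegral_mul _ (by fun_prop)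
          (by fun_prop)]
        exact lintegral_subtype_comap measurableSet_Ioi
          (fun r : ℝ => ENNReal.ofReal (r ^ (Module.finrank ℝ E - 1)) * F (r • (θ : E)))

/-- The uniform probability measure on the unit sphere. -/
def sphereLaw (E : Type*) [NormedAddCommGroup E] [InnerProductSpace ℝ E] [FiniteDimensional ℝ E]
    [MeasurableSpace E] [BorelSpace E] : Measure (Metric.sphere (0 : E) 1) :=
  ((volume : Measure E).toSphere univ)⁻¹ • (volume : Measure E).toSphere

theorem toSphere_univ_ne_zero : (volume : Measure E).toSphere univ ≠ 0 := by
  rw [Ne, Measure.measure_univ_eq_zero]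
  exact Measure.toSphere_ne_zero _

instance : IsProbabilityMeasure (sphereLaw E) := by
  refine ⟨?_⟩
  rw [sphereLaw, Measure.smul_apply, smul_eq_mul,
    ENNReal.inv_mul_cancel toSphere_univ_ne_zero (measure_ne_top _ _)]

/-- The law of the norm under the measure with density `w ‖x‖`. -/
def radialLaw (E : Type*) [NormedAddCommGroup E] [InnerProductSpace ℝ E] [FiniteDimensional ℝ E]
    [MeasurableSpace E] [BorelSpace E] (w : ℝ → ℝ≥0∞) : Measure ℝ :=
  (volume : Measure E).toSphere univ • (volume.restrict (Ioi (0 : ℝ))).withDensity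
    fun r => ENNReal.ofReal (r ^ (Module.finrank ℝ E - 1)) * w r

/-- The polar coordinates map. -/
def polarMap (z : Metric.sphere (0 : E) 1 × ℝ) : E := z.2 • (z.1 : E)

omit [Nontrivial E] [FiniteDimensional ℝ E] in
theorem measurable_polarMap : Measurable (polarMap : Metric.sphere (0 : E) 1 × ℝ → E) := by
  unfold polarMap
  fun_prop

instance sfinite_radialLaw (w : ℝ → ℝ≥0∞) : SFinite (radialLaw E w) := by
  unfold radialLaw; infer_instance

/-- Integration in polar coordinates, with the total mass of the surface measure moved from the
sphere to the radial factor so that the spherical factor is a probability measure. -/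
theorem measurePreserving_polarMap {w : ℝ → ℝ≥0∞} (hw : Measurable w) :
    MeasurePreserving (polarMap : Metric.sphere (0 : E) 1 × ℝ → E)
      ((sphereLaw E).prod (radialLaw E w)) (volume.withDensity fun x : E => w ‖x‖) := by
  refine ⟨measurable_polarMap, Measure.ext_of_lintegral _ fun F hF => ?_⟩
  rw [lintegral_map hF measurable_polarMap,
    lintegral_withDensity_eq_lintegral_mul _ (by fun_prop) hF, lintegral_polar (by fun_prop),
    lintegral_prod _ (by
      exact (hF.comp measurable_polarMap).aemeasurable), sphereLaw, lintegral_smul_measure]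
  have hin : ∀ θ : Metric.sphere (0 : E) 1, ∫⁻ r, F (polarMap (θ, r)) ∂(radialLaw E w) =
      (volume : Measure E).toSphere univ * ∫⁻ r in Ioi (0 : ℝ),
      ENNReal.ofReal (r ^ (Module.finrank ℝ E - 1)) * ((fun x : E => w ‖x‖) * F) (r • (θ : E)) := by
    intro θ
    have hFm : Measurable fun r => F (polarMap (θ, r)) :=
      (hF.comp measurable_polarMap).comp measurable_prodMk_left
    rw [radialLaw, lintegral_smul_measure, lintegral_withDensity_eq_lintegral_mul _
      (by fun_prop) hFm, smul_eq_mul]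
    congr 1
    refine setLIntegral_congr_fun measurableSet_Ioi fun r hr => ?_
    have hr : 0 < r := hr
    simp [polarMap, norm_smul, abs_of_pos hr, mul_assoc]
  simp_rw [hin]
  rw [lintegral_const_mul' _ _ (measure_ne_top _ _), smul_eq_mul, ← mul_assoc,
    ENNReal.inv_mul_cancel toSphere_univ_ne_zero (measure_ne_top _ _), one_mul]

theorem isProbabilityMeasure_radialLaw {w : ℝ → ℝ≥0∞} (hw : Measurable w)
    [h : IsProbabilityMeasure (volume.withDensity fun x : E => w ‖x‖)] :
    IsProbabilityMeasure (radialLaw E w) := by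
  refine ⟨?_⟩
  have h1 := (measurePreserving_polarMap (E := E) hw).measure_preimage
    MeasurableSet.univ.nullMeasurableSet
  rw [preimage_univ, ← univ_prod_univ, Measure.prod_prod, h.measure_univ, measure_univ,
    one_mul] at h1
  exact h1

end Polar

/-! ### Density of the standard Gaussian. -/

section GaussianDensity

open ProbabilityTheory

/-- The point is that the density is a function of the norm, so the polar factorization covers the
Gaussian as well. -/
theorem stdGaussian_eq_withDensity (n : ℕ) :
    stdGaussian (EuclideanSpace ℝ (Fin n)) = volume.withDensity fun x =>
      ENNReal.ofReal ((√(2 * Real.pi))⁻¹ ^ n * Real.exp (-‖x‖ ^ 2 / 2)) := by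
  set g : ℝ → ℝ := gaussianPDFReal 0 1 with hg
  have hprod : ∀ x : Fin n → ℝ, ∏ i, g (x i) =
      (√(2 * Real.pi))⁻¹ ^ n * Real.exp (-‖(WithLp.toLp 2 x : EuclideanSpace ℝ (Fin n))‖ ^ 2 / 2) := by
    intro x
    simp only [hg, gaussianPDFReal]
    rw [Finset.prod_mul_distrib, ← Real.exp_sum, EuclideanSpace.norm_sq_eq]
    simp only [Finset.prod_const, Finset.card_univ, Fintype.card_fin, NNReal.coe_one, mul_one,
      sub_zero, Real.norm_eq_abs, sq_abs]
    rw [← Finset.sum_div, Finset.sum_neg_distrib]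
  have hpi : Measure.pi (fun _ : Fin n => gaussianReal 0 1) =
      volume.withDensity fun x : Fin n → ℝ => ENNReal.ofReal (∏ i, g (x i)) := by
    refine Measure.pi_eq fun s hs => ?_
    rw [withDensity_apply _ (MeasurableSet.univ_pi hs),
      ← lintegral_indicator (MeasurableSet.univ_pi hs)]
    have e1 : ∀ x : Fin n → ℝ, (univ.pi s).indicator
        (fun x : Fin n → ℝ => ENNReal.ofReal (∏ i, g (x i))) x =
        ENNReal.ofReal (∏ i, (s i).indicator g (x i)) := by
      intro x
      by_cases hx : x ∈ univ.pi s
      · rw [indicator_of_mem hx]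
        congr 1
        refine Finset.prod_congr rfl fun i _ => ?_
        rw [indicator_of_mem (hx i (mem_univ i))]
      · rw [indicator_of_notMem hx]
        simp only [mem_univ_pi, not_forall] at hx
        obtain ⟨i, hi⟩ := hx
        rw [Finset.prod_eq_zero (Finset.mem_univ i) (indicator_of_notMem hi _), ENNReal.ofReal_zero]
    have hgi : ∀ i, Integrable ((s i).indicator g) :=
      fun i => (integrable_gaussianPDFReal 0 1).indicator (hs i)
    have hg0 : ∀ i x, 0 ≤ (s i).indicator g x := fun i x =>
      indicator_nonneg (fun y _ => gaussianPDFReal_nonneg _ _ _) _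
    simp_rw [e1]
    rw [← ofReal_integral_eq_lintegral_ofReal, integral_fintype_prod_volume_eq_prod,
      ENNReal.ofReal_prod_of_nonneg]
    · refine Finset.prod_congr rfl fun i _ => ?_
      rw [gaussianReal_apply_eq_integral _ one_ne_zero, integral_indicator (hs i)]
    · exact fun i _ => integral_nonneg (hg0 i)
    · exact Integrable.fintype_prod hgi
    · exact Eventually.of_forall fun x => Finset.prod_nonneg fun i _ => hg0 i _
  rw [← map_pi_eq_stdGaussian, hpi]
  refine Measure.ext_of_lintegral _ fun F hF => ?_
  have hm : Measurable (WithLp.toLp 2 : (Fin n → ℝ) → EuclideanSpace ℝ (Fin n)) := by fun_prop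
  have hF' : Measurable fun x : Fin n → ℝ => F (WithLp.toLp 2 x) := hF.comp hm
  rw [lintegral_map hF hm, lintegral_withDensity_eq_lintegral_mul _ _ hF',
    lintegral_withDensity_eq_lintegral_mul _ (by fun_prop) hF,
    ← (PiLp.volume_preserving_toLp (Fin n)).lintegral_comp (by fun_prop)]
  · refine lintegral_congr fun x => ?_
    simp only [Pi.mul_apply, hprod]
  · simp_rw [hprod]
    exact Measurable.ennreal_ofReal (by fun_prop)

end GaussianDensity

end


noncomputable section

/-! ### Gaussian Poincaré inequality in dimension one and on products. -/

section GaussianPoincare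

open ProbabilityTheory

theorem integrable_gaussianReal_iff {F : ℝ → ℝ} :
    Integrable F (gaussianReal 0 1) ↔ Integrable fun x => gaussianPDFReal 0 1 x * F x := by
  rw [gaussianReal_of_var_ne_zero 0 one_ne_zero,
    integrable_withDensity_iff_integrable_smul' (measurable_gaussianPDF 0 1)
      (Eventually.of_forall fun x => gaussianPDF_lt_top)]
  simp [toReal_gaussianPDF]

theorem hasDerivAt_gaussianPDFReal (x : ℝ) :
    HasDerivAt (gaussianPDFReal 0 1) (-x * gaussianPDFReal 0 1 x) x := by
  unfold gaussianPDFReal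
  have h1 : HasDerivAt (fun x : ℝ => -(x - 0) ^ 2 / (2 * ((1 : ℝ≥0) : ℝ))) (-x) x := by
    have := (((hasDerivAt_id x).sub_const 0).pow 2).neg.div_const (2 * ((1 : ℝ≥0) : ℝ))
    refine HasDerivAt.congr_deriv (f := fun x : ℝ => -(x - 0) ^ 2 / (2 * ((1 : ℝ≥0) : ℝ))) this ?_
    simp only [id, NNReal.coe_one, Nat.cast_ofNat]
    ring
  refine (h1.exp.const_mul (√(2 * Real.pi * ((1 : ℝ≥0) : ℝ)))⁻¹).congr_deriv ?_
  ring

/-- The one-dimensional Gaussian inequality for functions vanishing at the origin. -/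
theorem integral_sq_le_integral_deriv_sq_gaussianReal {g : ℝ → ℝ} (hg : Differentiable ℝ g)
    {C : ℝ} (hC : ∀ x, |deriv g x| ≤ C) (h0 : g 0 = 0) :
    ∫ x, g x ^ 2 ∂(gaussianReal 0 1) ≤ ∫ x, deriv g x ^ 2 ∂(gaussianReal 0 1) := by
  have hC0 : 0 ≤ C := (abs_nonneg _).trans (hC 0)
  set p := gaussianPDFReal 0 1 with hp
  have hp0 : ∀ x, 0 ≤ p x := gaussianPDFReal_nonneg 0 1
  have hpd : ∀ x, HasDerivAt p (-x * p x) x := hasDerivAt_gaussianPDFReal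
  have hlip : ∀ x, |g x| ≤ C * |x| := by
    intro x
    have := Convex.norm_image_sub_le_of_norm_deriv_le (𝕜 := ℝ) (f := g) (s := univ) (x := 0)
      (y := x) (C := C) (fun x _ => hg x) (fun x _ => hC x) convex_univ (mem_univ _) (mem_univ _)
    simpa [h0] using this
  have i0 : Integrable p := integrable_gaussianPDFReal 0 1
  have i2 : Integrable fun x => p x * x ^ 2 := integrable_gaussianReal_iff.1
    ((memLp_id_gaussianReal (μ := 0) (v := 1) 2).integrable_sq)
  have ib : Integrable fun x => p x * ((3 * C ^ 2) * (1 + x ^ 2)) := by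
    have : (fun x => p x * ((3 * C ^ 2) * (1 + x ^ 2))) =
        fun x => (3 * C ^ 2) * p x + (3 * C ^ 2) * (p x * x ^ 2) := by
      ext x; ring
    rw [this]
    exact (i0.const_mul _).add (i2.const_mul _)
  -- Since `p' = -x p`, one has `p g'² - p g² - B' = p (g' - g / x)² ≥ 0`, and `B'` integrates to
  -- zero. The condition `g 0 = 0` removes the singularity at the origin, where `B' = g'(0)² p(0)`.
  set B : ℝ → ℝ := fun x => g x ^ 2 / x * p x with hB
  set D : ℝ → ℝ := fun x => if x = 0 then deriv g 0 ^ 2 * p 0 else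
    (2 * g x * deriv g x / x - g x ^ 2 / x ^ 2 - g x ^ 2) * p x with hD
  have hBD : ∀ x, HasDerivAt B (D x) x := by
    intro x
    by_cases hx : x = 0
    · subst hx
      have e : D 0 = deriv g 0 ^ 2 * p 0 := by simp [hD]
      rw [e, hasDerivAt_iff_tendsto_slope]
      have h1 := hasDerivAt_iff_tendsto_slope.1 (hg 0).hasDerivAt
      have h2 : Tendsto p (𝓝[≠] 0) (𝓝 (p 0)) := (hpd 0).continuousAt.mono_left nhdsWithin_le_nhds
      refine ((h1.pow 2).mul h2).congr' ?_
      filter_upwards [self_mem_nhdsWithin] with y hy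
      have hy : y ≠ 0 := hy
      simp only [slope_def_field, hB, h0]
      field_simp
      ring
    · have e : D x = (2 * g x * deriv g x / x - g x ^ 2 / x ^ 2 - g x ^ 2) * p x := by
        simp [hD, hx]
      rw [e]
      have h1 := (((hg x).hasDerivAt.pow 2).div (hasDerivAt_id x) hx).mul (hpd x)
      refine HasDerivAt.congr_deriv (f := B) h1 ?_
      simp only [id, Pi.pow_apply, Pi.div_apply]
      field_simp
      push_cast
      ring
  -- Both `g / x` and `g'` are at most `C` in absolute value, so `D / p` is bounded by `3 C² + C²
  -- x²`.
  have hDb : ∀ x, |D x| ≤ p x * ((3 * C ^ 2) * (1 + x ^ 2)) := by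
    intro x
    by_cases hx : x = 0
    · have e : D x = deriv g 0 ^ 2 * p 0 := by simp [hD, hx]
      rw [e, hx, abs_of_nonneg (mul_nonneg (sq_nonneg _) (hp0 0))]
      have : deriv g 0 ^ 2 ≤ C ^ 2 := sq_le_sq' (abs_le.1 (hC 0)).1 (abs_le.1 (hC 0)).2
      nlinarith [hp0 0, mul_nonneg (hp0 0) (sq_nonneg C), mul_le_mul_of_nonneg_right this (hp0 0)]
    · have e : D x = (2 * g x * deriv g x / x - g x ^ 2 / x ^ 2 - g x ^ 2) * p x := by
        simp [hD, hx]
      rw [e, abs_mul, abs_of_nonneg (hp0 x), mul_comm]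
      refine mul_le_mul_of_nonneg_left ?_ (hp0 x)
      have ha : |g x / x| ≤ C := by
        rw [abs_div, div_le_iff₀ (abs_pos.2 hx)]
        exact hlip x
      have hb := hC x
      have e2 : 2 * g x * deriv g x / x - g x ^ 2 / x ^ 2 - g x ^ 2 =
          2 * (g x / x) * deriv g x - (g x / x) ^ 2 - (g x / x) ^ 2 * x ^ 2 := by
        field_simp
      rw [e2]
      set a := g x / x
      set b := deriv g x
      have ha2 : a ^ 2 ≤ C ^ 2 := sq_le_sq' (abs_le.1 ha).1 (abs_le.1 ha).2
      have hb2 : b ^ 2 ≤ C ^ 2 := sq_le_sq' (abs_le.1 hb).1 (abs_le.1 hb).2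
      have hax := mul_le_mul_of_nonneg_right ha2 (sq_nonneg x)
      have hCx : 0 ≤ C ^ 2 * x ^ 2 := by positivity
      have hax0 : 0 ≤ a ^ 2 * x ^ 2 := by positivity
      rw [abs_le]
      constructor
      · nlinarith [sq_nonneg (a + b), sq_nonneg (a - b)]
      · nlinarith [sq_nonneg (a + b), sq_nonneg (a - b)]
  have hDm : AEStronglyMeasurable D volume := by
    have : D = deriv B := by ext x; exact (hBD x).deriv.symm
    rw [this]
    exact (measurable_deriv B).aestronglyMeasurable
  have hBc : Continuous B := continuous_iff_continuousAt.2 fun x => (hBD x).continuousAt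
  have iD : Integrable D := ib.mono' hDm (Eventually.of_forall fun x => hDb x)
  have iB : Integrable B := by
    refine ib.mono' hBc.aestronglyMeasurable (Eventually.of_forall fun x => ?_)
    simp only [hB]
    rw [Real.norm_eq_abs, abs_mul, abs_of_nonneg (hp0 x), mul_comm]
    refine mul_le_mul_of_nonneg_left ?_ (hp0 x)
    by_cases hx : x = 0
    · simp [hx]; positivity
    · rw [abs_div, abs_pow, div_le_iff₀ (abs_pos.2 hx)]
      have h1 : |g x| ^ 2 ≤ (C * |x|) ^ 2 := by gcongr; exact hlip x
      refine h1.trans ?_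
      have h2 : x ^ 2 = |x| ^ 2 := (sq_abs x).symm
      rw [h2, mul_pow]
      have h3 : |x| ≤ 3 * (1 + |x| ^ 2) := by nlinarith [sq_nonneg (|x| - 1)]
      have h4 : 0 ≤ C ^ 2 * |x| := by positivity
      nlinarith [mul_le_mul_of_nonneg_left h3 h4]
  have hint := integral_eq_zero_of_hasDerivAt_of_integrable hBD iD iB
  have im1 : Integrable fun x => p x * g x ^ 2 := by
    refine ib.mono' (((hpd · |>.continuousAt) |> continuous_iff_continuousAt.2).mul
      (hg.continuous.pow 2)).aestronglyMeasurable (Eventually.of_forall fun x => ?_)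
    rw [Real.norm_eq_abs, abs_mul, abs_of_nonneg (hp0 x)]
    refine mul_le_mul_of_nonneg_left ?_ (hp0 x)
    rw [abs_pow]
    have h1 : |g x| ^ 2 ≤ (C * |x|) ^ 2 := by gcongr; exact hlip x
    rw [mul_pow, sq_abs x] at h1
    have hCx : 0 ≤ C ^ 2 * x ^ 2 := by positivity
    nlinarith [sq_nonneg C]
  have im2 : Integrable fun x => p x * deriv g x ^ 2 := by
    refine ib.mono' (((measurable_gaussianPDFReal 0 1).mul
      ((measurable_deriv g).pow_const 2)).aestronglyMeasurable) (Eventually.of_forall fun x => ?_)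
    rw [Real.norm_eq_abs, abs_mul, abs_of_nonneg (hp0 x)]
    refine mul_le_mul_of_nonneg_left ?_ (hp0 x)
    rw [abs_of_nonneg (sq_nonneg _)]
    have hb2 : deriv g x ^ 2 ≤ C ^ 2 := sq_le_sq' (abs_le.1 (hC x)).1 (abs_le.1 (hC x)).2
    have hCx : 0 ≤ C ^ 2 * x ^ 2 := by positivity
    nlinarith [sq_nonneg C]
  rw [integral_gaussianReal_eq_integral_smul one_ne_zero,
    integral_gaussianReal_eq_integral_smul one_ne_zero]
  simp only [smul_eq_mul]
  rw [← sub_nonneg, ← integral_sub im2 im1, ← hint]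
  refine integral_mono_ae iD (im2.sub im1) ?_
  have hne : ∀ᵐ x : ℝ, x ≠ 0 := by simp [ae_iff]
  filter_upwards [hne] with x hx
  have e : D x = (2 * g x * deriv g x / x - g x ^ 2 / x ^ 2 - g x ^ 2) * p x := by
    simp [hD, hx]
  rw [e]
  have : p x * deriv g x ^ 2 - p x * g x ^ 2 -
      (2 * g x * deriv g x / x - g x ^ 2 / x ^ 2 - g x ^ 2) * p x =
      p x * (deriv g x - g x / x) ^ 2 := by
    field_simp
    ring
  have h1 : 0 ≤ p x * (deriv g x - g x / x) ^ 2 := mul_nonneg (hp0 x) (sq_nonneg _)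
  linarith

/-- A bounded derivative gives linear growth, so a finite second moment suffices. -/
theorem memLp_of_lipschitz {E : Type*} [NormedAddCommGroup E] [NormedSpace ℝ E]
    [MeasurableSpace E] [BorelSpace E] [SecondCountableTopology E] {m : Measure E}
    [IsFiniteMeasure m] (hm : MemLp (fun x => x) 2 m) {f : E → ℝ} (hf : Differentiable ℝ f) {C : ℝ}
    (hC : ∀ x, ‖fderiv ℝ f x‖ ≤ C) : MemLp f 2 m := by
  have hlip : ∀ x, ‖f x‖ ≤ |f 0| + C * ‖x‖ := by
    intro x
    have := Convex.norm_image_sub_le_of_norm_fderiv_le (𝕜 := ℝ) (f := f) (s := univ) (x := 0)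
      (y := x) (C := C) (fun x _ => hf x) (fun x _ => hC x) convex_univ (mem_univ _) (mem_univ _)
    rw [sub_zero] at this
    have h2 := norm_add_le (f x - f 0) (f 0)
    rw [sub_add_cancel] at h2
    have h3 : ‖f 0‖ = |f 0| := rfl
    linarith
  have h0 : MemLp (fun _ : E => |f 0|) 2 m := memLp_const _
  have h2 : MemLp (fun x : E => C * ‖x‖) 2 m := MemLp.const_mul hm.norm C
  have h1 : MemLp (fun x : E => |f 0| + C * ‖x‖) 2 m := h0.add h2
  refine h1.mono hf.continuous.aestronglyMeasurable (Eventually.of_forall fun x => ?_)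
  exact (hlip x).trans (le_abs_self _)

/-- The variance is at most the second moment about any constant, in particular about the value at
the origin. -/
theorem variance_le_integral_deriv_sq_gaussianReal {f : ℝ → ℝ} (hf : Differentiable ℝ f)
    {C : ℝ} (hC : ∀ x, |deriv f x| ≤ C) :
    ∫ x, f x ^ 2 ∂(gaussianReal 0 1) - (∫ x, f x ∂(gaussianReal 0 1)) ^ 2 ≤
      ∫ x, deriv f x ^ 2 ∂(gaussianReal 0 1) := by
  have hm : MemLp f 2 (gaussianReal 0 1) := by
    refine memLp_of_lipschitz (memLp_id_gaussianReal (μ := 0) (v := 1) 2) hf (C := C) fun x => ?_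
    rw [← norm_deriv_eq_norm_fderiv]
    exact hC x
  have h1 := integral_sq_le_integral_deriv_sq_gaussianReal (g := fun x => f x - f 0)
    (hf.sub_const _) (C := C) (by simpa using hC) (by simp)
  rw [integral_sub_const_sq hm] at h1
  simp only [deriv_sub_const] at h1
  nlinarith [sq_nonneg (∫ x, f x ∂(gaussianReal 0 1) - f 0)]

theorem memLp_pi_gaussian (n : ℕ) :
    MemLp (fun x : Fin n → ℝ => x) 2 (Measure.pi fun _ : Fin n => gaussianReal 0 1) := by
  refine memLp_pi_iff.2 fun i => ?_
  exact (memLp_id_gaussianReal (μ := 0) (v := 1) 2).comp_measurePreserving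
    (measurePreserving_eval (fun _ : Fin n => gaussianReal 0 1) i)

theorem sq_integral_le {α : Type*} [MeasurableSpace α] {m : Measure α} [IsProbabilityMeasure m]
    {f : α → ℝ} (hf : MemLp f 2 m) : (∫ x, f x ∂m) ^ 2 ≤ ∫ x, f x ^ 2 ∂m := by
  have h1 := integral_sub_integral_sq hf
  have h2 : 0 ≤ ∫ x, (f x - ∫ y, f y ∂m) ^ 2 ∂m := integral_nonneg fun x => sq_nonneg _
  linarith

/-- The Gaussian Poincaré inequality, on the product space. -/
theorem variance_le_sum_pi_gaussian (n : ℕ) {f : (Fin n → ℝ) → ℝ} (hf : Differentiable ℝ f) {C : ℝ}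
    (hC : ∀ x, ‖fderiv ℝ f x‖ ≤ C) :
    ∫ x, f x ^ 2 ∂(Measure.pi fun _ : Fin n => gaussianReal 0 1) -
      (∫ x, f x ∂(Measure.pi fun _ : Fin n => gaussianReal 0 1)) ^ 2 ≤
    ∑ i, ∫ x, fderiv ℝ f x (Pi.single i 1) ^ 2
      ∂(Measure.pi fun _ : Fin n => gaussianReal 0 1) := by
  induction n with
  | zero =>
    have h1 : ∀ x : Fin 0 → ℝ, f x = f 0 := fun x => by rw [Subsingleton.elim x 0]
    simp_rw [h1]
    simp
  | succ n ih =>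
    set γ := gaussianReal 0 1 with hγ
    set P : Measure (Fin n → ℝ) := Measure.pi fun _ => γ with hP
    set Q : Measure (Fin (n + 1) → ℝ) := Measure.pi fun _ => γ with hQ
    have hmp : MeasurePreserving (MeasurableEquiv.piFinSuccAbove (fun _ : Fin (n + 1) => ℝ) 0).symm
        (γ.prod P) Q :=
      (measurePreserving_piFinSuccAbove (fun _ : Fin (n + 1) => γ) 0).symm
    have hcons : ∀ z : ℝ × (Fin n → ℝ),
        (MeasurableEquiv.piFinSuccAbove (fun _ : Fin (n + 1) => ℝ) 0).symm z = Fin.cons z.1 z.2 := by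
      intro z
      rw [← Fin.insertNth_zero']
      rfl
    have hint : ∀ F : (Fin (n + 1) → ℝ) → ℝ, Integrable F Q →
        Integrable (fun z : ℝ × (Fin n → ℝ) => F (Fin.cons z.1 z.2)) (γ.prod P) ∧
        ∫ x, F x ∂Q = ∫ s, ∫ y, F (Fin.cons s y) ∂P ∂γ := by
      intro F hF
      have h1 : Integrable (fun z : ℝ × (Fin n → ℝ) => F (Fin.cons z.1 z.2)) (γ.prod P) := by
        have := hmp.integrable_comp_of_integrable hF
        refine this.congr (Eventually.of_forall fun z => ?_)
        simp only [Function.comp, hcons]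
      refine ⟨h1, ?_⟩
      rw [← integral_prod _ h1, ← hmp.integral_comp' ]
      simp_rw [hcons]
    -- derivatives along the two factors
    set L1 : ℝ →L[ℝ] (Fin (n + 1) → ℝ) :=
      ContinuousLinearMap.pi (Fin.cons (ContinuousLinearMap.id ℝ ℝ) fun _ => 0) with hL1
    set L2 : (Fin n → ℝ) →L[ℝ] (Fin (n + 1) → ℝ) :=
      ContinuousLinearMap.pi (Fin.cons 0 fun i => ContinuousLinearMap.proj i) with hL2
    have hL1x : ∀ s, L1 s = Fin.cons s 0 := by
      intro s; ext i; refine Fin.cases ?_ (fun j => ?_) i <;> simp [hL1]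
    have hL2x : ∀ y, L2 y = Fin.cons 0 y := by
      intro y; ext i; refine Fin.cases ?_ (fun j => ?_) i <;> simp [hL2]
    have hsplit : ∀ s y, (Fin.cons s y : Fin (n + 1) → ℝ) = L1 s + L2 y := by
      intro s y; rw [hL1x, hL2x]; ext i; refine Fin.cases ?_ (fun j => ?_) i <;> simp
    have hL1s : L1 1 = Pi.single 0 1 := by
      rw [hL1x]; ext i; refine Fin.cases ?_ (fun j => ?_) i <;> simp
    have hL2s : ∀ j, L2 (Pi.single j 1) = Pi.single j.succ 1 := by
      intro j; rw [hL2x]; ext i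
      refine Fin.cases ?_ (fun k => ?_) i
      · simp
      · simp [Pi.single_apply]
    have hL2n : ‖L2‖ ≤ 1 := by
      refine L2.opNorm_le_bound zero_le_one fun y => ?_
      rw [one_mul, hL2x, pi_norm_le_iff_of_nonneg (norm_nonneg _)]
      intro i
      refine Fin.cases ?_ (fun j => ?_) i
      · simp
      · simpa using norm_le_pi_norm y j
    have hL1n : ‖L1 1‖ ≤ 1 := by
      rw [hL1x, pi_norm_le_iff_of_nonneg zero_le_one]
      intro i
      refine Fin.cases ?_ (fun j => ?_) i <;> simp
    have hC0 : 0 ≤ C := (norm_nonneg _).trans (hC 0)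
    have hdy : ∀ s y, HasFDerivAt (fun y => f (Fin.cons s y))
        ((fderiv ℝ f (Fin.cons s y)).comp L2) y := by
      intro s y
      have h1 : HasFDerivAt (fun y => L1 s + L2 y) L2 y := L2.hasFDerivAt.const_add _
      have h2 := ((hf (L1 s + L2 y)).hasFDerivAt).comp y h1
      simp_rw [hsplit]
      exact h2
    have hds : ∀ s y, HasDerivAt (fun s => f (Fin.cons s y))
        (fderiv ℝ f (Fin.cons s y) (Pi.single 0 1)) s := by
      intro s y
      have h1 : HasFDerivAt (fun s => L1 s + L2 y) L1 s := L1.hasFDerivAt.add_const _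
      have h2 := (((hf (L1 s + L2 y)).hasFDerivAt).comp s h1).hasDerivAt
      simp_rw [hsplit]
      rw [← hL1s]
      exact h2
    have hfQ : MemLp f 2 Q := memLp_of_lipschitz (memLp_pi_gaussian (n + 1)) hf hC
    have hfi : Integrable f Q := hfQ.integrable (by norm_num)
    have hfi2 : Integrable (fun x => f x ^ 2) Q := hfQ.integrable_sq
    have hDb : ∀ x v, |fderiv ℝ f x v| ≤ C * ‖v‖ := fun x v =>
      ((fderiv ℝ f x).le_opNorm v).trans (by gcongr; exact hC x)
    have hDi : ∀ v, Integrable (fun x => fderiv ℝ f x v ^ 2) Q := by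
      intro v
      refine Integrable.of_bound (((measurable_fderiv_apply_const ℝ f v).pow_const 2)
        |>.aestronglyMeasurable) ((C * ‖v‖) ^ 2) (Eventually.of_forall fun x => ?_)
      rw [Real.norm_eq_abs, abs_pow]
      gcongr
      exact hDb x v
    have hfy : ∀ s, Differentiable ℝ fun y => f (Fin.cons s y) :=
      fun s y => (hdy s y).differentiableAt
    have hfyC : ∀ s y, ‖fderiv ℝ (fun y => f (Fin.cons s y)) y‖ ≤ C := by
      intro s y
      rw [(hdy s y).fderiv]
      refine (ContinuousLinearMap.opNorm_comp_le _ _).trans ?_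
      have := mul_le_mul (hC (Fin.cons s y)) hL2n (norm_nonneg _) hC0
      linarith
    have hfyP : ∀ s, MemLp (fun y => f (Fin.cons s y)) 2 P := fun s =>
      memLp_of_lipschitz (memLp_pi_gaussian n) (hfy s) (hfyC s)
    -- Tensorisation: the variance is the mean of the variances in the last `n` coordinates, bounded
    -- by induction, plus the variance of the partial mean `h`, bounded by the one-dimensional
    -- inequality.
    set h : ℝ → ℝ := fun s => ∫ y, f (Fin.cons s y) ∂P with hh
    have hmeas1 : ∀ s, Measurable fun y : Fin n → ℝ =>
        fderiv ℝ f (Fin.cons s y) (Pi.single 0 1) := by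
      intro s
      have h2 : Measurable fun y => L1 s + L2 y := by fun_prop
      have h3 := (measurable_fderiv_apply_const ℝ f (Pi.single 0 1)).comp h2
      refine (congrArg Measurable (funext fun y => ?_)).mp h3
      rw [hsplit]
      rfl
    have hb1 : ∀ x, |fderiv ℝ f x (Pi.single 0 1)| ≤ C := by
      intro x
      have := hDb x (Pi.single 0 1)
      rw [← hL1s] at this ⊢
      exact this.trans (mul_le_of_le_one_right hC0 hL1n)
    have hhd : ∀ s, HasDerivAt h (∫ y, fderiv ℝ f (Fin.cons s y) (Pi.single 0 1) ∂P) s := by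
      intro s
      refine (hasDerivAt_integral_of_dominated_loc_of_deriv_le (μ := P) (s := univ)
        (F := fun t y => f (Fin.cons t y))
        (F' := fun t y => fderiv ℝ f (Fin.cons t y) (Pi.single 0 1)) (x₀ := s)
        (bound := fun _ => C) univ_mem ?_ ?_ ?_ ?_ ?_ ?_).2
      · exact Eventually.of_forall fun t => (hfyP t).1
      · exact (hfyP s).integrable (by norm_num)
      · exact (hmeas1 s).aestronglyMeasurable
      · exact Eventually.of_forall fun y t _ => hb1 _
      · exact integrable_const _
      · exact Eventually.of_forall fun y t _ => hds t y
    have hhC : ∀ s, |deriv h s| ≤ C := by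
      intro s
      rw [(hhd s).deriv]
      have := norm_integral_le_of_norm_le_const (μ := P) (C := C)
        (f := fun y => fderiv ℝ f (Fin.cons s y) (Pi.single 0 1))
        (Eventually.of_forall fun y => hb1 _)
      simpa using this
    have h1d := variance_le_integral_deriv_sq_gaussianReal
      (fun s => (hhd s).differentiableAt) hhC
    have hhγ : MemLp h 2 γ := by
      refine memLp_of_lipschitz (memLp_id_gaussianReal (μ := 0) (v := 1) 2)
        (fun s => (hhd s).differentiableAt) (C := C) fun x => ?_
      rw [← norm_deriv_eq_norm_fderiv]
      exact hhC x
    have hih : ∀ s, ∫ y, f (Fin.cons s y) ^ 2 ∂P ≤ h s ^ 2 +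
        ∑ j : Fin n, ∫ y, fderiv ℝ f (Fin.cons s y) (Pi.single j.succ 1) ^ 2 ∂P := by
      intro s
      have := ih (hfy s) (hfyC s)
      have e : ∀ y (j : Fin n), fderiv ℝ (fun y => f (Fin.cons s y)) y (Pi.single j 1) =
          fderiv ℝ f (Fin.cons s y) (Pi.single j.succ 1) := by
        intro y j
        rw [(hdy s y).fderiv, ContinuousLinearMap.comp_apply, hL2s]
      simp_rw [e] at this
      linarith
    -- Jensen, as `h'` is the partial mean of the first partial derivative.
    have hjen : ∀ s, deriv h s ^ 2 ≤ ∫ y, fderiv ℝ f (Fin.cons s y) (Pi.single 0 1) ^ 2 ∂P := by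
      intro s
      rw [(hhd s).deriv]
      exact sq_integral_le (MemLp.of_bound (hmeas1 s).aestronglyMeasurable C
        (Eventually.of_forall fun y => hb1 _))
    obtain ⟨j1, e1⟩ := hint _ hfi2
    obtain ⟨j2, e2⟩ := hint _ hfi
    have hj := fun v => hint _ (hDi v)
    rw [e1, e2, Fin.sum_univ_succ]
    simp_rw [(hj _).2]
    have a1 : ∫ s, ∫ y, f (Fin.cons s y) ^ 2 ∂P ∂γ ≤ ∫ s, h s ^ 2 ∂γ +
        ∑ j : Fin n, ∫ s, ∫ y, fderiv ℝ f (Fin.cons s y) (Pi.single j.succ 1) ^ 2 ∂P ∂γ := by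
      rw [← integral_finsetSum _ fun j _ => (hj _).1.integral_prod_left,
        ← integral_add hhγ.integrable_sq
          (integrable_finsetSum _ fun j _ => (hj _).1.integral_prod_left)]
      exact integral_mono j1.integral_prod_left (hhγ.integrable_sq.add
          (integrable_finsetSum _ fun j _ => (hj _).1.integral_prod_left)) hih
    have a2 : ∫ s, deriv h s ^ 2 ∂γ ≤
        ∫ s, ∫ y, fderiv ℝ f (Fin.cons s y) (Pi.single 0 1) ^ 2 ∂P ∂γ := by
      refine integral_mono ?_ (hj _).1.integral_prod_left hjen
      refine Integrable.of_bound ((measurable_deriv h).pow_const 2).aestronglyMeasurable (C ^ 2)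
        (Eventually.of_forall fun x => ?_)
      rw [Real.norm_eq_abs, abs_pow]
      gcongr
      exact hhC x
    linarith

end GaussianPoincare

end


noncomputable section

/-! ### Consequences of polar coordinates for norms and integrals. -/

section Polar

variable {E : Type*} [NormedAddCommGroup E] [InnerProductSpace ℝ E] [FiniteDimensional ℝ E]
  [MeasurableSpace E] [BorelSpace E]

theorem ae_radialLaw_pos (w : ℝ → ℝ≥0∞) : ∀ᵐ r ∂(radialLaw E w), 0 < r := by
  unfold radialLaw
  refine Measure.ae_smul_measure ?_ _
  exact (withDensity_absolutelyContinuous _ _).ae_le (ae_restrict_mem measurableSet_Ioi)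

omit [FiniteDimensional ℝ E] [MeasurableSpace E] [BorelSpace E] in
theorem norm_polarMap (θ : Metric.sphere (0 : E) 1) {r : ℝ} (hr : 0 < r) :
    ‖polarMap (θ, r)‖ = r := by
  have : ‖(θ : E)‖ = 1 := by simp
  simp [polarMap, norm_smul, this, abs_of_pos hr]

theorem ae_norm_polarMap [Nontrivial E] {ρ : Measure ℝ} [SFinite ρ] (hρ : ∀ᵐ r ∂ρ, 0 < r) :
    ∀ᵐ z ∂((sphereLaw E).prod ρ), 0 < z.2 ∧ ‖polarMap z‖ = z.2 := by
  have h1 : ∀ᵐ z ∂((sphereLaw E).prod ρ), 0 < z.2 :=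
    (measurePreserving_snd (μ := sphereLaw E) (ν := ρ)).quasiMeasurePreserving.ae hρ
  filter_upwards [h1] with z hz
  exact ⟨hz, norm_polarMap z.1 hz⟩

theorem measurePreserving_norm [Nontrivial E] {ρ : Measure ℝ} [SFinite ρ] {m : Measure E}
    (hρ : ∀ᵐ r ∂ρ, 0 < r)
    (h : MeasurePreserving (polarMap (E := E)) ((sphereLaw E).prod ρ) m) :
    MeasurePreserving (fun x : E => ‖x‖) m ρ := by
  refine ⟨measurable_norm, ?_⟩
  rw [← h.map_eq, Measure.map_map measurable_norm h.measurable]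
  refine (Measure.map_congr (g := Prod.snd) ?_).trans measurePreserving_snd.map_eq
  filter_upwards [ae_norm_polarMap hρ] with z hz
  exact hz.2

theorem MeasureTheory.MeasurePreserving.integral_map_eq {α β G : Type*} [MeasurableSpace α]
    [MeasurableSpace β] [NormedAddCommGroup G] [NormedSpace ℝ G] {f : α → β} {m : Measure α}
    {m' : Measure β} (h : MeasurePreserving f m m') {g : β → G} (hg : AEStronglyMeasurable g m') :
    ∫ y, g y ∂m' = ∫ x, g (f x) ∂m := by
  rw [← h.map_eq, integral_map h.measurable.aemeasurable (by rwa [h.map_eq])]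

end Polar

/-! ### Spherical Poincaré inequality with constant `n - 1`. -/

section SphericalPoincare

open ProbabilityTheory

theorem norm_gradient {E : Type*} [NormedAddCommGroup E] [InnerProductSpace ℝ E] [CompleteSpace E]
    (f : E → ℝ) (x : E) : ‖∇ f x‖ = ‖fderiv ℝ f x‖ := by
  simp [gradient]

theorem measurable_gradient {E : Type*} [NormedAddCommGroup E] [InnerProductSpace ℝ E]
    [CompleteSpace E] [MeasurableSpace E] [BorelSpace E] (f : E → ℝ) : Measurable (∇ f) :=
  (InnerProductSpace.toDual ℝ E).symm.continuous.measurable.comp (measurable_fderiv ℝ f)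

theorem EuclideanSpace.sum_fderiv_single_sq {n : ℕ} (f : EuclideanSpace ℝ (Fin n) → ℝ)
    (x : EuclideanSpace ℝ (Fin n)) :
    ∑ i, fderiv ℝ f x (EuclideanSpace.single i 1) ^ 2 = ‖∇ f x‖ ^ 2 := by
  rw [← (EuclideanSpace.basisFun (Fin n) ℝ).sum_sq_norm_inner_right (∇ f x)]
  refine Finset.sum_congr rfl fun i _ => ?_
  rw [inner_gradient_right, EuclideanSpace.basisFun_apply]
  simp

/-- The Gaussian Poincaré inequality on Euclidean space. -/
theorem variance_le_integral_gradient_sq_stdGaussian {n : ℕ} {f : EuclideanSpace ℝ (Fin n) → ℝ}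
    (hf : Differentiable ℝ f) {C : ℝ} (hC : ∀ x, ‖fderiv ℝ f x‖ ≤ C) :
    ∫ x, f x ^ 2 ∂(stdGaussian (EuclideanSpace ℝ (Fin n))) -
      (∫ x, f x ∂(stdGaussian (EuclideanSpace ℝ (Fin n)))) ^ 2 ≤
    ∫ x, ‖∇ f x‖ ^ 2 ∂(stdGaussian (EuclideanSpace ℝ (Fin n))) := by
  set L : (Fin n → ℝ) →L[ℝ] EuclideanSpace ℝ (Fin n) :=
    (PiLp.continuousLinearEquiv 2 ℝ fun _ : Fin n => ℝ).symm.toContinuousLinearMap with hL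
  have hLx : ∀ x, L x = WithLp.toLp 2 x := fun x => rfl
  have hmap : ∀ F : EuclideanSpace ℝ (Fin n) → ℝ, Measurable F →
      ∫ x, F x ∂(stdGaussian (EuclideanSpace ℝ (Fin n))) =
        ∫ x, F (L x) ∂(Measure.pi fun _ : Fin n => gaussianReal 0 1) := by
    intro F hF
    rw [← map_pi_eq_stdGaussian, integral_map (by fun_prop) hF.aestronglyMeasurable]
    rfl
  have hd : ∀ x, HasFDerivAt (fun y => f (L y)) ((fderiv ℝ f (L x)).comp L) x := fun x =>
    (hf (L x)).hasFDerivAt.comp x L.hasFDerivAt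
  have hC0 : 0 ≤ C := (norm_nonneg _).trans (hC 0)
  have key := variance_le_sum_pi_gaussian n (f := fun y => f (L y))
    (fun x => (hd x).differentiableAt) (C := C * ‖L‖) (fun x => by
      rw [(hd x).fderiv]
      exact (ContinuousLinearMap.opNorm_comp_le _ _).trans
        (mul_le_mul_of_nonneg_right (hC _) (norm_nonneg _)))
  rw [hmap _ (hf.continuous.measurable.pow_const 2), hmap _ hf.continuous.measurable,
    hmap _ ((measurable_gradient f).norm.pow_const 2)]
  refine key.trans_eq ?_
  have hmv : ∀ v, Measurable fun x => fderiv ℝ f (L x) v := fun v =>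
    (measurable_fderiv_apply_const ℝ f v).comp L.continuous.measurable
  rw [← integral_finsetSum]
  · refine integral_congr_ae (Eventually.of_forall fun x => ?_)
    simp only
    rw [← EuclideanSpace.sum_fderiv_single_sq]
    refine Finset.sum_congr rfl fun i _ => ?_
    rw [(hd x).fderiv]
    rfl
  · intro i _
    have : ∀ x, fderiv ℝ (fun y => f (L y)) x (Pi.single i 1) =
        fderiv ℝ f (L x) (L (Pi.single i 1)) := fun x => by rw [(hd x).fderiv]; rfl
    simp_rw [this]
    refine Integrable.of_bound ((hmv _).pow_const 2).aestronglyMeasurable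
      ((C * ‖L (Pi.single i 1)‖) ^ 2) (Eventually.of_forall fun x => ?_)
    rw [norm_pow]
    gcongr
    exact ((fderiv ℝ f (L x)).le_opNorm _).trans
      (mul_le_mul_of_nonneg_right (hC _) (norm_nonneg _))

theorem memLp_id_stdGaussian (n : ℕ) :
    MemLp (fun x => x) 2 (stdGaussian (EuclideanSpace ℝ (Fin n))) := by
  rw [← map_pi_eq_stdGaussian, memLp_map_measure_iff (by fun_prop) (by fun_prop)]
  have h := (memLp_pi_gaussian n).continuousLinearMap_comp
    (PiLp.continuousLinearEquiv 2 ℝ fun _ : Fin n => ℝ).symm.toContinuousLinearMap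
  exact h

theorem integral_norm_sq_stdGaussian (n : ℕ) :
    ∫ x, ‖x‖ ^ 2 ∂(stdGaussian (EuclideanSpace ℝ (Fin n))) = n := by
  have h1 : MemLp (fun x : ℝ => x) 2 (gaussianReal 0 1) :=
    memLp_id_gaussianReal (μ := 0) (v := 1) 2
  have h2 : ∫ x : ℝ, x ^ 2 ∂(gaussianReal 0 1) = 1 := by
    have := variance_id_gaussianReal (μ := 0) (v := 1)
    rw [variance_of_integral_eq_zero (X := id) h1.1.aemeasurable integral_id_gaussianReal] at this
    simpa using this
  have hmp := fun i => measurePreserving_eval (fun _ : Fin n => gaussianReal 0 1) i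
  rw [← map_pi_eq_stdGaussian, integral_map (by fun_prop) (by fun_prop)]
  simp_rw [EuclideanSpace.real_norm_sq_eq]
  rw [integral_finsetSum]
  · have : ∀ i : Fin n, ∫ x : Fin n → ℝ, x i ^ 2 ∂(Measure.pi fun _ : Fin n => gaussianReal 0 1)
        = 1 := by
      intro i
      have := integral_map (μ := Measure.pi fun _ : Fin n => gaussianReal 0 1)
        (hmp i).measurable.aemeasurable (f := fun x : ℝ => x ^ 2) (by fun_prop)
      rw [(hmp i).map_eq, h2] at this
      exact this.symm
    simp [this]
  · exact fun i _ => (h1.comp_measurePreserving (hmp i)).integrable_sq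

section Homogeneous

variable {E : Type*} [NormedAddCommGroup E] [InnerProductSpace ℝ E] [CompleteSpace E]

/-- Euler's identity in degree zero: differentiate the constant function `r ↦ F (r x)` at `r = 1`.
-/
theorem inner_gradient_self_of_homogeneous {F : E → ℝ}
    (hF : ∀ r : ℝ, 0 < r → ∀ x, F (r • x) = F x) {x : E} (hd : DifferentiableAt ℝ F x) :
    ⟪∇ F x, x⟫_ℝ = 0 := by
  rw [inner_gradient_left]
  have h1 : HasDerivAt (fun r : ℝ => F (r • x)) (fderiv ℝ F x x) 1 := by
    have h2 : HasDerivAt (fun r : ℝ => r • x) x 1 := by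
      simpa using (hasDerivAt_id (1 : ℝ)).smul_const x
    have h3 : HasFDerivAt F (fderiv ℝ F x) ((1 : ℝ) • x) := by
      rw [one_smul]; exact hd.hasFDerivAt
    exact h3.comp_hasDerivAt (1 : ℝ) h2
  have h4 : HasDerivAt (fun r : ℝ => F (r • x)) 0 1 := by
    refine (hasDerivAt_const (1 : ℝ) (F x)).congr_of_eventuallyEq ?_
    filter_upwards [Ioi_mem_nhds (zero_lt_one (α := ℝ))] with r hr
    exact hF r hr x
  exact h1.unique h4

theorem gradient_smul_of_homogeneous {F : E → ℝ}
    (hF : ∀ r : ℝ, 0 < r → ∀ x, F (r • x) = F x) {r : ℝ} (hr : 0 < r) (x : E) :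
    ∇ F (r • x) = r⁻¹ • ∇ F x := by
  have h1 : fderiv ℝ (fun y => F (r • y)) x = r • fderiv ℝ F (r • x) := fderiv_comp_smul r
  have h2 : (fun y => F (r • y)) = F := funext fun y => hF r hr y
  rw [h2] at h1
  refine ext_inner_right ℝ fun v => ?_
  rw [real_inner_smul_left, inner_gradient_left, inner_gradient_left, h1]
  simp only [smul_apply, smul_eq_mul]
  field_simp

omit [CompleteSpace E] in
theorem hasFDerivAt_radial {a : ℝ → ℝ} {a' : ℝ} {x : E} (hx : x ≠ 0)
    (ha : HasDerivAt a a' ‖x‖) :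
    HasFDerivAt (fun y => a ‖y‖) ((a' / ‖x‖) • innerSL ℝ x) x := by
  have hp : ‖x‖ ≠ 0 := norm_ne_zero_iff.2 hx
  have h5 : HasFDerivAt (fun y : E => ‖y‖) (fderiv ℝ (‖·‖) x) x :=
    (contDiffAt_norm (n := 1) ℝ hx).differentiableAt (by simp) |>.hasFDerivAt
  refine (ha.comp_hasFDerivAt x h5).congr_fderiv ?_
  have h8 : HasFDerivAt (fun y : E => ‖y‖ ^ 2) _ x := (hasStrictFDerivAt_norm_sq x).hasFDerivAt
  have h9 := h8.unique (h5.pow 2)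
  ext v
  have h10 := DFunLike.congr_fun h9 v
  simp at h10
  simp only [smul_apply, smul_eq_mul, innerSL_apply_apply]
  rw [div_mul_eq_mul_div, eq_div_iff hp]
  linear_combination (-a' / 2) * h10

theorem gradient_radial {a : ℝ → ℝ} {a' : ℝ} {x : E} (hx : x ≠ 0) (ha : HasDerivAt a a' ‖x‖) :
    ∇ (fun y => a ‖y‖) x = (a' / ‖x‖) • x := by
  refine ext_inner_right ℝ fun v => ?_
  rw [inner_gradient_left, (hasFDerivAt_radial hx ha).fderiv, real_inner_smul_left]
  rfl

/-- The radial factor contributes a gradient along `x` and the degree-zero factor one orthogonal to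
`x`, so no cross term survives. -/
theorem norm_gradient_radial_mul_sq {F : E → ℝ}
    (hF : ∀ r : ℝ, 0 < r → ∀ x, F (r • x) = F x) {a : ℝ → ℝ} {a' : ℝ} {x : E} (hx : x ≠ 0)
    (hd : DifferentiableAt ℝ F x) (ha : HasDerivAt a a' ‖x‖) :
    ‖∇ (fun y => a ‖y‖ * F y) x‖ ^ 2 = a' ^ 2 * F x ^ 2 + a ‖x‖ ^ 2 * ‖∇ F x‖ ^ 2 := by
  have h1 : ∇ (fun y => a ‖y‖ * F y) x = (F x * (a' / ‖x‖)) • x + a ‖x‖ • ∇ F x := by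
    refine ext_inner_right ℝ fun v => ?_
    have h2 := ((hasFDerivAt_radial hx ha).mul hd.hasFDerivAt).fderiv
    have h3 : fderiv ℝ (fun y => a ‖y‖ * F y) x = _ := h2
    rw [inner_gradient_left, h3, inner_add_left, real_inner_smul_left, real_inner_smul_left,
      inner_gradient_left]
    simp
    ring
  have h0 := inner_gradient_self_of_homogeneous hF hd
  have hp : ‖x‖ ≠ 0 := norm_ne_zero_iff.2 hx
  rw [h1, norm_add_sq_real, real_inner_smul_left, real_inner_smul_right, real_inner_comm, h0,
    norm_smul, norm_smul, mul_pow, mul_pow, Real.norm_eq_abs, Real.norm_eq_abs, sq_abs, sq_abs]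
  field_simp
  ring

end Homogeneous

theorem hasDerivAt_sq_div_add {ε r : ℝ} (hε : 0 < ε) (hr : 0 < r) :
    HasDerivAt (fun r => r ^ 2 / (r + ε)) ((r ^ 2 + 2 * r * ε) / (r + ε) ^ 2) r := by
  have h1 := ((hasDerivAt_id r).pow 2).div ((hasDerivAt_id r).add_const ε) (by simp; positivity)
  refine HasDerivAt.congr_deriv (f := fun r => r ^ 2 / (r + ε)) h1 ?_
  simp
  ring

/-- The spherical Poincaré inequality, for centred homogeneous functions of degree zero. -/
theorem integral_sq_le_integral_gradient_sq_sphereLaw {n : ℕ} [NeZero n]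
    {F : EuclideanSpace ℝ (Fin n) → ℝ} (hF : ∀ r : ℝ, 0 < r → ∀ x, F (r • x) = F x)
    (hd : ∀ x, x ≠ 0 → DifferentiableAt ℝ F x) {B : ℝ} (hB : ∀ x, |F x| ≤ B)
    (hG : ∀ θ : Metric.sphere (0 : EuclideanSpace ℝ (Fin n)) 1, ‖∇ F θ‖ ≤ B)
    (h0 : ∫ θ, F θ ∂(sphereLaw (EuclideanSpace ℝ (Fin n))) = 0) :
    ((n : ℝ) - 1) * ∫ θ, F θ ^ 2 ∂(sphereLaw (EuclideanSpace ℝ (Fin n))) ≤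
      ∫ θ, ‖∇ F θ‖ ^ 2 ∂(sphereLaw (EuclideanSpace ℝ (Fin n))) := by
  have hB0 : 0 ≤ B := (abs_nonneg _).trans (hB 0)
  have hFm : Measurable F := measurable_of_continuousOn_compl_singleton 0
    fun x hx => (hd x hx).continuousAt.continuousWithinAt
  have hGm : Measurable (∇ F) := measurable_gradient F
  have hFms : Measurable fun θ : Metric.sphere (0 : EuclideanSpace ℝ (Fin n)) 1 => F θ :=
    hFm.comp measurable_subtype_coe
  have hGms : Measurable fun θ : Metric.sphere (0 : EuclideanSpace ℝ (Fin n)) 1 => ∇ F θ :=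
    hGm.comp measurable_subtype_coe
  set γ := stdGaussian (EuclideanSpace ℝ (Fin n)) with hγ
  set κ := sphereLaw (EuclideanSpace ℝ (Fin n)) with hκ
  set w : ℝ → ℝ≥0∞ := fun r => ENNReal.ofReal ((√(2 * Real.pi))⁻¹ ^ n * Real.exp (-r ^ 2 / 2))
    with hw
  have hwm : Measurable w := by fun_prop
  have hγw : γ = volume.withDensity fun x : EuclideanSpace ℝ (Fin n) => w ‖x‖ :=
    stdGaussian_eq_withDensity n
  have : IsProbabilityMeasure (volume.withDensity fun x : EuclideanSpace ℝ (Fin n) => w ‖x‖) :=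
    hγw ▸ inferInstance
  have := isProbabilityMeasure_radialLaw (E := EuclideanSpace ℝ (Fin n)) hwm
  set ρ := radialLaw (EuclideanSpace ℝ (Fin n)) w with hρ
  have hmp : MeasurePreserving (polarMap (E := EuclideanSpace ℝ (Fin n))) (κ.prod ρ) γ := by
    rw [hγw]; exact measurePreserving_polarMap hwm
  have hρpos : ∀ᵐ r ∂ρ, 0 < r := ae_radialLaw_pos w
  have hpol := ae_norm_polarMap (E := EuclideanSpace ℝ (Fin n)) hρpos
  have hnorm : MeasurePreserving (fun x : EuclideanSpace ℝ (Fin n) => ‖x‖) γ ρ :=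
    measurePreserving_norm hρpos hmp
  have hr2 : MemLp (fun r : ℝ => r) 2 ρ := by
    have := (memLp_id_stdGaussian n).norm
    rwa [← hnorm.map_eq, memLp_map_measure_iff (by fun_prop) (by fun_prop)]
  have hn2 : ∫ r, r ^ 2 ∂ρ = n := by
    rw [← integral_norm_sq_stdGaussian n]
    exact hnorm.integral_map_eq (by fun_prop)
  set A := ∫ θ : Metric.sphere (0 : EuclideanSpace ℝ (Fin n)) 1, F θ ^ 2 ∂κ with hA
  set D := ∫ θ : Metric.sphere (0 : EuclideanSpace ℝ (Fin n)) 1, ‖∇ F θ‖ ^ 2 ∂κ with hD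
  have hA0 : 0 ≤ A := integral_nonneg fun _ => sq_nonneg _
  have hFp : ∀ (θ : Metric.sphere (0 : EuclideanSpace ℝ (Fin n)) 1) {r : ℝ}, 0 < r →
      F (polarMap (θ, r)) = F θ :=
    fun θ r hr => hF r hr θ
  have hGp : ∀ (θ : Metric.sphere (0 : EuclideanSpace ℝ (Fin n)) 1) {r : ℝ}, 0 < r →
      ‖∇ F (polarMap (θ, r))‖ = r⁻¹ * ‖∇ F θ‖ := by
    intro θ r hr
    simp only [polarMap]
    rw [gradient_smul_of_homogeneous hF hr, norm_smul, Real.norm_of_nonneg (inv_pos.2 hr).le]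
  have hFi : Integrable (fun θ : Metric.sphere (0 : EuclideanSpace ℝ (Fin n)) 1 => F θ ^ 2) κ := by
    refine Integrable.of_bound (hFms.pow_const 2).aestronglyMeasurable (B ^ 2)
      (Eventually.of_forall fun θ => ?_)
    rw [norm_pow]; gcongr; exact hB _
  have hGi : Integrable (fun θ : Metric.sphere (0 : EuclideanSpace ℝ (Fin n)) 1 =>
      ‖∇ F θ‖ ^ 2) κ := by
    refine Integrable.of_bound (hGms.norm.pow_const 2).aestronglyMeasurable (B ^ 2)
      (Eventually.of_forall fun θ => ?_)
    rw [norm_pow, norm_norm]; gcongr; exact hG _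
  -- the test functions `a (‖x‖) F x`
  have key : ∀ ε : ℝ, 0 < ε → (∫ r, (r ^ 2 / (r + ε)) ^ 2 ∂ρ) * A ≤ A + D := by
    intro ε hε
    -- The desired profile `a(r) = r` need not give a differentiable function at the origin. This
    -- regularisation is quadratic near zero, keeps `a' ≤ 1` and `a / r ≤ 1`, and returns to `r` as
    -- `ε → 0`.
    set a : ℝ → ℝ := fun r => r ^ 2 / (r + ε) with ha
    set a' : ℝ → ℝ := fun r => (r ^ 2 + 2 * r * ε) / (r + ε) ^ 2 with ha'
    have ha1 : ∀ r, 0 < r → a' r ^ 2 ≤ 1 := by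
      intro r hr
      have h1 : 0 ≤ a' r := by positivity
      have h2 : a' r ≤ 1 := by
        rw [ha', div_le_one (by positivity)]; nlinarith
      nlinarith
    have ha2 : ∀ r, 0 < r → a r ^ 2 * (r⁻¹) ^ 2 ≤ 1 := by
      intro r hr
      rw [← mul_pow]
      have h1 : 0 ≤ a r * r⁻¹ := by positivity
      have h2 : a r * r⁻¹ ≤ 1 := by
        rw [← div_eq_mul_inv, div_le_one hr, ha, div_le_iff₀ (by positivity)]; nlinarith
      nlinarith
    set Φ : EuclideanSpace ℝ (Fin n) → ℝ := fun x => a ‖x‖ * F x with hΦ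
    -- Near the origin `|Φ x| ≤ (B / ε) ‖x‖²`, so the discontinuity of `F` there is harmless.
    have hΦd0 : HasFDerivAt Φ (0 : EuclideanSpace ℝ (Fin n) →L[ℝ] ℝ) 0 := by
      rw [hasFDerivAt_iff_isLittleO]
      have hb : Φ =O[𝓝 0] fun x : EuclideanSpace ℝ (Fin n) => ‖x‖ ^ 2 := by
        refine Asymptotics.IsBigO.of_bound (B / ε) (Eventually.of_forall fun x => ?_)
        have h1 : |a ‖x‖| ≤ ‖x‖ ^ 2 / ε := by
          rw [abs_of_nonneg (by positivity)]
          simp only [ha]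
          gcongr
          linarith [norm_nonneg x]
        rw [Real.norm_eq_abs, abs_mul, norm_pow, norm_norm]
        calc |a ‖x‖| * |F x| ≤ (‖x‖ ^ 2 / ε) * B := by gcongr; exact hB x
          _ = B / ε * ‖x‖ ^ 2 := by ring
      have hl : (fun x : EuclideanSpace ℝ (Fin n) => ‖x‖ ^ 2) =o[𝓝 0]
          fun x : EuclideanSpace ℝ (Fin n) => x := by
        simpa using (Asymptotics.isLittleO_norm_pow_id (E' := EuclideanSpace ℝ (Fin n)) one_lt_two)
      simpa [hΦ, ha] using hb.trans_isLittleO hl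
    have hΦdiff : ∀ x, x ≠ 0 → DifferentiableAt ℝ Φ x := fun x hx =>
      ((hasFDerivAt_radial hx (hasDerivAt_sq_div_add hε (norm_pos_iff.2 hx))).differentiableAt).mul
        (hd x hx)
    have hΦD : Differentiable ℝ Φ := by
      intro x
      rcases eq_or_ne x 0 with rfl | hx
      · exact hΦd0.differentiableAt
      · exact hΦdiff x hx
    have hΦg : ∀ (θ : Metric.sphere (0 : EuclideanSpace ℝ (Fin n)) 1) {r : ℝ}, 0 < r →
        ‖∇ Φ (polarMap (θ, r))‖ ^ 2 ≤ F θ ^ 2 + ‖∇ F θ‖ ^ 2 := by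
      intro θ r hr
      have hn := norm_polarMap θ hr
      have hx : polarMap (θ, r) ≠ 0 := norm_pos_iff.1 (by rw [hn]; exact hr)
      rw [hΦ, norm_gradient_radial_mul_sq hF hx (hd _ hx) (a' := a' r)
        (by rw [hn]; exact hasDerivAt_sq_div_add hε hr), hn, hFp θ hr, hGp θ hr, mul_pow]
      have h1 := mul_le_mul_of_nonneg_right (ha1 r hr) (sq_nonneg (F θ))
      have h2 := mul_le_mul_of_nonneg_right (ha2 r hr) (sq_nonneg ‖∇ F θ‖)
      linarith
    have hΦC : ∀ x, ‖fderiv ℝ Φ x‖ ≤ 2 * B := by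
      intro x
      rcases eq_or_ne x 0 with rfl | hx
      · rw [hΦd0.fderiv, norm_zero]; positivity
      · have hxp : 0 < ‖x‖ := norm_pos_iff.2 hx
        have hθ : ‖x‖⁻¹ • x ∈ Metric.sphere (0 : EuclideanSpace ℝ (Fin n)) 1 := by
          simp [norm_smul, hxp.ne']
        have h1 := hΦg ⟨_, hθ⟩ hxp
        have h2 : polarMap (E := EuclideanSpace ℝ (Fin n)) (⟨_, hθ⟩, ‖x‖) = x := by
          simp [polarMap, smul_smul, hxp.ne']
        rw [h2] at h1
        rw [← norm_gradient]
        have h3 := hG ⟨_, hθ⟩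
        have h4 := abs_le.1 (hB (‖x‖⁻¹ • x))
        refine le_of_sq_le_sq ?_ (by positivity)
        nlinarith [norm_nonneg (∇ F (‖x‖⁻¹ • x))]
    have hgp := variance_le_integral_gradient_sq_stdGaussian hΦD hΦC
    have hΦm : Measurable Φ := hΦD.continuous.measurable
    have e1 : ∫ x, Φ x ^ 2 ∂γ = A * ∫ r, a r ^ 2 ∂ρ := by
      rw [hmp.integral_map_eq (hΦm.pow_const 2).aestronglyMeasurable, hA,
        ← integral_prod_mul (f := fun θ : Metric.sphere (0 : EuclideanSpace ℝ (Fin n)) 1 => F θ ^ 2)]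
      refine integral_congr_ae ?_
      filter_upwards [hpol] with z hz
      simp only [hΦ]
      rw [hz.2, hFp z.1 hz.1]
      ring
    have e2 : ∫ x, Φ x ∂γ = 0 := by
      rw [hmp.integral_map_eq hΦm.aestronglyMeasurable,
        ← zero_mul (∫ r, a r ∂ρ), ← h0,
        ← integral_prod_mul (f := fun θ : Metric.sphere (0 : EuclideanSpace ℝ (Fin n)) 1 => F θ)]
      refine integral_congr_ae ?_
      filter_upwards [hpol] with z hz
      simp only [hΦ]
      rw [hz.2, hFp z.1 hz.1]
      ring
    have e3 : ∫ x, ‖∇ Φ x‖ ^ 2 ∂γ ≤ A + D := by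
      rw [hmp.integral_map_eq ((measurable_gradient Φ).norm.pow_const 2).aestronglyMeasurable,
        hA, hD, ← integral_add hFi hGi]
      have e4 : ∫ θ : Metric.sphere (0 : EuclideanSpace ℝ (Fin n)) 1, F θ ^ 2 + ‖∇ F θ‖ ^ 2 ∂κ =
          ∫ z, F z.1 ^ 2 + ‖∇ F z.1‖ ^ 2 ∂(κ.prod ρ) :=
        (measurePreserving_fst (μ := κ) (ν := ρ)).integral_map_eq (hFi.add hGi).1
      rw [e4]
      refine integral_mono_of_nonneg (Eventually.of_forall fun z => by positivity)
        ((hFi.add hGi).comp_fst ρ) ?_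
      filter_upwards [hpol] with z hz
      exact hΦg z.1 hz.1
    rw [e1, e2] at hgp
    nlinarith
  -- As `ε → 0` the left side tends to `n`, the second moment of the Gaussian radius; `key` then
  -- becomes `n A ≤ A + D`.
  have hlow : ∀ ε : ℝ, 0 < ε → n - 2 * ε * (1 + n) ≤ ∫ r, (r ^ 2 / (r + ε)) ^ 2 ∂ρ := by
    intro ε hε
    have hi1 : Integrable (fun r : ℝ => r ^ 2) ρ := hr2.integrable_sq
    have hi2 : Integrable (fun r : ℝ => 2 * ε * (1 + r ^ 2)) ρ :=
      ((integrable_const _).add hi1).const_mul _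
    have e : ∫ r, (r ^ 2 - 2 * ε * (1 + r ^ 2)) ∂ρ = n - 2 * ε * (1 + n) := by
      rw [integral_sub hi1 hi2, integral_const_mul, integral_add (integrable_const _) hi1, hn2]
      simp
    rw [← e]
    refine integral_mono_ae (hi1.sub hi2) ?_ ?_
    · refine hi1.mono' (Measurable.aestronglyMeasurable (by fun_prop)) ?_
      filter_upwards [hρpos] with r hr
      rw [Real.norm_of_nonneg (sq_nonneg _)]
      gcongr
      rw [div_le_iff₀ (by positivity)]
      nlinarith
    · filter_upwards [hρpos] with r hr
      have h1 : r - ε ≤ r ^ 2 / (r + ε) := by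
        rw [le_div_iff₀ (by positivity)]; nlinarith
      have h2 : r ^ 2 - 2 * ε * r ≤ (r ^ 2 / (r + ε)) ^ 2 := by
        rw [div_pow, le_div_iff₀ (by positivity)]
        have : 0 ≤ r * ε ^ 2 * (3 * r + 2 * ε) := by positivity
        nlinarith
      nlinarith [sq_nonneg (r - 1)]
  have hfin : ∀ ε : ℝ, 0 < ε → ((n : ℝ) - 1) * A - D ≤ ε := by
    intro ε hε
    set C := 2 * (1 + (n : ℝ)) * A with hC
    have hC0 : 0 ≤ C := by positivity
    have h1 := mul_le_mul_of_nonneg_right (hlow (ε / (C + 1)) (by positivity)) hA0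
    have h2 := key (ε / (C + 1)) (by positivity)
    have h3 : ε / (C + 1) * C ≤ ε := by
      rw [div_mul_eq_mul_div, div_le_iff₀ (by positivity)]; nlinarith
    have h4 : 2 * (ε / (C + 1)) * (1 + n) * A = ε / (C + 1) * C := by rw [hC]; ring
    linarith
  have := le_of_forall_pos_le_add (a := ((n : ℝ) - 1) * A - D) (b := 0)
    (fun ε hε => by simpa using hfin ε hε)
  linarith

/-- The spherical Poincaré inequality, for homogeneous functions of degree zero. -/
theorem variance_le_integral_gradient_sq_sphereLaw {n : ℕ} [NeZero n]
    {F : EuclideanSpace ℝ (Fin n) → ℝ} (hF : ∀ r : ℝ, 0 < r → ∀ x, F (r • x) = F x)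
    (hd : ∀ x, x ≠ 0 → DifferentiableAt ℝ F x) {B : ℝ} (hB : ∀ x, |F x| ≤ B)
    (hG : ∀ θ : Metric.sphere (0 : EuclideanSpace ℝ (Fin n)) 1, ‖∇ F θ‖ ≤ B) :
    ((n : ℝ) - 1) * (∫ θ, (F θ - ∫ η, F η ∂(sphereLaw (EuclideanSpace ℝ (Fin n)))) ^ 2
        ∂(sphereLaw (EuclideanSpace ℝ (Fin n)))) ≤
      ∫ θ, ‖∇ F θ‖ ^ 2 ∂(sphereLaw (EuclideanSpace ℝ (Fin n))) := by
  set c := ∫ η, F η ∂(sphereLaw (EuclideanSpace ℝ (Fin n))) with hc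
  have hg : ∀ x, ∇ (fun y => F y - c) x = ∇ F x := fun x => by
    simp [gradient, fderiv_sub_const]
  have hFm : Measurable F := measurable_of_continuousOn_compl_singleton 0
    fun x hx => (hd x hx).continuousAt.continuousWithinAt
  have hi : Integrable (fun θ : Metric.sphere (0 : EuclideanSpace ℝ (Fin n)) 1 => F θ)
      (sphereLaw (EuclideanSpace ℝ (Fin n))) :=
    Integrable.of_bound (hFm.comp measurable_subtype_coe).aestronglyMeasurable B
      (Eventually.of_forall fun θ => hB _)
  have := integral_sq_le_integral_gradient_sq_sphereLaw (F := fun y => F y - c)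
    (fun r hr x => by rw [hF r hr]) (fun x hx => (hd x hx).sub_const c) (B := B + |c|)
    (fun x => (abs_sub _ _).trans (add_le_add_left (hB x) _))
    (fun θ => by rw [hg]; linarith [hG θ, abs_nonneg c])
    (by rw [integral_sub hi (integrable_const _)]; simp [hc])
  simpa only [hg] using this

end SphericalPoincare

end


noncomputable section

/-! ### Polar factorization of the given measures and weight. -/

section Setting

/-- A measure `μ` on `E` that splits, in polar coordinates, as the product of the uniform law on the
sphere and of a law `ν` on `(0, ∞)`, together with a radial weight `σ` of profile `s`. -/
structure PolarFactorization {E : Type*} [NormedAddCommGroup E] [InnerProductSpace ℝ E]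
    [FiniteDimensional ℝ E] [MeasurableSpace E] [BorelSpace E] (μ : Measure E) (ν : Measure ℝ)
    (σ : E → ℝ) (s : ℝ → ℝ) : Prop where
  full : RegularWeight univ μ σ
  radial : RegularWeight (Ioi 0) ν s
  polar : MeasurePreserving (polarMap (E := E)) ((sphereLaw E).prod ν) μ
  weight : ∀ x, σ x = s ‖x‖

theorem pos_of_isProbabilityMeasure_withDensity {α : Type*} [MeasurableSpace α] {m m' : Measure α}
    [IsProbabilityMeasure m] {c : ℝ} {u : α → ℝ} (hu : ∀ᵐ x ∂m', 0 ≤ u x)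
    (hm : m = m'.withDensity fun x => ENNReal.ofReal (c * u x)) : 0 < c := by
  by_contra hc
  have h0 : m = 0 := by
    rw [hm, ← withDensity_zero]
    refine withDensity_congr_ae ?_
    filter_upwards [hu] with x hx
    simp only [Pi.zero_apply, ENNReal.ofReal_eq_zero]
    exact mul_nonpos_of_nonpos_of_nonneg (not_lt.1 hc) hx
  exact IsProbabilityMeasure.ne_zero m h0

/-- The radial law of `μ` and `ν` have proportional densities and both have mass one, hence
coincide. The value of the constants `c` and `c'` plays no role beyond their positivity. -/
theorem polarFactorization_of_density {n : ℕ} (hn : 2 ≤ n)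
    {V : ℝ → ℝ} (hV0 : ContinuousOn V (Ici 0))
    {μ : Measure (EuclideanSpace ℝ (Fin n))} [IsProbabilityMeasure μ] {c : ℝ}
    (hμ : μ = volume.withDensity (fun x => ENNReal.ofReal (c * Real.exp (-V ‖x‖))))
    {ν : Measure ℝ} [IsProbabilityMeasure ν] {c' : ℝ}
    (hν : ν = (volume.restrict (Ioi 0)).withDensity
      (fun r => ENNReal.ofReal (c' * (r ^ (n - 1) * Real.exp (-V r)))))
    {σ : EuclideanSpace ℝ (Fin n) → ℝ} (hσ : Continuous σ) (hσ0 : ∀ x, 0 < σ x)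
    {s : ℝ → ℝ} (hs : ∀ x, σ x = s ‖x‖) : PolarFactorization μ ν σ s := by
  have : NeZero n := ⟨by omega⟩
  obtain ⟨e, he⟩ := exists_norm_eq (EuclideanSpace ℝ (Fin n)) zero_le_one
  have hc : 0 < c := pos_of_isProbabilityMeasure_withDensity
    (Eventually.of_forall fun x => (Real.exp_pos _).le) hμ
  have hc' : 0 < c' := by
    refine pos_of_isProbabilityMeasure_withDensity ?_ hν
    filter_upwards [ae_restrict_mem measurableSet_Ioi] with r hr
    have hr : 0 < r := hr
    positivity
  have hVm : Continuous fun r => V (max r 0) :=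
    hV0.comp_continuous (by fun_prop) fun r => le_max_right r 0
  -- `V` is controlled only on the half-line, so `max r 0` provides a globally measurable density
  -- without changing it at norms.
  set w : ℝ → ℝ≥0∞ := fun r => ENNReal.ofReal (c * Real.exp (-V (max r 0))) with hw
  have hwm : Measurable w := by
    refine Measurable.ennreal_ofReal ?_
    exact (continuous_const.mul (Real.continuous_exp.comp hVm.neg)).measurable
  have hμw : μ = volume.withDensity fun x : EuclideanSpace ℝ (Fin n) => w ‖x‖ := by
    rw [hμ]; simp [hw]
  have : IsProbabilityMeasure (volume.withDensity fun x : EuclideanSpace ℝ (Fin n) => w ‖x‖) :=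
    hμw ▸ inferInstance
  have hp := isProbabilityMeasure_radialLaw (E := EuclideanSpace ℝ (Fin n)) hwm
  have hνw : radialLaw (EuclideanSpace ℝ (Fin n)) w = ν := by
    obtain ⟨k, hk⟩ : ∃ k : ℝ≥0∞, radialLaw (EuclideanSpace ℝ (Fin n)) w = k • ν := by
      refine ⟨(volume : Measure (EuclideanSpace ℝ (Fin n))).toSphere univ *
        ENNReal.ofReal (c / c'), ?_⟩
      rw [hν, mul_smul, ← withDensity_smul' _ _ ENNReal.ofReal_ne_top, radialLaw]
      congr 1
      refine withDensity_congr_ae ?_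
      filter_upwards [ae_restrict_mem measurableSet_Ioi] with r hr
      have hr : 0 < r := hr
      simp only [hw, Pi.smul_apply, smul_eq_mul, finrank_euclideanSpace, Fintype.card_fin,
        max_eq_left hr.le]
      rw [← ENNReal.ofReal_mul (by positivity), ← ENNReal.ofReal_mul (by positivity)]
      congr 1
      field_simp
    have h1 : k = 1 := by
      have := congrArg (fun m => m univ) hk
      simpa using this.symm
    rw [hk, h1, one_smul]
  refine ⟨⟨isOpen_univ, ⟨fun x => c * Real.exp (-V ‖x‖), ?_, fun x _ => by positivity, ?_⟩,
    hσ.continuousOn, fun x _ => hσ0 x, ⟨fun k => Metric.closedBall 0 (k + 1), ?_, ?_, ?_, ?_⟩⟩,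
    ⟨isOpen_Ioi, ⟨fun r => c' * (r ^ (n - 1) * Real.exp (-V r)), ?_, ?_, hν⟩, ?_, ?_,
      -- The shift by `2` gives the first interval `[1/2, 2]` a nonempty interior.
      ⟨fun k => Icc (1 / ((k : ℝ) + 2)) (k + 2), ?_, ?_, ?_, ?_⟩⟩, ?_, hs⟩
  · have : ContinuousOn (fun x : EuclideanSpace ℝ (Fin n) => V ‖x‖) univ :=
      hV0.comp continuous_norm.continuousOn fun x _ => norm_nonneg x
    exact continuousOn_const.mul (Real.continuous_exp.comp_continuousOn this.neg)
  · rw [Measure.restrict_univ]; exact hμ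
  · intro i j hij
    exact Metric.closedBall_subset_closedBall (by have : (i : ℝ) ≤ j := by exact_mod_cast hij
                                                  linarith)
  · exact fun k => ⟨isCompact_closedBall _ _, convex_closedBall _ _, subset_univ _⟩
  · intro x _
    obtain ⟨k, hk⟩ := exists_nat_ge ‖x‖
    exact mem_iUnion.2 ⟨k, by simp; linarith⟩
  · exact ⟨0, mem_interior.2 ⟨Metric.ball 0 1, by
      simpa using Metric.ball_subset_closedBall, Metric.isOpen_ball, by simp⟩⟩
  · have : ContinuousOn V (Ioi 0) := hV0.mono Ioi_subset_Ici_self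
    fun_prop
  · intro r hr
    have hr : 0 < r := hr
    positivity
  · have h1 : ContinuousOn (fun r : ℝ => σ (r • e)) (Ioi 0) :=
      (hσ.comp (by fun_prop)).continuousOn
    refine h1.congr fun r hr => ?_
    have hr : 0 < r := hr
    simp only [hs, norm_smul, he, Real.norm_of_nonneg hr.le, mul_one]
  · intro r hr
    have hr : 0 < r := hr
    have := hσ0 (r • e)
    rwa [hs, norm_smul, he, Real.norm_of_nonneg hr.le, mul_one] at this
  · intro i j hij
    have : (i : ℝ) ≤ j := by exact_mod_cast hij
    exact Icc_subset_Icc (by gcongr) (by linarith)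
  · intro k
    refine ⟨isCompact_Icc, convex_Icc _ _, fun r hr => ?_⟩
    exact lt_of_lt_of_le (by positivity) hr.1
  · intro r hr
    have hr : 0 < r := hr
    obtain ⟨k, hk⟩ := exists_nat_ge (max r (1 / r))
    have h1 := (le_max_left _ _).trans hk
    have h2 := (le_max_right _ _).trans hk
    refine mem_iUnion.2 ⟨k, ?_, by linarith⟩
    rw [one_div_le (by positivity) hr]
    linarith
  · simp only [CharP.cast_eq_zero, zero_add, interior_Icc]
    exact ⟨1, by norm_num, by norm_num⟩
  · rw [hμw, ← hνw]
    exact measurePreserving_polarMap hwm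

end Setting

/-! ### Integration by parts and removability of the origin. -/

section IntegrationByParts

variable {E : Type*} [NormedAddCommGroup E] [InnerProductSpace ℝ E] [FiniteDimensional ℝ E]
  [MeasurableSpace E] [BorelSpace E]

omit [MeasurableSpace E] [BorelSpace E] in
theorem gradient_mul {f g : E → ℝ} {x : E} (hf : DifferentiableAt ℝ f x)
    (hg : DifferentiableAt ℝ g x) :
    ∇ (fun y => f y * g y) x = f x • ∇ g x + g x • ∇ f x := by
  simp [gradient, fderiv_fun_mul hf hg]

theorem integral_gradient_eq_zero {φ : E → ℝ} (h1 : ContDiff ℝ ∞ φ) (h2 : HasCompactSupport φ) :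
    ∫ x, ∇ φ x = 0 := by
  have := (hasWeakGradient_const (U := (univ : Set E)) 1).2.2 φ h1 h2 (subset_univ _)
  simpa using this

/-- Integration by parts against a function that is smooth near the support of the test
function. -/
theorem integral_smul_gradient_eq_neg {h φ : E → ℝ} (h1 : ContDiff ℝ ∞ φ)
    (h2 : HasCompactSupport φ) (hh : ∀ x ∈ tsupport φ, ContDiffAt ℝ ∞ h x) :
    ∫ x, h x • ∇ φ x = - ∫ x, φ x • ∇ h x := by
  have z : ∀ x, x ∉ tsupport φ → φ x = 0 := fun x hx => image_eq_zero_of_notMem_tsupport hx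
  have z' : ∀ x, x ∉ tsupport φ → ∇ φ x = 0 := fun x hx => gradient_eq_zero_of_notMem_tsupport hx
  have hgr : ContDiff ℝ ∞ (∇ φ) :=
    (InnerProductSpace.toDual ℝ E).symm.toContinuousLinearEquiv.contDiff.comp
      (h1.fderiv_right (m := ∞) (by simp))
  have c0 : ContDiff ℝ ∞ fun x => h x * φ x := contDiff_of_forall_tsupport
    (fun x hx => (hh x hx).mul h1.contDiffAt) fun x hx => by simp [z x hx]
  have c1 : ContDiff ℝ ∞ fun x => h x • ∇ φ x := contDiff_of_forall_tsupport
    (fun x hx => (hh x hx).smul hgr.contDiffAt) fun x hx => by simp [z' x hx]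
  have c2 : ContDiff ℝ ∞ fun x => φ x • ∇ h x := contDiff_of_forall_tsupport
    (fun x hx => h1.contDiffAt.smul
      ((InnerProductSpace.toDual ℝ E).symm.toContinuousLinearEquiv.contDiff.contDiffAt.comp x
        ((hh x hx).fderiv_right (m := ∞) (by simp)))) fun x hx => by simp [z x hx]
  have i1 : Integrable fun x => h x • ∇ φ x := c1.continuous.integrable_of_hasCompactSupport
    (HasCompactSupport.intro h2 fun x hx => by simp [z' x hx])
  have i2 : Integrable fun x => φ x • ∇ h x := c2.continuous.integrable_of_hasCompactSupport
    (HasCompactSupport.intro h2 fun x hx => by simp [z x hx])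
  have h0 := integral_gradient_eq_zero c0 (HasCompactSupport.intro h2 fun x hx => by simp [z x hx])
  rw [eq_neg_iff_add_eq_zero, ← integral_add i1 i2, ← h0]
  refine integral_congr_ae (Eventually.of_forall fun x => ?_)
  by_cases hx : x ∈ tsupport φ
  · simp only
    rw [gradient_mul ((hh x hx).differentiableAt (by simp)) (h1.differentiable (by simp) x)]
  · have : tsupport (fun x => h x * φ x) ⊆ tsupport φ := closure_mono fun y hy => by
      intro h3; exact hy (by simp [h3])
    simp [z x hx, z' x hx, gradient_eq_zero_of_notMem_tsupport fun h3 => hx (this h3)]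

theorem lintegral_sq_le_measure_mul {α : Type*} [MeasurableSpace α] {m : Measure α}
    {f : α → ℝ≥0∞} (hf : AEMeasurable f m) :
    (∫⁻ x, f x ∂m) ^ 2 ≤ m univ * ∫⁻ x, f x ^ 2 ∂m := by
  have := ENNReal.lintegral_mul_le_Lp_mul_Lq m Real.HolderConjugate.two_two hf
    (aemeasurable_const (b := (1 : ℝ≥0∞)))
  simp only [Pi.mul_apply, mul_one, ENNReal.one_rpow, lintegral_const, one_mul] at this
  calc (∫⁻ x, f x ∂m) ^ 2 ≤ ((∫⁻ x, f x ^ (2 : ℝ) ∂m) ^ (1 / 2 : ℝ) * m univ ^ (1 / 2 : ℝ)) ^ 2 := by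
        gcongr
    _ = m univ * ∫⁻ x, f x ^ 2 ∂m := by
        rw [mul_pow, ← ENNReal.rpow_natCast, ← ENNReal.rpow_mul, ← ENNReal.rpow_natCast,
          ← ENNReal.rpow_mul]
        norm_num
        rw [mul_comm]

theorem tendsto_zero_of_enorm_sq_le {F : Type*} [NormedAddCommGroup F] {u : ℕ → F} {e : ℕ → ℝ≥0∞}
    (hu : ∀ k, ‖u k‖ₑ ^ 2 ≤ e k) (he : Tendsto e atTop (𝓝 0)) : Tendsto u atTop (𝓝 0) := by
  rw [tendsto_zero_iff_enorm_tendsto_zero]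
  have h1 : Tendsto (fun k => ‖u k‖ₑ ^ 2) atTop (𝓝 0) :=
    tendsto_of_tendsto_of_tendsto_of_le_of_le tendsto_const_nhds he (fun _ => zero_le) hu
  have h2 := h1.ennrpow_const (1 / 2 : ℝ)
  rw [ENNReal.zero_rpow_of_pos (by norm_num)] at h2
  refine h2.congr fun k => ?_
  rw [← ENNReal.rpow_natCast, ← ENNReal.rpow_mul]
  norm_num

/-- In dimension at least two, points are removable for the weak gradient of locally square
integrable functions. -/
theorem HasWeakGradient.of_compl_singleton (hdim : 2 ≤ Module.finrank ℝ E) {f : E → ℝ} {G : E → E}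
    (hf : LocallyIntegrable (fun x => f x ^ 2)) (hfl : LocallyIntegrable f)
    (hG : LocallyIntegrable G) (h : HasWeakGradient {0}ᶜ f G) : HasWeakGradient univ f G := by
  refine ⟨hfl.locallyIntegrableOn _, hG.locallyIntegrableOn _, fun φ h1 h2 _ => ?_⟩
  have : Nontrivial E := Module.nontrivial_of_finrank_pos (R := ℝ) (by omega)
  set b : ContDiffBump (0 : E) := ⟨1, 2, one_pos, one_lt_two⟩ with hb
  set Θ : E → ℝ := fun x => 1 - b x with hΘ
  have hΘc : ContDiff ℝ ∞ Θ := contDiff_const.sub b.contDiff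
  have hΘg : ∀ x, ∇ Θ x = - ∇ b x := fun x => by simp [hΘ, gradient, fderiv_const_sub]
  have hΘ1 : ∀ x, |Θ x| ≤ 1 := fun x => by
    rw [abs_le]; constructor <;> simp only [hΘ] <;> linarith [b.nonneg (x := x), b.le_one (x := x)]
  have hΘin : ∀ x, ‖x‖ ≤ 1 → Θ x = 0 := fun x hx => by
    simp only [hΘ, b.one_of_mem_closedBall (x := x) (by simpa [hb] using hx), sub_self]
  have hΘout : ∀ x, 2 ≤ ‖x‖ → Θ x = 1 := fun x hx => by
    simp only [hΘ, b.zero_of_le_dist (x := x) (by simpa [hb] using hx), sub_zero]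
  have hΘg0 : ∀ x, 2 < ‖x‖ → ∇ Θ x = 0 := fun x hx => by
    rw [hΘg, gradient_eq_zero_of_notMem_tsupport, neg_zero]
    rw [b.tsupport_eq]
    simpa [hb] using hx
  obtain ⟨C, hC⟩ : ∃ C, ∀ x, ‖∇ Θ x‖ ≤ C := by
    refine HasCompactSupport.exists_bound_of_continuous ?_ (continuous_gradient hΘc)
    exact HasCompactSupport.intro (isCompact_closedBall (0 : E) 2) fun x hx =>
      hΘg0 x (by simpa using hx)
  obtain ⟨Cφ, hCφ⟩ := h2.exists_bound_of_continuous h1.continuous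
  -- Cut-offs that vanish near the origin and tend to one elsewhere; their gradients have size of
  -- order `k + 1` on a ball of radius `2 / (k + 1)`.
  set χ : ℕ → E → ℝ := fun k x => Θ (((k : ℝ) + 1) • x) with hχ
  have hN : ∀ k : ℕ, 0 < (k : ℝ) + 1 := fun k => by positivity
  have hχc : ∀ k, ContDiff ℝ ∞ (χ k) := fun k => hΘc.comp (contDiff_const_smul _)
  have hχg : ∀ k x, ∇ (χ k) x = ((k : ℝ) + 1) • ∇ Θ (((k : ℝ) + 1) • x) := by
    intro k x
    have h1 : fderiv ℝ (χ k) x = ((k : ℝ) + 1) • fderiv ℝ Θ (((k : ℝ) + 1) • x) :=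
      fderiv_comp_smul _
    simp [gradient, h1]
  have hχlim : ∀ x : E, x ≠ 0 → ∀ᶠ k in atTop, χ k x = 1 := by
    intro x hx
    have hx : 0 < ‖x‖ := norm_pos_iff.2 hx
    obtain ⟨n, hn⟩ := exists_nat_ge (2 / ‖x‖)
    filter_upwards [eventually_ge_atTop n] with k hk
    refine hΘout _ ?_
    rw [norm_smul, Real.norm_of_nonneg (hN k).le, ← div_le_iff₀ hx]
    have : (n : ℝ) ≤ k := by exact_mod_cast hk
    linarith
  have hne : ∀ᵐ x : E, x ≠ 0 := by simp [ae_iff]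
  -- the two main terms
  have hlim : ∀ u : E → E, Integrable u →
      Tendsto (fun k => ∫ x, χ k x • u x) atTop (𝓝 (∫ x, u x)) := by
    intro u hu
    refine tendsto_integral_of_dominated_convergence (fun x => ‖u x‖)
      (fun k => (hχc k).continuous.aestronglyMeasurable.smul hu.1) hu.norm
      (fun k => Eventually.of_forall fun x => ?_) ?_
    · rw [norm_smul]
      exact mul_le_of_le_one_left (norm_nonneg _) (hΘ1 _)
    · filter_upwards [hne] with x hx
      refine tendsto_const_nhds.congr' ?_
      filter_upwards [hχlim x hx] with k hk
      rw [hk, one_smul]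
  have hgφ : HasCompactSupport (∇ φ) := HasCompactSupport.intro h2
    fun x hx => gradient_eq_zero_of_notMem_tsupport hx
  have i1 : Integrable fun x => f x • ∇ φ x :=
    hfl.integrable_smul_right_of_hasCompactSupport (continuous_gradient h1) hgφ
  have i2 : Integrable fun x => φ x • G x :=
    hG.integrable_smul_left_of_hasCompactSupport h1.continuous h2
  have i3 : ∀ k, Integrable fun x => f x • (φ x • ∇ (χ k) x) := fun k =>
    hfl.integrable_smul_right_of_hasCompactSupport
      (h1.continuous.smul (continuous_gradient (hχc k))) h2.smul_right
  have i1' : ∀ k, Integrable fun x => χ k x • (f x • ∇ φ x) := fun k => by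
    refine i1.norm.mono' ((hχc k).continuous.aestronglyMeasurable.smul i1.1)
      (Eventually.of_forall fun x => ?_)
    rw [norm_smul]
    exact mul_le_of_le_one_left (norm_nonneg _) (hΘ1 _)
  -- the error term
  have herr : Tendsto (fun k => ∫ x, f x • (φ x • ∇ (χ k) x)) atTop (𝓝 0) := by
    set d := Module.finrank ℝ E with hd
    set S : ℕ → Set E := fun k => Metric.closedBall 0 (2 / ((k : ℝ) + 1)) with hS
    have hS2 : ∀ k, S k ⊆ Metric.closedBall 0 2 := fun k => by
      refine Metric.closedBall_subset_closedBall ?_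
      exact div_le_self zero_le_two (by have : (0 : ℝ) ≤ k := by positivity
                                        linarith)
    have hvol : ∀ k, volume (S k) = ENNReal.ofReal ((2 / ((k : ℝ) + 1)) ^ d) *
        volume (Metric.ball (0 : E) 1) := fun k =>
      Measure.addHaar_closedBall _ _ (by positivity)
    have hS0 : Tendsto (fun k => volume (S k)) atTop (𝓝 0) := by
      have h3 : Tendsto (fun k : ℕ => (2 / ((k : ℝ) + 1)) ^ d) atTop (𝓝 0) := by
        have := (tendsto_const_div_atTop_nhds_zero_nat (2 : ℝ)).comp (tendsto_add_atTop_nat 1)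
        have h4 := this.pow d
        rw [zero_pow (by omega)] at h4
        refine h4.congr fun k => ?_
        simp
      have h4 := ENNReal.Tendsto.mul_const (ENNReal.tendsto_ofReal h3)
        (b := volume (Metric.ball (0 : E) 1)) (Or.inr measure_ball_lt_top.ne)
      simp only [ENNReal.ofReal_zero, zero_mul] at h4
      exact h4.congr fun k => (hvol k).symm
    -- By Cauchy–Schwarz the squared error is at most a multiple of `(k + 1)² vol (S k)` times the
    -- integral of `f²` over `S k`. In dimension `d ≥ 2` the first product stays bounded, and the
    -- second factor tends to zero because `S k` shrinks to a point.
    set K : ℝ≥0∞ := ENNReal.ofReal (Cφ * C) ^ 2 *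
      (ENNReal.ofReal (2 ^ d) * volume (Metric.ball (0 : E) 1)) with hK
    have hKt : K ≠ ⊤ := ENNReal.mul_ne_top (by simp)
      (ENNReal.mul_ne_top (by simp) measure_ball_lt_top.ne)
    have hf2 : ∫⁻ x in Metric.closedBall (0 : E) 2, ‖f x‖ₑ ^ 2 ≠ ⊤ := by
      have := (hf.integrableOn_isCompact (isCompact_closedBall (0 : E) 2)).2
      simp only [HasFiniteIntegral, enorm_pow] at this
      exact this.ne
    have hsm : Tendsto (fun k => ∫⁻ x in S k, ‖f x‖ₑ ^ 2) atTop (𝓝 0) := by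
      have h3 : Tendsto ((volume.restrict (Metric.closedBall (0 : E) 2)) ∘ S) atTop (𝓝 0) :=
        tendsto_of_tendsto_of_tendsto_of_le_of_le tendsto_const_nhds hS0 (fun _ => zero_le)
          fun k => Measure.restrict_apply_le _ _
      refine (tendsto_setLIntegral_zero hf2 h3).congr fun k => ?_
      rw [Measure.restrict_restrict measurableSet_closedBall, inter_eq_left.2 (hS2 k)]
    have hb := ENNReal.Tendsto.const_mul hsm (Or.inr hKt)
    rw [mul_zero] at hb
    refine tendsto_zero_of_enorm_sq_le (fun k => ?_) hb
    have h3 : ‖∫ x, f x • (φ x • ∇ (χ k) x)‖ₑ ≤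
        ENNReal.ofReal (Cφ * C * ((k : ℝ) + 1)) * ∫⁻ x in S k, ‖f x‖ₑ := by
      refine (enorm_integral_le_lintegral_enorm _).trans ?_
      rw [← lintegral_const_mul' _ _ ENNReal.ofReal_ne_top,
        ← lintegral_indicator measurableSet_closedBall]
      refine lintegral_mono fun x => ?_
      by_cases hx : x ∈ S k
      · rw [indicator_of_mem hx, enorm_smul, mul_comm]
        gcongr
        rw [← ofReal_norm, norm_smul, hχg, norm_smul, Real.norm_of_nonneg (hN k).le]
        refine ENNReal.ofReal_le_ofReal ?_
        have := mul_le_mul (hCφ x) (hC (((k : ℝ) + 1) • x)) (norm_nonneg _)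
          ((norm_nonneg _).trans (hCφ x))
        have := mul_le_mul_of_nonneg_right this (hN k).le
        linarith
      · rw [indicator_of_notMem hx, hχg, hΘg0]
        · simp
        · have hx : 2 / ((k : ℝ) + 1) < ‖x‖ := by simpa [hS] using hx
          rw [div_lt_iff₀ (hN k)] at hx
          rw [norm_smul, Real.norm_of_nonneg (hN k).le]
          linarith
    calc ‖∫ x, f x • (φ x • ∇ (χ k) x)‖ₑ ^ 2
        ≤ (ENNReal.ofReal (Cφ * C * ((k : ℝ) + 1)) * ∫⁻ x in S k, ‖f x‖ₑ) ^ 2 := by gcongr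
      _ ≤ ENNReal.ofReal (Cφ * C * ((k : ℝ) + 1)) ^ 2 *
          (volume (S k) * ∫⁻ x in S k, ‖f x‖ₑ ^ 2) := by
          rw [mul_pow]
          gcongr
          have := lintegral_sq_le_measure_mul (m := volume.restrict (S k))
            (f := fun x => ‖f x‖ₑ) hfl.aestronglyMeasurable.enorm.restrict
          rwa [Measure.restrict_apply_univ] at this
      _ ≤ K * ∫⁻ x in S k, ‖f x‖ₑ ^ 2 := by
          rw [← mul_assoc, hK, hvol k]
          gcongr ?_ * _
          have hCC : 0 ≤ Cφ * C := mul_nonneg ((norm_nonneg _).trans (hCφ 0))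
            ((norm_nonneg _).trans (hC 0))
          rw [← mul_assoc, ← mul_assoc, ENNReal.ofReal_mul hCC, mul_pow, mul_assoc _ (_ ^ 2)]
          gcongr ?_ * _
          gcongr
          rw [← ENNReal.ofReal_pow (hN k).le, ← ENNReal.ofReal_mul (by positivity)]
          refine ENNReal.ofReal_le_ofReal ?_
          rw [div_pow, mul_div_assoc', div_le_iff₀ (by positivity), mul_comm]
          gcongr
          have : (0 : ℝ) ≤ k := by positivity
          linarith
  have heq : ∀ k, (∫ x, χ k x • (f x • ∇ φ x)) + ∫ x, f x • (φ x • ∇ (χ k) x) =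
      - ∫ x, χ k x • (φ x • G x) := by
    intro k
    have h3 : tsupport (fun x => φ x * χ k x) ⊆ {0}ᶜ := by
      intro x hx hx0
      rw [mem_singleton_iff] at hx0
      subst hx0
      refine (notMem_tsupport_iff_eventuallyEq.2 ?_) hx
      have : Metric.ball (0 : E) (1 / ((k : ℝ) + 1)) ∈ 𝓝 (0 : E) :=
        Metric.ball_mem_nhds _ (by positivity)
      filter_upwards [this] with y hy
      have hy : ‖y‖ < 1 / ((k : ℝ) + 1) := by simpa using hy
      simp only [hχ, Pi.zero_apply]
      rw [hΘin, mul_zero]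
      rw [norm_smul, Real.norm_of_nonneg (hN k).le]
      rw [lt_div_iff₀ (hN k)] at hy
      linarith
    have := h.2.2 (fun x => φ x * χ k x) (h1.mul (hχc k)) h2.mul_right h3
    rw [← integral_add (i1' k) (i3 k)]
    refine Eq.trans (integral_congr_ae (Eventually.of_forall fun x => ?_)) (this.trans ?_)
    · simp only
      rw [gradient_mul (h1.differentiable (by simp) x) ((hχc k).differentiable (by simp) x),
        smul_add, add_comm, smul_comm (f x), smul_comm (f x)]
    · congr 1
      refine integral_congr_ae (Eventually.of_forall fun x => ?_)
      simp only [smul_smul, mul_comm]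
  have l1 := (hlim _ i1).add herr
  have l2 := (hlim _ i2).neg
  rw [add_zero] at l1
  exact tendsto_nhds_unique (l1.congr heq) l2

end IntegrationByParts

end


noncomputable section

/-! ### Passing to the limit in squared norms and integrals. -/

section Convergence

variable {α : Type*} [MeasurableSpace α] {m : Measure α}

theorem tendsto_eLpNorm_of_measure_le_smul {F : Type*} [NormedAddCommGroup F] {m' : Measure α}
    {C : ℝ≥0∞} (hC : C ≠ ⊤) (h : m ≤ C • m') {u : ℕ → α → F}
    (hu : Tendsto (fun j => eLpNorm (u j) 2 m') atTop (𝓝 0)) :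
    Tendsto (fun j => eLpNorm (u j) 2 m) atTop (𝓝 0) := by
  have h1 := ENNReal.Tendsto.const_mul (a := C ^ (1 / (2 : ℝ≥0∞)).toReal) hu
    (Or.inr (ENNReal.rpow_ne_top_of_nonneg (by positivity) hC))
  rw [mul_zero] at h1
  refine tendsto_of_tendsto_of_tendsto_of_le_of_le tendsto_const_nhds h1 (fun _ => zero_le)
    fun j => ?_
  have h2 := eLpNorm_smul_measure_of_ne_top (p := 2) (by simp) (u j) (μ := m') C
  rw [smul_eq_mul] at h2
  simp only
  rw [← h2]
  exact eLpNorm_mono_measure _ h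

/-- On a finite measure space square convergence controls absolute convergence; the form with `P`
covers products with a bounded test function. -/
theorem tendsto_integral_of_norm_sub_le [IsFiniteMeasure m] {F H : Type*} [NormedAddCommGroup F]
    [NormedAddCommGroup H] [NormedSpace ℝ H] {u : ℕ → α → F} {u₀ : α → F}
    (hum : ∀ j, AEStronglyMeasurable (u j - u₀) m)
    (hu : Tendsto (fun j => eLpNorm (u j - u₀) 2 m) atTop (𝓝 0))
    {P : ℕ → α → H} {P₀ : α → H} (hP : ∀ j, Integrable (P j) m) (hP₀ : Integrable P₀ m) {C : ℝ}
    (hb : ∀ j, ∀ᵐ x ∂m, ‖P j x - P₀ x‖ ≤ C * ‖u j x - u₀ x‖) :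
    Tendsto (fun j => ∫ x, P j x ∂m) atTop (𝓝 (∫ x, P₀ x ∂m)) := by
  refine tendsto_integral_of_L1' P₀ hP₀.1 (Eventually.of_forall hP) ?_
  set K := ENNReal.ofReal C * m univ ^ (1 / (1 : ℝ≥0∞).toReal - 1 / (2 : ℝ≥0∞).toReal) with hK
  have hKt : K ≠ ⊤ := ENNReal.mul_ne_top ENNReal.ofReal_ne_top
    (ENNReal.rpow_ne_top_of_nonneg (by norm_num) (measure_ne_top _ _))
  have h1 := ENNReal.Tendsto.const_mul (a := K) hu (Or.inr hKt)
  rw [mul_zero] at h1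
  refine tendsto_of_tendsto_of_tendsto_of_le_of_le tendsto_const_nhds h1 (fun _ => zero_le)
    fun j => ?_
  calc eLpNorm (P j - P₀) 1 m ≤ ENNReal.ofReal C * eLpNorm (u j - u₀) 1 m :=
        eLpNorm_le_mul_eLpNorm_of_ae_le_mul (hb j) 1
    _ ≤ ENNReal.ofReal C * (eLpNorm (u j - u₀) 2 m *
          m univ ^ (1 / (1 : ℝ≥0∞).toReal - 1 / (2 : ℝ≥0∞).toReal)) := by
        gcongr
        exact eLpNorm_le_eLpNorm_mul_rpow_measure_univ (by norm_num) (hum j)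
    _ = K * eLpNorm (u j - u₀) 2 m := by rw [hK]; ring

end Convergence

/-! ### Lifting radial functions: the gap of `μ` is at most that of `ν`. -/

namespace PolarFactorization

variable {E : Type*} [NormedAddCommGroup E] [InnerProductSpace ℝ E] [FiniteDimensional ℝ E]
  [MeasurableSpace E] [BorelSpace E] [Nontrivial E] {μ : Measure E} {ν : Measure ℝ}
  [IsProbabilityMeasure ν] {σ : E → ℝ} {s : ℝ → ℝ}

omit [Nontrivial E] [IsProbabilityMeasure ν] in
theorem ae_pos (h : PolarFactorization μ ν σ s) : ∀ᵐ r ∂ν, 0 < r := h.radial.ae_mem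

theorem norm (h : PolarFactorization μ ν σ s) : MeasurePreserving (fun x : E => ‖x‖) μ ν :=
  measurePreserving_norm h.ae_pos h.polar

omit [MeasurableSpace E] [BorelSpace E] [Nontrivial E] in
theorem _root_.IsCompact.preimage_norm {I : Set ℝ} (hI : IsCompact I) :
    IsCompact ((fun x : E => ‖x‖) ⁻¹' I) := by
  obtain ⟨b, hb⟩ := hI.isBounded.subset_closedBall 0
  refine (isCompact_closedBall (0 : E) b).of_isClosed_subset (hI.isClosed.preimage continuous_norm)
    fun x hx => ?_
  have := hb hx
  simpa using this

/-- Lebesgue measure on the annulus is compared with `μ`, pushed to `ν` by the norm, and compared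
with Lebesgue measure on `I`. Approximation in one variable thereby transfers to the annulus. -/
theorem exists_map_norm_le (h : PolarFactorization μ ν σ s) {I : Set ℝ} (hI : IsCompact I)
    (hI0 : I ⊆ Ioi 0) : ∃ C : ℝ≥0∞, C ≠ ⊤ ∧
      (volume.restrict ((fun x : E => ‖x‖) ⁻¹' I)).map (fun x => ‖x‖) ≤
        C • volume.restrict I := by
  obtain ⟨C, hC, h1⟩ := h.full.exists_volume_restrict_le (hI.preimage_norm (E := E))
    (subset_univ _)
  obtain ⟨C', hC', h2⟩ := h.radial.exists_restrict_le_volume hI hI0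
  refine ⟨C * C', ENNReal.mul_ne_top hC hC', ?_⟩
  have hm : MeasurableSet ((fun x : E => ‖x‖) ⁻¹' I) := measurable_norm hI.measurableSet
  have h3 : volume.restrict ((fun x : E => ‖x‖) ⁻¹' I) ≤
      C • μ.restrict ((fun x : E => ‖x‖) ⁻¹' I) := by
    have := Measure.restrict_mono (le_refl ((fun x : E => ‖x‖) ⁻¹' I)) h1
    rwa [Measure.restrict_restrict hm, inter_self, Measure.restrict_smul] at this
  refine (Measure.map_mono h3 measurable_norm).trans ?_
  rw [Measure.map_smul, ← Measure.restrict_map measurable_norm hI.measurableSet, h.norm.map_eq,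
    mul_smul]
  gcongr

/-- A radial function of a Sobolev function is a Sobolev function, away from the origin. -/
theorem hasWeakGradient_radial_compl (h : PolarFactorization μ ν σ s) {g G : ℝ → ℝ}
    (hg : MemLp g 2 ν) (hG : HasWeakGradient (Ioi 0) g G) (hsG : MemLp (fun r => s r • G r) 2 ν)
    (hf2 : ∀ K : Set E, IsCompact K → MemLp (fun x : E => g ‖x‖) 2 (volume.restrict K))
    (hw2 : ∀ K : Set E, IsCompact K →
      MemLp (fun x : E => (G ‖x‖ / ‖x‖) • x) 2 (volume.restrict K)) :
    HasWeakGradient {0}ᶜ (fun x : E => g ‖x‖) (fun x => (G ‖x‖ / ‖x‖) • x) := by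
  have hU : IsOpen ({0}ᶜ : Set E) := isOpen_compl_singleton
  have hl1 : LocallyIntegrableOn (fun x : E => g ‖x‖) ({0}ᶜ : Set E) :=
    (h.full.locallyIntegrableOn fun K _ hK => hf2 K hK).mono_set (subset_univ _)
  have hl2 : LocallyIntegrableOn (fun x : E => (G ‖x‖ / ‖x‖) • x) ({0}ᶜ : Set E) :=
    (h.full.locallyIntegrableOn fun K _ hK => hw2 K hK).mono_set (subset_univ _)
  refine ⟨hl1, hl2, fun φ h1 h2 h3 => ?_⟩
  -- The support of `φ` misses the origin, so its norms stay in some `[a, b]` with `a > 0`, where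
  -- `g` can be mollified and the classical chain rule used.
  obtain ⟨a, ha, hab⟩ := IsCompact.exists_forall_le' h2 continuous_norm.continuousOn (a := 0)
    fun x hx => norm_pos_iff.2 (h3 hx)
  obtain ⟨b, hb⟩ := h2.isBounded.subset_closedBall 0
  set I := Icc a b with hI
  have hIc : IsCompact I := isCompact_Icc
  have hI0 : I ⊆ Ioi 0 := fun r hr => lt_of_lt_of_le ha hr.1
  set A : Set E := (fun x : E => ‖x‖) ⁻¹' I with hA
  have hAc : IsCompact A := hIc.preimage_norm
  have hφA : ∀ x, x ∉ A → x ∉ tsupport φ := fun x hx hx' => hx ⟨hab x hx', by simpa using hb hx'⟩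
  have hA0 : ∀ x ∈ A, x ≠ 0 := fun x hx => norm_pos_iff.1 (hI0 hx)
  obtain ⟨u, hu, hu1, hu2, -⟩ := hG.exists_smooth_approx isOpen_Ioi
    (fun K hK hKc => h.radial.memLp_restrict hg hKc hK)
    (fun K hK hKc => h.radial.memLp_restrict_gradient hsG hKc hK) hIc hI0
  obtain ⟨C, hC, hle⟩ := h.exists_map_norm_le (E := E) hIc hI0
  have hac : (volume.restrict A).map (fun x : E => ‖x‖) ≪ volume.restrict I :=
    (Measure.absolutelyContinuous_of_le hle).trans (Measure.smul_absolutelyContinuous)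
  have conv : ∀ {v : ℕ → ℝ → ℝ} {v₀ : ℝ → ℝ}, (∀ j, Continuous (v j)) →
      MemLp v₀ 2 (volume.restrict I) →
      Tendsto (fun j => eLpNorm (v j - v₀) 2 (volume.restrict I)) atTop (𝓝 0) →
      (∀ j, AEStronglyMeasurable ((fun x : E => v j ‖x‖) - fun x => v₀ ‖x‖) (volume.restrict A)) ∧
      Tendsto (fun j => eLpNorm ((fun x : E => v j ‖x‖) - fun x => v₀ ‖x‖) 2 (volume.restrict A))
        atTop (𝓝 0) := by
    intro v v₀ hv hv₀ hl
    have hm : ∀ j, AEStronglyMeasurable (v j - v₀) ((volume.restrict A).map fun x : E => ‖x‖) :=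
      fun j => ((hv j).aestronglyMeasurable.sub hv₀.1).mono_ac hac
    refine ⟨fun j => (hm j).comp_measurable measurable_norm, ?_⟩
    refine (tendsto_eLpNorm_of_measure_le_smul hC hle hl).congr fun j => ?_
    rw [eLpNorm_map_measure (hm j) measurable_norm.aemeasurable]
    rfl
  have := hAc.measure_lt_top (μ := (volume : Measure E))
  have hfin : IsFiniteMeasure (volume.restrict A) := ⟨by simpa using this⟩
  have hsmooth : ∀ j, ∀ x : E, x ≠ 0 → ContDiffAt ℝ ∞ (fun x : E => u j ‖x‖) x := fun j x hx =>
    (hu j).contDiffAt.comp x (contDiffAt_norm ℝ hx)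
  have hgrad : ∀ j, ∀ x : E, x ≠ 0 → ∇ (fun x : E => u j ‖x‖) x = (∇ (u j) ‖x‖ / ‖x‖) • x := by
    intro j x hx
    rw [gradient_radial hx (((hu j).differentiable (by simp) _).hasDerivAt), gradient_eq_deriv']
  obtain ⟨φ', hφ'⟩ : ∃ C, ∀ x, ‖∇ φ x‖ ≤ C := by
    refine HasCompactSupport.exists_bound_of_continuous ?_ (continuous_gradient h1)
    exact HasCompactSupport.intro h2 fun x hx => gradient_eq_zero_of_notMem_tsupport hx
  obtain ⟨Cφ, hCφ⟩ := h2.exists_bound_of_continuous h1.continuous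
  have z : ∀ x, x ∉ A → φ x = 0 := fun x hx => image_eq_zero_of_notMem_tsupport (hφA x hx)
  have z' : ∀ x, x ∉ A → ∇ φ x = 0 := fun x hx => gradient_eq_zero_of_notMem_tsupport (hφA x hx)
  have l1 : Tendsto (fun j => ∫ x in A, u j ‖x‖ • ∇ φ x) atTop
      (𝓝 (∫ x in A, g ‖x‖ • ∇ φ x)) := by
    obtain ⟨c1, c2⟩ := conv (fun j => (hu j).continuous) (h.radial.memLp_restrict hg hIc hI0) hu1
    refine tendsto_integral_of_norm_sub_le c1 c2 (C := φ') (fun j => ?_) ?_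
      fun j => Eventually.of_forall fun x => ?_
    · exact (((hu j).continuous.comp continuous_norm).smul
        (continuous_gradient h1)).continuousOn.integrableOn_compact hAc
    · exact ((hf2 A hAc).integrable (by norm_num)).smul_bdd φ'
        (continuous_gradient h1).aestronglyMeasurable (Eventually.of_forall hφ')
    · rw [← sub_smul, norm_smul, mul_comm]
      exact mul_le_mul_of_nonneg_right (hφ' x) (norm_nonneg _)
  have l2 : Tendsto (fun j => ∫ x in A, φ x • ((∇ (u j) ‖x‖ / ‖x‖) • x)) atTop
      (𝓝 (∫ x in A, φ x • ((G ‖x‖ / ‖x‖) • x))) := by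
    obtain ⟨c1, c2⟩ := conv (fun j => continuous_gradient (hu j))
      (h.radial.memLp_restrict_gradient hsG hIc hI0) hu2
    refine tendsto_integral_of_norm_sub_le c1 c2 (C := Cφ) (fun j => ?_) ?_
      fun j => ?_
    · refine ContinuousOn.integrableOn_compact hAc ?_
      refine h1.continuous.continuousOn.smul (ContinuousOn.smul (ContinuousOn.div
        ((continuous_gradient (hu j)).comp continuous_norm).continuousOn
        continuous_norm.continuousOn fun x hx => (norm_pos_iff.2 (hA0 x hx)).ne') continuousOn_id)
    · exact ((hw2 A hAc).integrable (by norm_num)).bdd_smul Cφ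
        h1.continuous.aestronglyMeasurable (Eventually.of_forall hCφ)
    · filter_upwards [ae_restrict_mem hAc.measurableSet] with x hx
      have hx0 := norm_pos_iff.2 (hA0 x hx)
      rw [← smul_sub, ← sub_smul, ← sub_div, norm_smul, norm_smul, norm_div, norm_norm,
        div_mul_cancel₀ _ hx0.ne']
      exact mul_le_mul_of_nonneg_right (hCφ x) (norm_nonneg _)
  have e : ∀ j, ∫ x in A, u j ‖x‖ • ∇ φ x = - ∫ x in A, φ x • ((∇ (u j) ‖x‖ / ‖x‖) • x) := by
    intro j
    rw [setIntegral_eq_integral_of_forall_compl_eq_zero fun x hx => by simp [z' x hx],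
      setIntegral_eq_integral_of_forall_compl_eq_zero fun x hx => by simp [z x hx],
      integral_smul_gradient_eq_neg h1 h2 fun x hx => hsmooth j x (h3 hx)]
    congr 1
    refine integral_congr_ae (Eventually.of_forall fun x => ?_)
    by_cases hx : x ∈ A
    · simp only; rw [hgrad j x (hA0 x hx)]
    · simp [z x hx]
  have := tendsto_nhds_unique (l1.congr e) l2.neg
  rwa [setIntegral_eq_integral_of_forall_compl_eq_zero fun x hx => by simp [z' x hx],
    setIntegral_eq_integral_of_forall_compl_eq_zero fun x hx => by simp [z x hx]] at this

/-- The Poincaré inequality for `μ` implies the Poincaré inequality for `ν`. -/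
theorem poincareInequality_radial (h : PolarFactorization μ ν σ s)
    (hdim : 2 ≤ Module.finrank ℝ E) {l : ℝ} (hP : PoincareInequality univ μ σ l) :
    PoincareInequality (Ioi 0) ν s l := by
  intro g G hg hG hsG
  have hf : MemLp (fun x : E => g ‖x‖) 2 μ := hg.comp_measurePreserving h.norm
  have hne : ∀ᵐ x ∂μ, x ≠ 0 := by
    have : ∀ᵐ x ∂μ, 0 < ‖x‖ := h.norm.quasiMeasurePreserving.ae h.ae_pos
    filter_upwards [this] with x hx
    exact norm_pos_iff.1 hx
  -- The vector `x / ‖x‖` has norm at most one, even at the origin, so the lifted gradient is no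
  -- larger than `s G` at the radius.
  have hσw : MemLp (fun x : E => σ x • ((G ‖x‖ / ‖x‖) • x)) 2 μ := by
    have h1 : MemLp (fun x : E => s ‖x‖ • G ‖x‖) 2 μ := hsG.comp_measurePreserving h.norm
    have e : (fun x : E => σ x • ((G ‖x‖ / ‖x‖) • x)) =
        fun x => (s ‖x‖ • G ‖x‖) • (‖x‖⁻¹ • x) := by
      ext x
      rw [h.weight, smul_smul, smul_smul, smul_eq_mul]
      congr 1
      ring
    rw [e]
    refine h1.of_le (h1.1.smul (Measurable.aestronglyMeasurable (by fun_prop))) ?_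
    refine Eventually.of_forall fun x => ?_
    rw [norm_smul _ (‖x‖⁻¹ • x)]
    refine mul_le_of_le_one_right (norm_nonneg _) ?_
    rw [norm_smul, norm_inv, norm_norm]
    exact inv_mul_le_one
  have hw : HasWeakGradient univ (fun x : E => g ‖x‖) (fun x => (G ‖x‖ / ‖x‖) • x) := by
    have hf2 : ∀ K : Set E, IsCompact K → MemLp (fun x : E => g ‖x‖) 2 (volume.restrict K) :=
      fun K hK => h.full.memLp_restrict hf hK (subset_univ _)
    have hw2 : ∀ K : Set E, IsCompact K →
        MemLp (fun x : E => (G ‖x‖ / ‖x‖) • x) 2 (volume.restrict K) :=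
      fun K hK => h.full.memLp_restrict_gradient hσw hK (subset_univ _)
    refine HasWeakGradient.of_compl_singleton hdim ?_ ?_ ?_
      (h.hasWeakGradient_radial_compl hg hG hsG hf2 hw2)
    · rw [← locallyIntegrableOn_univ, locallyIntegrableOn_iff isOpen_univ.isLocallyClosed]
      exact fun K _ hK => (hf2 K hK).integrable_sq
    · rw [← locallyIntegrableOn_univ]
      exact h.full.locallyIntegrableOn fun K _ hK => hf2 K hK
    · rw [← locallyIntegrableOn_univ]
      exact h.full.locallyIntegrableOn fun K _ hK => hw2 K hK
  have key := hP _ _ hf hw hσw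
  have e3 : ∫ x : E, σ x ^ 2 * ‖(G ‖x‖ / ‖x‖) • x‖ ^ 2 ∂μ = ∫ r, s r ^ 2 * ‖G r‖ ^ 2 ∂ν := by
    have hm : AEStronglyMeasurable (fun r => s r ^ 2 * ‖G r‖ ^ 2) ν := by
      have := hsG.1.norm.pow 2
      refine this.congr (Eventually.of_forall fun r => ?_)
      simp [mul_pow]
    rw [h.norm.integral_map_eq hm]
    refine integral_congr_ae ?_
    filter_upwards [hne] with x hx
    rw [h.weight, norm_smul, norm_div, norm_norm, div_mul_cancel₀ _ (norm_pos_iff.2 hx).ne']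
  rw [h.norm.integral_map_eq (g := fun r => g r ^ 2) (hg.1.pow 2), h.norm.integral_map_eq hg.1, ← e3]
  exact key

/-- Any constant strictly below the gap of `μ` is a Poincaré constant for `μ`, hence for `ν`. -/
theorem spectralGap_le_radial [IsProbabilityMeasure μ] (h : PolarFactorization μ ν σ s)
    (hdim : 2 ≤ Module.finrank ℝ E) :
    spectralGap univ μ σ ≤ spectralGap (Ioi 0) ν s :=
  ENNReal.le_of_forall_nnreal_lt fun _ hl => h.radial.le_spectralGap
    (h.poincareInequality_radial hdim (h.full.poincareInequality_of_lt_spectralGap hl))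

end PolarFactorization

end


noncomputable section

/-! ### Upper bound from coordinate functions. -/

section UpperBound

variable {E : Type*} [NormedAddCommGroup E] [InnerProductSpace ℝ E] [FiniteDimensional ℝ E]
  [MeasurableSpace E] [BorelSpace E] {μ : Measure E} [IsProbabilityMeasure μ] {σ : E → ℝ}

theorem tendsto_mul_sin_div (t : ℝ) :
    Tendsto (fun k : ℕ => ((k : ℝ) + 1) * Real.sin (t / ((k : ℝ) + 1))) atTop (𝓝 t) := by
  have h1 : HasDerivAt (fun h : ℝ => Real.sin (t * h)) t 0 := by
    have h0 : HasDerivAt (fun h : ℝ => t * h) t 0 := by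
      simpa using (hasDerivAt_id (0 : ℝ)).const_mul t
    simpa using h0.sin
  have h2 : Tendsto (fun k : ℕ => 1 / ((k : ℝ) + 1)) atTop (𝓝[≠] 0) := by
    refine tendsto_nhdsWithin_iff.2 ⟨tendsto_one_div_add_atTop_nhds_zero_nat, ?_⟩
    exact Eventually.of_forall fun k => by
      have : (0 : ℝ) < 1 / ((k : ℝ) + 1) := by positivity
      exact this.ne'
  refine ((hasDerivAt_iff_tendsto_slope_zero.1 h1).comp h2).congr fun k => ?_
  simp [div_eq_mul_inv]

/-- The Poincaré inequality for bounded odd functions of a single coordinate. -/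
theorem PoincareInequality.mul_lintegral_inner_sq_le (h : RegularWeight univ μ σ)
    (hneg : MeasurePreserving (fun x : E => -x) μ μ) {l : ℝ≥0} (hP : PoincareInequality univ μ σ l)
    (hσ : ∫⁻ x, ENNReal.ofReal (σ x ^ 2) ∂μ ≠ ⊤) {v : E} (hv : ‖v‖ = 1) :
    l * ∫⁻ x, ENNReal.ofReal (⟪v, x⟫_ℝ ^ 2) ∂μ ≤ ∫⁻ x, ENNReal.ofReal (σ x ^ 2) ∂μ := by
  have hσc : Continuous σ := continuousOn_univ.1 h.continuousOn
  have hσi : Integrable (fun x => σ x ^ 2) μ := by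
    refine ⟨by fun_prop, ?_⟩
    rw [hasFiniteIntegral_iff_ofReal (Eventually.of_forall fun x => sq_nonneg _)]
    exact lt_top_iff_ne_top.2 hσ
  have hσ2 : MemLp σ 2 μ := (memLp_two_iff_integrable_sq (by fun_prop)).2 hσi
  -- Bounded smooth substitutes for the coordinate `⟪v, x⟫`: they are odd, have gradient of norm at
  -- most one, and converge pointwise to it. No second moment of `μ` is therefore assumed.
  set f : ℕ → E → ℝ := fun k x => ((k : ℝ) + 1) * Real.sin (⟪v, x⟫_ℝ / ((k : ℝ) + 1)) with hf
  have hfc : ∀ k, ContDiff ℝ ∞ (f k) := fun k => by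
    have h1 : ContDiff ℝ ∞ fun x : E => ⟪v, x⟫_ℝ := contDiff_const.inner ℝ contDiff_id
    exact contDiff_const.mul (Real.contDiff_sin.comp (h1.div_const _))
  have hfb : ∀ k x, ‖f k x‖ ≤ (k : ℝ) + 1 := fun k x => by
    have h0 : (0 : ℝ) ≤ (k : ℝ) + 1 := by positivity
    rw [Real.norm_eq_abs, abs_mul, abs_of_nonneg h0]
    exact mul_le_of_le_one_right h0 (Real.abs_sin_le_one _)
  have hfm : ∀ k, MemLp (f k) 2 μ := fun k =>
    MemLp.of_bound (hfc k).continuous.aestronglyMeasurable _ (Eventually.of_forall (hfb k))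
  have hg : ∀ k x, ‖∇ (f k) x‖ ≤ 1 := by
    intro k x
    have h0 : ((k : ℝ) + 1) ≠ 0 := by positivity
    have h1 : HasFDerivAt (fun x : E => ⟪v, x⟫_ℝ * ((k : ℝ) + 1)⁻¹)
        (((k : ℝ) + 1)⁻¹ • innerSL ℝ v) x := ((innerSL ℝ v).hasFDerivAt (x := x)).mul_const _
    have h2 := (h1.sin).const_mul ((k : ℝ) + 1)
    have h3 : HasFDerivAt (f k) _ x := h2
    rw [norm_gradient, h3.fderiv, norm_smul, norm_smul, norm_smul, innerSL_apply_norm, hv, norm_inv,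
      mul_one, mul_comm (‖Real.cos _‖), ← mul_assoc, mul_inv_cancel₀ (norm_ne_zero_iff.2 h0),
      one_mul]
    exact Real.abs_cos_le_one _
  have hσg : ∀ k, MemLp (fun x => σ x • ∇ (f k) x) 2 μ := fun k => by
    refine hσ2.of_le ((hσc.smul (continuous_gradient (hfc k))).aestronglyMeasurable)
      (Eventually.of_forall fun x => ?_)
    rw [norm_smul]
    exact mul_le_of_le_one_right (norm_nonneg _) (hg k x)
  have hmean : ∀ k, ∫ x, f k x ∂μ = 0 := by
    intro k
    have h1 := hneg.integral_map_eq (hfm k).1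
    have h2 : ∀ x, f k (-x) = - f k x := fun x => by
      simp [hf, neg_div]
    simp_rw [h2, integral_neg] at h1
    linarith
  have hk : ∀ k, l * ∫⁻ x, ENNReal.ofReal (f k x ^ 2) ∂μ ≤ ∫⁻ x, ENNReal.ofReal (σ x ^ 2) ∂μ := by
    intro k
    have h1 := hP (f k) (∇ (f k)) (hfm k) (hasWeakGradient_of_smooth (hfc k) (EventuallyEq.refl _ _))
      (hσg k)
    rw [hmean k] at h1
    have h2 : ∫ x, σ x ^ 2 * ‖∇ (f k) x‖ ^ 2 ∂μ ≤ ∫ x, σ x ^ 2 ∂μ := by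
      refine integral_mono_of_nonneg (Eventually.of_forall fun x => by positivity) hσi
        (Eventually.of_forall fun x => ?_)
      exact mul_le_of_le_one_right (sq_nonneg _) (pow_le_one₀ (norm_nonneg _) (hg k x))
    rw [← ofReal_integral_eq_lintegral_ofReal (hfm k).integrable_sq
      (Eventually.of_forall fun x => sq_nonneg _), ← ofReal_integral_eq_lintegral_ofReal hσi
      (Eventually.of_forall fun x => sq_nonneg _), ← ENNReal.ofReal_coe_nnreal,
      ← ENNReal.ofReal_mul l.coe_nonneg]
    refine ENNReal.ofReal_le_ofReal ?_
    linarith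
  have hlim : ∀ x, Tendsto (fun k => ENNReal.ofReal (f k x ^ 2)) atTop
      (𝓝 (ENNReal.ofReal (⟪v, x⟫_ℝ ^ 2))) := fun x =>
    ENNReal.tendsto_ofReal ((tendsto_mul_sin_div _).pow 2)
  -- Fatou's lemma removes the truncation.
  calc l * ∫⁻ x, ENNReal.ofReal (⟪v, x⟫_ℝ ^ 2) ∂μ
      = ∫⁻ x, liminf (fun k => l * ENNReal.ofReal (f k x ^ 2)) atTop ∂μ := by
        rw [← lintegral_const_mul' _ _ ENNReal.coe_ne_top]
        refine lintegral_congr fun x => ?_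
        exact ((ENNReal.Tendsto.const_mul (hlim x) (Or.inr ENNReal.coe_ne_top)).liminf_eq).symm
    _ ≤ liminf (fun k => ∫⁻ x, l * ENNReal.ofReal (f k x ^ 2) ∂μ) atTop := by
        refine lintegral_liminf_le fun k => ?_
        have := (hfc k).continuous.measurable
        fun_prop
    _ ≤ ∫⁻ x, ENNReal.ofReal (σ x ^ 2) ∂μ := by
        refine liminf_le_of_le (by isBoundedDefault) fun b hb => ?_
        obtain ⟨k, hk'⟩ := hb.exists
        refine hk'.trans ?_
        rw [lintegral_const_mul' _ _ ENNReal.coe_ne_top]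
        exact hk k

/-- Parseval: the squared norm is the sum of the squared coordinates, each of which costs one
integral of `σ²`. -/
theorem PoincareInequality.mul_lintegral_norm_sq_le (hdim : Module.finrank ℝ E ≠ 0)
    (h : RegularWeight univ μ σ)
    (hneg : MeasurePreserving (fun x : E => -x) μ μ) {l : ℝ≥0}
    (hP : PoincareInequality univ μ σ l) :
    l * ∫⁻ x, ENNReal.ofReal (‖x‖ ^ 2) ∂μ ≤
      Module.finrank ℝ E * ∫⁻ x, ENNReal.ofReal (σ x ^ 2) ∂μ := by
  by_cases hσ : ∫⁻ x, ENNReal.ofReal (σ x ^ 2) ∂μ = ⊤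
  · rw [hσ, ENNReal.mul_top (by exact_mod_cast hdim)]
    exact le_top
  set b := stdOrthonormalBasis ℝ E
  have e : ∀ x : E, ENNReal.ofReal (‖x‖ ^ 2) = ∑ i, ENNReal.ofReal (⟪b i, x⟫_ℝ ^ 2) := by
    intro x
    rw [← ENNReal.ofReal_sum_of_nonneg fun i _ => sq_nonneg _, ← b.sum_sq_norm_inner_right x]
    simp
  simp_rw [e]
  rw [lintegral_finsetSum _ fun i _ => by fun_prop, Finset.mul_sum]
  refine (Finset.sum_le_sum fun i _ => hP.mul_lintegral_inner_sq_le h hneg hσ (b.norm_eq_one i)).trans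
    ?_
  simp

theorem spectralGap_le_div (hdim : Module.finrank ℝ E ≠ 0)
    (h : RegularWeight univ μ σ) (hneg : MeasurePreserving (fun x : E => -x) μ μ)
    (hfin : ∫⁻ x, ENNReal.ofReal (σ x ^ 2) ∂μ ≠ ⊤ ∨ ∫⁻ x, ENNReal.ofReal (‖x‖ ^ 2) ∂μ ≠ ⊤) :
    spectralGap univ μ σ ≤ (Module.finrank ℝ E * ∫⁻ x, ENNReal.ofReal (σ x ^ 2) ∂μ) /
      ∫⁻ x, ENNReal.ofReal (‖x‖ ^ 2) ∂μ := by
  refine ENNReal.le_of_forall_nnreal_lt fun l hl => ?_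
  -- The side conditions exclude the quotients `0 / 0` and `∞ / ∞`: the numerator is positive
  -- because `σ` is, and the second case is ruled out by `hfin`.
  rw [ENNReal.le_div_iff_mul_le]
  · exact PoincareInequality.mul_lintegral_norm_sq_le hdim h hneg
      (h.poincareInequality_of_lt_spectralGap hl)
  · right
    have hσc : Continuous σ := continuousOn_univ.1 h.continuousOn
    refine mul_ne_zero (by exact_mod_cast hdim) fun h0 => ?_
    rw [lintegral_eq_zero_iff (by fun_prop)] at h0
    obtain ⟨x, hx⟩ := h0.exists
    have := h.pos x (mem_univ x)
    have h1 : σ x ^ 2 ≤ 0 := by simpa using hx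
    nlinarith
  · rcases hfin with h1 | h1
    · exact Or.inr (ENNReal.mul_ne_top (by simp) h1)
    · exact Or.inl h1

end UpperBound

end


noncomputable section

/-! ### Convergence on slices of a product. -/

section Tools

variable {α : Type*} [MeasurableSpace α] {m : Measure α}

/-- Along indices where the integrals are at most `2⁻ᵏ` the series has a finite integral, so it
converges almost everywhere and its terms tend to zero. -/
theorem exists_seq_ae_tendsto_zero {Ψ : ℕ → α → ℝ≥0∞} (hΨ : ∀ j, AEMeasurable (Ψ j) m)
    (h : Tendsto (fun j => ∫⁻ a, Ψ j a ∂m) atTop (𝓝 0)) :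
    ∃ φ : ℕ → ℕ, ∀ᵐ a ∂m, Tendsto (fun k => Ψ (φ k) a) atTop (𝓝 0) := by
  have h1 : ∀ k : ℕ, ∃ j, ∫⁻ a, Ψ j a ∂m ≤ (1 / 2) ^ k := fun k =>
    (h.eventually (ge_mem_nhds (ENNReal.pow_pos (by norm_num) k))).exists
  choose φ hφ using h1
  refine ⟨φ, ?_⟩
  have h2 : ∫⁻ a, ∑' k, Ψ (φ k) a ∂m ≠ ⊤ := by
    rw [lintegral_tsum fun k => hΨ _]
    refine ne_top_of_le_ne_top ?_ (ENNReal.tsum_le_tsum hφ)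
    rw [ENNReal.tsum_geometric]
    norm_num
  filter_upwards [ae_lt_top' (AEMeasurable.tsum fun k => hΨ _) h2] with a ha
  exact ENNReal.tendsto_atTop_zero_of_tsum_ne_top ha.ne

theorem tendsto_eLpNorm_of_tendsto_lintegral {F : Type*} [NormedAddCommGroup F] {u : ℕ → α → F}
    (h : Tendsto (fun j => ∫⁻ a, ‖u j a‖ₑ ^ 2 ∂m) atTop (𝓝 0)) :
    Tendsto (fun j => eLpNorm (u j) 2 m) atTop (𝓝 0) := by
  have h2 := h.ennrpow_const (1 / 2 : ℝ)
  rw [ENNReal.zero_rpow_of_pos (by norm_num)] at h2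
  refine h2.congr fun k => ?_
  rw [← eLpNorm_two_sq, ← ENNReal.rpow_natCast, ← ENNReal.rpow_mul]
  norm_num

theorem tendsto_lintegral_of_tendsto_eLpNorm {F : Type*} [NormedAddCommGroup F] {u : ℕ → α → F}
    (h : Tendsto (fun j => eLpNorm (u j) 2 m) atTop (𝓝 0)) :
    Tendsto (fun j => ∫⁻ a, ‖u j a‖ₑ ^ 2 ∂m) atTop (𝓝 0) := by
  have h2 := ENNReal.Tendsto.pow (n := 2) h
  rw [zero_pow two_ne_zero] at h2
  exact h2.congr fun k => eLpNorm_two_sq _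

/-- Convergence in `L²` of a product space implies convergence in `L²` of almost every slice, along
a subsequence. -/
theorem exists_seq_ae_tendsto_eLpNorm_slice {β F H : Type*} [MeasurableSpace β]
    [NormedAddCommGroup F] [NormedAddCommGroup H] {m' : Measure β} [SFinite m']
    {u : ℕ → α × β → F} {v : ℕ → α × β → H}
    (hum : ∀ j, AEStronglyMeasurable (u j) (m.prod m'))
    (hvm : ∀ j, AEStronglyMeasurable (v j) (m.prod m')) [SFinite m]
    (hu : Tendsto (fun j => eLpNorm (u j) 2 (m.prod m')) atTop (𝓝 0))
    (hv : Tendsto (fun j => eLpNorm (v j) 2 (m.prod m')) atTop (𝓝 0)) :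
    ∃ φ : ℕ → ℕ, ∀ᵐ a ∂m,
      Tendsto (fun k => eLpNorm (fun b => u (φ k) (a, b)) 2 m') atTop (𝓝 0) ∧
      Tendsto (fun k => eLpNorm (fun b => v (φ k) (a, b)) 2 m') atTop (𝓝 0) := by
  have hum' : ∀ j, AEMeasurable (fun z => ‖u j z‖ₑ ^ 2) (m.prod m') := fun j =>
    (hum j).enorm.pow_const 2
  have hvm' : ∀ j, AEMeasurable (fun z => ‖v j z‖ₑ ^ 2) (m.prod m') := fun j =>
    (hvm j).enorm.pow_const 2
  have h1 := (tendsto_lintegral_of_tendsto_eLpNorm hu).add (tendsto_lintegral_of_tendsto_eLpNorm hv)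
  rw [add_zero] at h1
  obtain ⟨φ, hφ⟩ := exists_seq_ae_tendsto_zero (m := m)
    (Ψ := fun j a => ∫⁻ b, ‖u j (a, b)‖ₑ ^ 2 ∂m' + ∫⁻ b, ‖v j (a, b)‖ₑ ^ 2 ∂m')
    (fun j => (hum' j).lintegral_prod_right'.add (hvm' j).lintegral_prod_right') (by
      refine h1.congr fun j => ?_
      rw [lintegral_add_left' (hum' j).lintegral_prod_right', lintegral_prod _ (hum' j),
        lintegral_prod _ (hvm' j)])
  refine ⟨φ, ?_⟩
  filter_upwards [hφ] with a ha
  exact ⟨tendsto_eLpNorm_of_tendsto_lintegral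
      (tendsto_of_tendsto_of_tendsto_of_le_of_le tendsto_const_nhds ha (fun _ => zero_le)
        fun k => le_self_add),
    tendsto_eLpNorm_of_tendsto_lintegral
      (tendsto_of_tendsto_of_tendsto_of_le_of_le tendsto_const_nhds ha (fun _ => zero_le)
        fun k => le_add_self)⟩

theorem sq_integral_mul_le {f g : α → ℝ} (hf : MemLp f 2 m) (hg : MemLp g 2 m) :
    (∫ x, f x * g x ∂m) ^ 2 ≤ (∫ x, f x ^ 2 ∂m) * ∫ x, g x ^ 2 ∂m := by
  have h := real_inner_mul_inner_self_le (hf.toLp f) (hg.toLp g)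
  have e : ∀ {u v : α → ℝ} (hu : MemLp u 2 m) (hv : MemLp v 2 m),
      ⟪hu.toLp u, hv.toLp v⟫_ℝ = ∫ x, u x * v x ∂m := by
    intro u v hu hv
    rw [L2.inner_def]
    refine integral_congr_ae ?_
    filter_upwards [hu.coeFn_toLp, hv.coeFn_toLp] with x h1 h2
    rw [h1, h2]
    simp [mul_comm]
  rw [e, e, e] at h
  simp_rw [pow_two]
  exact h

theorem tendsto_integral_norm_sq {F : Type*} [NormedAddCommGroup F] [InnerProductSpace ℝ F]
    {u : ℕ → α → F} {u₀ : α → F} (hu : ∀ j, MemLp (u j) 2 m) (hu₀ : MemLp u₀ 2 m)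
    (h : Tendsto (fun j => eLpNorm (u j - u₀) 2 m) atTop (𝓝 0)) :
    Tendsto (fun j => ∫ x, ‖u j x‖ ^ 2 ∂m) atTop (𝓝 (∫ x, ‖u₀ x‖ ^ 2 ∂m)) := by
  have h1 : Tendsto (fun j => (hu j).toLp (u j)) atTop (𝓝 (hu₀.toLp u₀)) :=
    (Lp.tendsto_Lp_iff_tendsto_eLpNorm'' _ _ _ _).2 h
  have e : ∀ {v : α → F} (hv : MemLp v 2 m), ∫ x, ‖v x‖ ^ 2 ∂m = ‖hv.toLp v‖ ^ 2 := by
    intro v hv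
    rw [← integral_sq_eq_norm_sq]
    refine integral_congr_ae ?_
    filter_upwards [hv.coeFn_toLp] with x hx
    rw [hx]
  rw [e hu₀]
  exact (h1.norm.pow 2).congr fun j => (e (hu j)).symm

end Tools

/-! ### Weak gradients as limits of smooth gradients. -/

section Approx

variable {E : Type*} [NormedAddCommGroup E] [InnerProductSpace ℝ E] [FiniteDimensional ℝ E]
  [MeasurableSpace E] [BorelSpace E]

/-- Classical integration by parts passes to the limit. This is the converse of local smooth
approximation, used to recognise the weak derivative of a slice. -/
theorem HasWeakGradient.of_approx {U : Set E} {f : E → ℝ} {G : E → E}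
    (hf : LocallyIntegrableOn f U) (hG : LocallyIntegrableOn G U)
    (h : ∀ K ⊆ U, IsCompact K → ∃ u : ℕ → E → ℝ, (∀ j, ContDiff ℝ ∞ (u j)) ∧
      Tendsto (fun j => eLpNorm (u j - f) 2 (volume.restrict K)) atTop (𝓝 0) ∧
      Tendsto (fun j => eLpNorm (∇ (u j) - G) 2 (volume.restrict K)) atTop (𝓝 0)) :
    HasWeakGradient U f G := by
  refine ⟨hf, hG, fun φ h1 h2 h3 => ?_⟩
  have hK : IsCompact (tsupport φ) := h2
  obtain ⟨u, hu, hu1, hu2⟩ := h _ h3 hK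
  have hfin : IsFiniteMeasure (volume.restrict (tsupport φ)) :=
    ⟨by simpa using hK.measure_lt_top⟩
  have hfK := hf.integrableOn_compact_subset h3 hK
  have hGK := hG.integrableOn_compact_subset h3 hK
  obtain ⟨φ', hφ'⟩ : ∃ C, ∀ x, ‖∇ φ x‖ ≤ C := by
    refine HasCompactSupport.exists_bound_of_continuous ?_ (continuous_gradient h1)
    exact HasCompactSupport.intro h2 fun x hx => gradient_eq_zero_of_notMem_tsupport hx
  obtain ⟨Cφ, hCφ⟩ := h2.exists_bound_of_continuous h1.continuous
  have z : ∀ x, x ∉ tsupport φ → φ x = 0 := fun x hx => image_eq_zero_of_notMem_tsupport hx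
  have z' : ∀ x, x ∉ tsupport φ → ∇ φ x = 0 := fun x hx => gradient_eq_zero_of_notMem_tsupport hx
  have l1 : Tendsto (fun j => ∫ x in tsupport φ, u j x • ∇ φ x) atTop
      (𝓝 (∫ x in tsupport φ, f x • ∇ φ x)) := by
    refine tendsto_integral_of_norm_sub_le
      (fun j => (hu j).continuous.aestronglyMeasurable.sub hfK.1) hu1 (C := φ')
      (fun j => ?_) ?_ fun j => Eventually.of_forall fun x => ?_
    · exact ((hu j).continuous.smul (continuous_gradient h1)).continuousOn.integrableOn_compact hK
    · exact hfK.smul_bdd φ' (continuous_gradient h1).aestronglyMeasurable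
        (Eventually.of_forall hφ')
    · rw [← sub_smul, norm_smul, mul_comm]
      exact mul_le_mul_of_nonneg_right (hφ' x) (norm_nonneg _)
  have l2 : Tendsto (fun j => ∫ x in tsupport φ, φ x • ∇ (u j) x) atTop
      (𝓝 (∫ x in tsupport φ, φ x • G x)) := by
    refine tendsto_integral_of_norm_sub_le
      (fun j => (continuous_gradient (hu j)).aestronglyMeasurable.sub hGK.1) hu2 (C := Cφ)
      (fun j => ?_) ?_ fun j => Eventually.of_forall fun x => ?_
    · exact (h1.continuous.smul (continuous_gradient (hu j))).continuousOn.integrableOn_compact hK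
    · exact hGK.bdd_smul Cφ h1.continuous.aestronglyMeasurable (Eventually.of_forall hCφ)
    · rw [← smul_sub, norm_smul]
      exact mul_le_mul_of_nonneg_right (hCφ x) (norm_nonneg _)
  have e : ∀ j, ∫ x in tsupport φ, u j x • ∇ φ x = - ∫ x in tsupport φ, φ x • ∇ (u j) x := by
    intro j
    rw [setIntegral_eq_integral_of_forall_compl_eq_zero fun x hx => by simp [z' x hx],
      setIntegral_eq_integral_of_forall_compl_eq_zero fun x hx => by simp [z x hx]]
    exact integral_smul_gradient_eq_neg h1 h2 fun x _ => (hu j).contDiffAt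
  have := tendsto_nhds_unique (l1.congr e) l2.neg
  rwa [setIntegral_eq_integral_of_forall_compl_eq_zero fun x hx => by simp [z' x hx],
    setIntegral_eq_integral_of_forall_compl_eq_zero fun x hx => by simp [z x hx]] at this

omit [MeasurableSpace E] [BorelSpace E] in
theorem gradient_comp_smul_right {u : E → ℝ} (hu : Differentiable ℝ u) (θ : E) (r : ℝ) :
    ∇ (fun r : ℝ => u (r • θ)) r = ⟪∇ u (r • θ), θ⟫_ℝ := by
  have h2 : HasDerivAt (fun r : ℝ => r • θ) θ r := by
    simpa using (hasDerivAt_id r).smul_const θ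
  rw [gradient_eq_deriv', inner_gradient_left]
  exact ((hu (r • θ)).hasFDerivAt.comp_hasDerivAt r h2).deriv

end Approx

/-! ### Restriction of Sobolev functions to rays. -/

namespace PolarFactorization

variable {E : Type*} [NormedAddCommGroup E] [InnerProductSpace ℝ E] [FiniteDimensional ℝ E]
  [MeasurableSpace E] [BorelSpace E] [Nontrivial E] {μ : Measure E} {ν : Measure ℝ}
  [IsProbabilityMeasure ν] {σ : E → ℝ} {s : ℝ → ℝ}

/-- Polar coordinates carry the product law to `μ`, whose density is bounded on compact sets; local
Lebesgue convergence thus becomes convergence on the product. -/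
theorem exists_map_polar_le (h : PolarFactorization μ ν σ s) {I : Set ℝ} (hI : IsCompact I) :
    ∃ C : ℝ≥0∞, C ≠ ⊤ ∧ ((sphereLaw E).prod (ν.restrict I)).map polarMap ≤
        C • volume.restrict ((fun x : E => ‖x‖) ⁻¹' I) := by
  obtain ⟨C, hC, h1⟩ := h.full.exists_restrict_le_volume (hI.preimage_norm (E := E))
    (subset_univ _)
  refine ⟨C, hC, le_of_eq_of_le ?_ h1⟩
  have hm : MeasurableSet ((fun x : E => ‖x‖) ⁻¹' I) := measurable_norm hI.measurableSet
  have h2 : (sphereLaw E).prod (ν.restrict I) =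
      ((sphereLaw E).prod ν).restrict (polarMap ⁻¹' ((fun x : E => ‖x‖) ⁻¹' I)) := by
    have := Measure.prod_restrict (μ := sphereLaw E) (ν := ν) univ I
    rw [Measure.restrict_univ] at this
    rw [this]
    refine Measure.restrict_congr_set ?_
    filter_upwards [ae_norm_polarMap (E := E) h.ae_pos] with z hz
    refine propext ?_
    change z ∈ univ ×ˢ I ↔ ‖polarMap z‖ ∈ I
    simp [hz.2]
  rw [h2, ← Measure.restrict_map h.polar.measurable hm, h.polar.map_eq]

/-- Smooth approximation of a Sobolev function on an annulus, in polar coordinates. -/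
theorem exists_smooth_approx_polar (h : PolarFactorization μ ν σ s) {f : E → ℝ} {G : E → E}
    (hf : MemLp f 2 μ) (hG : HasWeakGradient univ f G) (hσG : MemLp (fun x => σ x • G x) 2 μ)
    {I : Set ℝ} (hI : IsCompact I) : ∃ u : ℕ → E → ℝ, (∀ j, ContDiff ℝ ∞ (u j)) ∧
      (∀ j, AEStronglyMeasurable (fun z => u j (polarMap z) - f (polarMap z))
        ((sphereLaw E).prod (ν.restrict I))) ∧
      (∀ j, AEStronglyMeasurable (fun z => ∇ (u j) (polarMap z) - G (polarMap z))
        ((sphereLaw E).prod (ν.restrict I))) ∧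
      Tendsto (fun j => eLpNorm (fun z => u j (polarMap z) - f (polarMap z)) 2
        ((sphereLaw E).prod (ν.restrict I))) atTop (𝓝 0) ∧
      Tendsto (fun j => eLpNorm (fun z => ∇ (u j) (polarMap z) - G (polarMap z)) 2
        ((sphereLaw E).prod (ν.restrict I))) atTop (𝓝 0) := by
  have hA := hI.preimage_norm (E := E)
  have hfK := h.full.memLp_restrict hf hA (subset_univ _)
  have hGK := h.full.memLp_restrict_gradient hσG hA (subset_univ _)
  obtain ⟨u, hu, hu1, hu2, -⟩ := hG.exists_smooth_approx isOpen_univ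
    (fun K hK hKc => h.full.memLp_restrict hf hKc hK)
    (fun K hK hKc => h.full.memLp_restrict_gradient hσG hKc hK) hA (subset_univ _)
  obtain ⟨C, hC, hle⟩ := h.exists_map_polar_le hI
  have hac : ((sphereLaw E).prod (ν.restrict I)).map polarMap ≪
      volume.restrict ((fun x : E => ‖x‖) ⁻¹' I) :=
    (Measure.absolutelyContinuous_of_le hle).trans (Measure.smul_absolutelyContinuous)
  have m1 : ∀ j, AEStronglyMeasurable (u j - f)
      (((sphereLaw E).prod (ν.restrict I)).map polarMap) := fun j =>
    ((hu j).continuous.aestronglyMeasurable.sub hfK.1).mono_ac hac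
  have m2 : ∀ j, AEStronglyMeasurable (∇ (u j) - G)
      (((sphereLaw E).prod (ν.restrict I)).map polarMap) := fun j =>
    ((continuous_gradient (hu j)).aestronglyMeasurable.sub hGK.1).mono_ac hac
  refine ⟨u, hu, fun j => (m1 j).comp_measurable measurable_polarMap,
    fun j => (m2 j).comp_measurable measurable_polarMap, ?_, ?_⟩
  · refine (tendsto_eLpNorm_of_measure_le_smul hC hle hu1).congr fun j => ?_
    rw [eLpNorm_map_measure (m1 j) measurable_polarMap.aemeasurable]
    rfl
  · refine (tendsto_eLpNorm_of_measure_le_smul hC hle hu2).congr fun j => ?_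
    rw [eLpNorm_map_measure (m2 j) measurable_polarMap.aemeasurable]
    rfl

omit [Nontrivial E] [IsProbabilityMeasure ν] in
theorem memLp_polar (h : PolarFactorization μ ν σ s) {F : Type*} [NormedAddCommGroup F]
    {u : E → F} (hu : MemLp u 2 μ) :
    MemLp (fun z => u (polarMap z)) 2 ((sphereLaw E).prod ν) :=
  hu.comp_measurePreserving h.polar

theorem ae_memLp_slice {α β F : Type*} [MeasurableSpace α] [MeasurableSpace β]
    [NormedAddCommGroup F] {m : Measure α} {m' : Measure β} [SFinite m] [SFinite m']
    {u : α × β → F} (hu : MemLp u 2 (m.prod m')) :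
    ∀ᵐ a ∂m, MemLp (fun b => u (a, b)) 2 m' := by
  have h1 : Integrable (fun z => ‖u z‖ ^ 2) (m.prod m') := hu.norm.integrable_sq
  filter_upwards [hu.1.prodMk_left, h1.prod_right_ae] with a ha hi
  exact (memLp_two_iff_integrable_sq_norm ha).2 hi

/-- The radial part of `σ G`. -/
theorem memLp_radial (h : PolarFactorization μ ν σ s) {G : E → E}
    (hσG : MemLp (fun x => σ x • G x) 2 μ) :
    MemLp (fun z : Metric.sphere (0 : E) 1 × ℝ => s z.2 • ⟪G (polarMap z), z.1⟫_ℝ) 2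
      ((sphereLaw E).prod ν) := by
  have h1 := h.memLp_polar hσG
  have h2 : MemLp (fun z : Metric.sphere (0 : E) 1 × ℝ =>
      ⟪σ (polarMap z) • G (polarMap z), (z.1 : E)⟫_ℝ) 2 ((sphereLaw E).prod ν) := by
    have hm : AEStronglyMeasurable (fun z : Metric.sphere (0 : E) 1 × ℝ => (z.1 : E))
        ((sphereLaw E).prod ν) :=
      (continuous_subtype_val.comp continuous_fst).aestronglyMeasurable
    refine h1.of_le (h1.1.inner hm) (Eventually.of_forall fun z => ?_)
    have := norm_inner_le_norm (𝕜 := ℝ) (σ (polarMap z) • G (polarMap z)) (z.1 : E)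
    simpa using this
  refine h2.ae_eq ?_
  filter_upwards [ae_norm_polarMap (E := E) h.ae_pos] with z hz
  rw [h.weight, hz.2, real_inner_smul_left, smul_eq_mul]

/-- Almost every radial slice of a Sobolev function is a Sobolev function. -/
theorem ae_hasWeakGradient_slice (h : PolarFactorization μ ν σ s) {f : E → ℝ} {G : E → E}
    (hf : MemLp f 2 μ) (hG : HasWeakGradient univ f G) (hσG : MemLp (fun x => σ x • G x) 2 μ) :
    ∀ᵐ θ : Metric.sphere (0 : E) 1 ∂(sphereLaw E), HasWeakGradient (Ioi 0)
      (fun r => f (polarMap (θ, r))) (fun r => ⟪G (polarMap (θ, r)), θ⟫_ℝ) := by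
  -- Each annulus gets its own approximating sequence and its own exceptional null set of
  -- directions; countably many annuli keep the union null.
  have happ : ∀ k : ℕ, ∀ᵐ θ : Metric.sphere (0 : E) 1 ∂(sphereLaw E),
      ∃ u : ℕ → ℝ → ℝ, (∀ j, ContDiff ℝ ∞ (u j)) ∧
        Tendsto (fun j => eLpNorm (u j - fun r => f (polarMap (θ, r))) 2
          (ν.restrict (Icc (1 / ((k : ℝ) + 1)) (k + 1)))) atTop (𝓝 0) ∧
        Tendsto (fun j => eLpNorm (∇ (u j) - fun r => ⟪G (polarMap (θ, r)), θ⟫_ℝ) 2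
          (ν.restrict (Icc (1 / ((k : ℝ) + 1)) (k + 1)))) atTop (𝓝 0) := by
    intro k
    obtain ⟨u, hu, m1, m2, l1, l2⟩ := h.exists_smooth_approx_polar hf hG hσG
      (isCompact_Icc (a := 1 / ((k : ℝ) + 1)) (b := k + 1))
    obtain ⟨φ, hφ⟩ := exists_seq_ae_tendsto_eLpNorm_slice m1 m2 l1 l2
    filter_upwards [hφ] with θ hθ
    have hc : ContDiff ℝ ∞ fun r : ℝ => r • (θ : E) := contDiff_id.smul contDiff_const
    refine ⟨fun j r => u (φ j) (polarMap (θ, r)), fun j => (hu _).comp hc, hθ.1, ?_⟩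
    refine tendsto_of_tendsto_of_tendsto_of_le_of_le tendsto_const_nhds hθ.2 (fun _ => zero_le)
      fun j => ?_
    refine eLpNorm_mono fun r => ?_
    -- Along a ray the derivative is the radial component of the gradient, so its error is at most
    -- that of the full gradient.
    have e : ∇ (fun r => u (φ j) (polarMap (θ, r))) r = ⟪∇ (u (φ j)) (polarMap (θ, r)), θ⟫_ℝ :=
      gradient_comp_smul_right ((hu (φ j)).differentiable (by simp)) (θ : E) r
    rw [Pi.sub_apply, e, ← inner_sub_left]
    have := norm_inner_le_norm (𝕜 := ℝ) (∇ (u (φ j)) (polarMap (θ, r)) - G (polarMap (θ, r)))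
      (θ : E)
    simpa using this
  filter_upwards [ae_memLp_slice (h.memLp_polar hf), ae_memLp_slice (h.memLp_radial hσG),
    ae_all_iff.2 happ] with θ hfθ hGθ hθ
  have k1 : ∀ K ⊆ Ioi (0 : ℝ), IsCompact K →
      MemLp (fun r => f (polarMap (θ, r))) 2 (volume.restrict K) := fun K hKU hK =>
    h.radial.memLp_restrict hfθ hK hKU
  have k2 : ∀ K ⊆ Ioi (0 : ℝ), IsCompact K →
      MemLp (fun r => ⟪G (polarMap (θ, r)), θ⟫_ℝ) 2 (volume.restrict K) := fun K hKU hK =>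
    h.radial.memLp_restrict_gradient hGθ hK hKU
  refine HasWeakGradient.of_approx (h.radial.locallyIntegrableOn k1)
    (h.radial.locallyIntegrableOn k2) fun K hKU hK => ?_
  obtain ⟨a, ha, haK⟩ := hK.exists_forall_le' continuousOn_id (a := 0) fun r hr => hKU hr
  obtain ⟨b, hb⟩ := hK.bddAbove
  obtain ⟨k, hk⟩ := exists_nat_ge (max b (1 / a))
  have hk1 := (le_max_left _ _).trans hk
  have hk2 := (le_max_right _ _).trans hk
  have hKI : K ⊆ Icc (1 / ((k : ℝ) + 1)) (k + 1) := fun r hr => by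
    refine ⟨le_trans ?_ (haK r hr), (hb hr).trans (by linarith)⟩
    rw [one_div_le (by positivity) ha]
    linarith
  obtain ⟨u, hu, hu1, hu2⟩ := hθ k
  obtain ⟨C, hC, hle⟩ := h.radial.exists_volume_restrict_le hK hKU
  have hle' : volume.restrict K ≤ C • ν.restrict (Icc (1 / ((k : ℝ) + 1)) (k + 1)) := by
    have := Measure.restrict_mono (le_refl K) hle
    rw [Measure.restrict_restrict hK.measurableSet, inter_self, Measure.restrict_smul] at this
    refine this.trans ?_
    have := Measure.restrict_mono (μ := ν) hKI le_rfl
    gcongr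
  exact ⟨u, hu, tendsto_eLpNorm_of_measure_le_smul hC hle' hu1,
    tendsto_eLpNorm_of_measure_le_smul hC hle' hu2⟩

/-- The radial Poincaré inequality, integrated over the sphere. -/
theorem mul_integral_slice_variance_le [IsProbabilityMeasure μ] (h : PolarFactorization μ ν σ s)
    {l : ℝ} (hP : PoincareInequality (Ioi 0) ν s l) {f : E → ℝ} {G : E → E}
    (hf : MemLp f 2 μ) (hG : HasWeakGradient univ f G) (hσG : MemLp (fun x => σ x • G x) 2 μ)
    (hF : MemLp (fun θ : Metric.sphere (0 : E) 1 => ∫ r, f (polarMap (θ, r)) ∂ν) 2 (sphereLaw E)) :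
    l * (∫ x, f x ^ 2 ∂μ - ∫ θ, (∫ r, f (polarMap (θ, r)) ∂ν) ^ 2 ∂(sphereLaw E)) ≤
      ∫ z : Metric.sphere (0 : E) 1 × ℝ, s z.2 ^ 2 * ⟪G (polarMap z), z.1⟫_ℝ ^ 2
        ∂((sphereLaw E).prod ν) := by
  have hf2 := (h.memLp_polar hf).integrable_sq
  have hr := h.memLp_radial hσG
  have hG2 : Integrable (fun z : Metric.sphere (0 : E) 1 × ℝ =>
      s z.2 ^ 2 * ⟪G (polarMap z), z.1⟫_ℝ ^ 2) ((sphereLaw E).prod ν) := by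
    refine hr.integrable_sq.congr (Eventually.of_forall fun z => ?_)
    simp [mul_pow]
  rw [h.polar.integral_map_eq (g := fun x => f x ^ 2) (hf.1.pow 2), integral_prod _ hf2,
    integral_prod _ hG2, ← integral_sub hf2.integral_prod_left hF.integrable_sq,
    ← integral_const_mul]
  refine integral_mono_ae ((hf2.integral_prod_left.sub hF.integrable_sq).const_mul l)
    hG2.integral_prod_left ?_
  -- For fixed `θ` the integrand is the variance of the slice, and the one-dimensional Poincaré
  -- inequality applies to it.
  filter_upwards [h.ae_hasWeakGradient_slice hf hG hσG, ae_memLp_slice (h.memLp_polar hf),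
    ae_memLp_slice hr] with θ h1 h2 h3
  refine (hP _ _ h2 h1 h3).trans_eq ?_
  refine integral_congr_ae (Eventually.of_forall fun r => ?_)
  simp

end PolarFactorization

end


noncomputable section

/-! ### Partial averages in a product space. -/

section Tools

variable {α β : Type*} [MeasurableSpace α] [MeasurableSpace β] {m : Measure α} {m' : Measure β}

/-- Cauchy–Schwarz on each slice; total mass at most one makes partial averaging a contraction,
including over a piece of a probability measure. -/
theorem eLpNorm_integral_prod_le [SFinite m] [SFinite m'] (hm' : m' univ ≤ 1) {w : α × β → ℝ}
    (hw : AEStronglyMeasurable w (m.prod m')) :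
    eLpNorm (fun a => ∫ b, w (a, b) ∂m') 2 m ≤ eLpNorm w 2 (m.prod m') := by
  refine (ENNReal.pow_le_pow_left_iff two_ne_zero).1 ?_
  rw [eLpNorm_two_sq, eLpNorm_two_sq, lintegral_prod _ (hw.enorm.pow_const 2)]
  refine lintegral_mono_ae ?_
  filter_upwards [hw.prodMk_left] with a ha
  calc ‖∫ b, w (a, b) ∂m'‖ₑ ^ 2 ≤ (∫⁻ b, ‖w (a, b)‖ₑ ∂m') ^ 2 := by
        gcongr; exact enorm_integral_le_lintegral_enorm _
    _ ≤ m' univ * ∫⁻ b, ‖w (a, b)‖ₑ ^ 2 ∂m' := lintegral_sq_le_measure_mul ha.enorm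
    _ ≤ ∫⁻ b, ‖w (a, b)‖ₑ ^ 2 ∂m' := mul_le_of_le_one_left zero_le hm'

theorem memLp_integral_prod [SFinite m] [SFinite m'] (hm' : m' univ ≤ 1) {w : α × β → ℝ}
    (hw : MemLp w 2 (m.prod m')) : MemLp (fun a => ∫ b, w (a, b) ∂m') 2 m :=
  ⟨hw.1.integral_prod_right', (eLpNorm_integral_prod_le hm' hw.1).trans_lt hw.2⟩

theorem tendsto_eLpNorm_integral_prod [IsFiniteMeasure m] [IsFiniteMeasure m'] (hm' : m' univ ≤ 1)
    {w : ℕ → α × β → ℝ} {w₀ : α × β → ℝ} (hw : ∀ j, MemLp (w j) 2 (m.prod m'))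
    (hw₀ : MemLp w₀ 2 (m.prod m'))
    (h : Tendsto (fun j => eLpNorm (fun z => w j z - w₀ z) 2 (m.prod m')) atTop (𝓝 0)) :
    Tendsto (fun j => eLpNorm ((fun a => ∫ b, w j (a, b) ∂m') - fun a => ∫ b, w₀ (a, b) ∂m') 2 m)
      atTop (𝓝 0) := by
  refine tendsto_of_tendsto_of_tendsto_of_le_of_le tendsto_const_nhds h (fun _ => zero_le)
    fun j => ?_
  refine le_of_eq_of_le (eLpNorm_congr_ae ?_)
    (eLpNorm_integral_prod_le (w := fun z => w j z - w₀ z) hm' ((hw j).1.sub hw₀.1))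
  filter_upwards [((hw j).integrable (by norm_num)).prod_right_ae,
    (hw₀.integrable (by norm_num)).prod_right_ae] with a h1 h2
  exact (integral_sub h1 h2).symm

/-- The variance is continuous on `L²`. -/
theorem tendsto_integral_sub_integral_sq [IsProbabilityMeasure m] {u : ℕ → α → ℝ} {u₀ : α → ℝ}
    (hu : ∀ j, MemLp (u j) 2 m) (hu₀ : MemLp u₀ 2 m)
    (h : Tendsto (fun j => eLpNorm (u j - u₀) 2 m) atTop (𝓝 0)) :
    Tendsto (fun j => ∫ x, (u j x - ∫ y, u j y ∂m) ^ 2 ∂m) atTop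
      (𝓝 (∫ x, (u₀ x - ∫ y, u₀ y ∂m) ^ 2 ∂m)) := by
  have h1 := tendsto_integral_norm_sq hu hu₀ h
  have h2 : Tendsto (fun j => ∫ x, u j x ∂m) atTop (𝓝 (∫ x, u₀ x ∂m)) :=
    tendsto_integral_of_norm_sub_le (fun j => (hu j).1.sub hu₀.1) h (C := 1)
      (fun j => (hu j).integrable (by norm_num)) (hu₀.integrable (by norm_num))
      fun j => Eventually.of_forall fun x => by simp
  simp only [Real.norm_eq_abs, sq_abs] at h1
  rw [integral_sub_integral_sq hu₀]
  exact (h1.sub (h2.pow 2)).congr fun j => (integral_sub_integral_sq (hu j)).symm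

end Tools

/-! ### The tangential projection. -/

section Tangential

variable {E : Type*} [NormedAddCommGroup E] [InnerProductSpace ℝ E]

/-- The component of `y` orthogonal to the unit vector `θ`. -/
def tangential (θ y : E) : E := y - ⟪θ, y⟫_ℝ • θ

theorem tangential_sub (θ y z : E) : tangential θ (y - z) = tangential θ y - tangential θ z := by
  simp only [tangential, inner_sub_right, sub_smul]
  abel

theorem inner_tangential_left (θ y v : E) :
    ⟪tangential θ y, v⟫_ℝ = ⟪y, tangential θ v⟫_ℝ := by
  simp only [tangential, inner_sub_left, inner_sub_right, real_inner_smul_left,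
    real_inner_smul_right, real_inner_comm θ y]
  ring

theorem norm_tangential_sq {θ : E} (hθ : ‖θ‖ = 1) (y : E) :
    ‖tangential θ y‖ ^ 2 = ‖y‖ ^ 2 - ⟪y, θ⟫_ℝ ^ 2 := by
  rw [tangential, norm_sub_sq_real, norm_smul, real_inner_smul_right, hθ, real_inner_comm θ y,
    Real.norm_eq_abs, mul_one, sq_abs]
  ring

theorem norm_tangential_le {θ : E} (hθ : ‖θ‖ = 1) (y : E) : ‖tangential θ y‖ ≤ ‖y‖ := by
  refine le_of_sq_le_sq ?_ (norm_nonneg y)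
  rw [norm_tangential_sq hθ]
  linarith [sq_nonneg ⟪y, θ⟫_ℝ]

/-- At a unit vector the derivative of the radial retraction onto the sphere is the projection onto
the tangent space. -/
theorem hasFDerivAt_inv_norm_smul {θ : E} (hθ : ‖θ‖ = 1) :
    ∃ L : E →L[ℝ] E, (∀ v, L v = tangential θ v) ∧
      HasFDerivAt (fun x : E => ‖x‖⁻¹ • x) L θ := by
  have h0 : θ ≠ 0 := norm_ne_zero_iff.1 (by rw [hθ]; exact one_ne_zero)
  have h1 : HasDerivAt (fun r : ℝ => r⁻¹) (-(‖θ‖ ^ 2)⁻¹) ‖θ‖ :=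
    hasDerivAt_inv (norm_ne_zero_iff.2 h0)
  refine ⟨_, fun v => ?_, (hasFDerivAt_radial h0 h1).smul (hasFDerivAt_id θ)⟩
  simp [hθ, tangential]
  abel

end Tangential

/-! ### Differentiating averages along rays. -/

section SphericalAverage

variable {E : Type*} [NormedAddCommGroup E] [InnerProductSpace ℝ E] [FiniteDimensional ℝ E]
  {m : Measure ℝ} [IsFiniteMeasure m] {I : Set ℝ}

/-- Differentiation under the integral sign; radii confined to a compact set make the derivatives
uniformly bounded near `y`. -/
theorem hasFDerivAt_integral_smul (hI : IsCompact I) (hm : ∀ᵐ r ∂m, r ∈ I) {u : E → ℝ}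
    (hu : ContDiff ℝ ∞ u) (y : E) :
    Integrable (fun r => r • fderiv ℝ u (r • y)) m ∧
    HasFDerivAt (fun y => ∫ r, u (r • y) ∂m) (∫ r, r • fderiv ℝ u (r • y) ∂m) y := by
  have hd : Continuous (fderiv ℝ u) := hu.continuous_fderiv (by simp)
  obtain ⟨C, hC⟩ := (hI.prod (isCompact_closedBall y 1)).exists_bound_of_continuousOn
    (f := fun z : ℝ × E => z.1 • fderiv ℝ u (z.1 • z.2)) (by fun_prop)
  obtain ⟨B, hB⟩ := hI.exists_bound_of_continuousOn (f := fun r : ℝ => u (r • y))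
    (hu.continuous.comp (by fun_prop)).continuousOn
  have hmeas : ∀ y, AEStronglyMeasurable (fun r : ℝ => u (r • y)) m := fun y =>
    (hu.continuous.comp (by fun_prop)).aestronglyMeasurable
  have hmeas' : AEStronglyMeasurable (fun r : ℝ => r • fderiv ℝ u (r • y)) m :=
    Continuous.aestronglyMeasurable (by fun_prop)
  have hb : ∀ᵐ r ∂m, ∀ x ∈ Metric.closedBall y 1, ‖r • fderiv ℝ u (r • x)‖ ≤ C := by
    filter_upwards [hm] with r hr x hx
    exact hC (r, x) ⟨hr, hx⟩
  refine ⟨Integrable.of_bound hmeas' C ?_, ?_⟩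
  · filter_upwards [hb] with r hr
    exact hr y (Metric.mem_closedBall_self zero_le_one)
  refine hasFDerivAt_integral_of_dominated_of_fderiv_le (bound := fun _ => C)
    (F := fun y r => u (r • y)) (F' := fun y r => r • fderiv ℝ u (r • y))
    (Metric.closedBall_mem_nhds y one_pos) (Eventually.of_forall hmeas) ?_ hmeas' hb
    (integrable_const _) (Eventually.of_forall fun r x _ => ?_)
  · exact Integrable.of_bound (hmeas y) B (by filter_upwards [hm] with r hr using hB r hr)
  · have h1 : HasFDerivAt (fun x : E => r • x) (r • ContinuousLinearMap.id ℝ E) x :=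
      (hasFDerivAt_id x).const_smul r
    have h2 := ((hu.differentiable (by simp) (r • x)).hasFDerivAt).comp x h1
    refine h2.congr_fderiv ?_
    ext v
    simp

/-- The chain rule through `x / ‖x‖` keeps only tangential derivatives, and dilation by `r`
contributes the factor `r`; this is the source of `‖x‖²` in the lower bound. -/
theorem norm_gradient_integral_le (hI : IsCompact I) (hI0 : I ⊆ Ioi 0) (hm : ∀ᵐ r ∂m, r ∈ I)
    {u : E → ℝ} (hu : ContDiff ℝ ∞ u) {θ : E} (hθ : ‖θ‖ = 1) :
    ‖∇ (fun x => ∫ r, u (r • (‖x‖⁻¹ • x)) ∂m) θ‖ ≤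
      ∫ r, r * ‖tangential θ (∇ u (r • θ))‖ ∂m := by
  obtain ⟨L, hL, hN⟩ := hasFDerivAt_inv_norm_smul hθ
  obtain ⟨hi, hΦ⟩ := hasFDerivAt_integral_smul hI hm hu θ
  have hN' : ‖θ‖⁻¹ • θ = θ := by simp [hθ]
  have h1 : HasFDerivAt (fun x => ∫ r, u (r • (‖x‖⁻¹ • x)) ∂m)
      ((∫ r, r • fderiv ℝ u (r • θ) ∂m).comp L) θ :=
    HasFDerivAt.comp (g := fun y => ∫ r, u (r • y) ∂m) θ (by rw [hN']; exact hΦ) hN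
  have hgc : Continuous (∇ u) := (InnerProductSpace.toDual ℝ E).symm.continuous.comp
    (hu.continuous_fderiv (by simp))
  have hc : Continuous fun r : ℝ => r * ‖tangential θ (∇ u (r • θ))‖ := by
    unfold tangential
    fun_prop
  obtain ⟨B, hB⟩ := hI.exists_bound_of_continuousOn hc.continuousOn
  have hi2 : Integrable (fun r : ℝ => r * ‖tangential θ (∇ u (r • θ))‖) m :=
    Integrable.of_bound hc.aestronglyMeasurable B (by filter_upwards [hm] with r hr using hB r hr)
  have h0 : 0 ≤ ∫ r, r * ‖tangential θ (∇ u (r • θ))‖ ∂m := by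
    refine integral_nonneg_of_ae ?_
    filter_upwards [hm] with r hr
    exact mul_nonneg (le_of_lt (hI0 hr)) (norm_nonneg _)
  rw [norm_gradient, h1.fderiv]
  refine ContinuousLinearMap.opNorm_le_bound _ h0 fun v => ?_
  rw [ContinuousLinearMap.comp_apply, ContinuousLinearMap.integral_apply hi, hL]
  have e : ∀ r : ℝ, (r • fderiv ℝ u (r • θ)) (tangential θ v) =
      r * ⟪tangential θ (∇ u (r • θ)), v⟫_ℝ := by
    intro r
    rw [inner_tangential_left, inner_gradient_left]
    rfl
  simp_rw [e]
  rw [← integral_mul_const]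
  refine norm_integral_le_of_norm_le (hi2.mul_const _) ?_
  filter_upwards [hm] with r hr
  have hr0 : 0 < r := hI0 hr
  rw [norm_mul, Real.norm_of_nonneg hr0.le, mul_assoc]
  exact mul_le_mul_of_nonneg_left (norm_inner_le_norm _ _) hr0.le

theorem differentiableAt_integral_radial (hI : IsCompact I) (hm : ∀ᵐ r ∂m, r ∈ I) {u : E → ℝ}
    (hu : ContDiff ℝ ∞ u) {x : E} (hx : x ≠ 0) :
    DifferentiableAt ℝ (fun x => ∫ r, u (r • (‖x‖⁻¹ • x)) ∂m) x := by
  have h1 : DifferentiableAt ℝ (fun x : E => ‖x‖⁻¹ • x) x :=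
    ((differentiableAt_id.norm ℝ hx).inv (norm_ne_zero_iff.2 hx)).smul differentiableAt_id
  exact DifferentiableAt.comp (g := fun y => ∫ r, u (r • y) ∂m) x
    ((hasFDerivAt_integral_smul hI hm hu _).2.differentiableAt) h1

end SphericalAverage

end


noncomputable section

/-! ### Lower bound: angular averages and decomposition of variance. -/

section LowerBound

namespace PolarFactorization

variable {n : ℕ} [NeZero n] {μ : Measure (EuclideanSpace ℝ (Fin n))} {ν : Measure ℝ}
  [IsProbabilityMeasure ν] {σ : EuclideanSpace ℝ (Fin n) → ℝ} {s : ℝ → ℝ}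

omit [NeZero n] in
theorem norm_sphere (θ : Metric.sphere (0 : EuclideanSpace ℝ (Fin n)) 1) :
    ‖(θ : EuclideanSpace ℝ (Fin n))‖ = 1 := by simp

/-- The weighted tangential part of a continuous vector field is square integrable on annuli. -/
theorem memLp_tangential_of_continuous (h : PolarFactorization μ ν σ s) {I : Set ℝ}
    (hI : IsCompact I) (hI0 : I ⊆ Ioi 0)
    {X : EuclideanSpace ℝ (Fin n) → EuclideanSpace ℝ (Fin n)} (hX : Continuous X) :
    MemLp (fun z : Metric.sphere (0 : EuclideanSpace ℝ (Fin n)) 1 × ℝ =>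
      s z.2 • tangential (z.1 : EuclideanSpace ℝ (Fin n)) (X (polarMap z))) 2
      ((sphereLaw (EuclideanSpace ℝ (Fin n))).prod (ν.restrict I)) := by
  have hsI : ContinuousOn s I := h.radial.continuousOn.mono hI0
  have hc : Continuous fun z : Metric.sphere (0 : EuclideanSpace ℝ (Fin n)) 1 × ℝ =>
      tangential (z.1 : EuclideanSpace ℝ (Fin n)) (X (polarMap z)) := by
    unfold tangential polarMap
    fun_prop
  obtain ⟨C, hC⟩ := ((isCompact_univ (X := Metric.sphere (0 : EuclideanSpace ℝ (Fin n)) 1)).prod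
    hI).exists_bound_of_continuousOn (f := fun z => s z.2 •
      tangential (z.1 : EuclideanSpace ℝ (Fin n)) (X (polarMap z)))
    ((hsI.comp continuousOn_snd fun z hz => hz.2).smul hc.continuousOn)
  have hm : AEStronglyMeasurable s (ν.restrict I) := hsI.aestronglyMeasurable hI.measurableSet
  refine MemLp.of_bound ((hm.comp_snd).smul hc.aestronglyMeasurable) C ?_
  have : ∀ᵐ z ∂((sphereLaw (EuclideanSpace ℝ (Fin n))).prod (ν.restrict I)), z.2 ∈ I :=
    Measure.quasiMeasurePreserving_snd.ae (ae_restrict_mem hI.measurableSet)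
  filter_upwards [this] with z hz
  exact hC z ⟨mem_univ _, hz⟩

theorem memLp_tangential (h : PolarFactorization μ ν σ s)
    {G : EuclideanSpace ℝ (Fin n) → EuclideanSpace ℝ (Fin n)}
    (hσG : MemLp (fun x => σ x • G x) 2 μ) :
    MemLp (fun z : Metric.sphere (0 : EuclideanSpace ℝ (Fin n)) 1 × ℝ =>
      s z.2 • tangential (z.1 : EuclideanSpace ℝ (Fin n)) (G (polarMap z))) 2
      ((sphereLaw (EuclideanSpace ℝ (Fin n))).prod ν) := by
  have h1 := h.memLp_polar hσG
  have hm : AEStronglyMeasurable (fun z : Metric.sphere (0 : EuclideanSpace ℝ (Fin n)) 1 × ℝ =>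
      (z.1 : EuclideanSpace ℝ (Fin n))) ((sphereLaw (EuclideanSpace ℝ (Fin n))).prod ν) :=
    (continuous_subtype_val.comp continuous_fst).aestronglyMeasurable
  have h2 : MemLp (fun z : Metric.sphere (0 : EuclideanSpace ℝ (Fin n)) 1 × ℝ =>
      tangential (z.1 : EuclideanSpace ℝ (Fin n)) (σ (polarMap z) • G (polarMap z))) 2
      ((sphereLaw (EuclideanSpace ℝ (Fin n))).prod ν) :=
    h1.of_le (h1.1.sub ((hm.inner (𝕜 := ℝ) h1.1).smul hm))
      (Eventually.of_forall fun z => norm_tangential_le (norm_sphere z.1) _)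
  refine h2.ae_eq ?_
  filter_upwards [ae_norm_polarMap (E := EuclideanSpace ℝ (Fin n)) h.ae_pos] with z hz
  rw [h.weight, hz.2, tangential, tangential, real_inner_smul_right, smul_sub, mul_smul]

/-- The spherical Poincaré inequality for the angular average of a smooth function. -/
theorem variance_angular_le_of_smooth (h : PolarFactorization μ ν σ s)
    (hM : MemLp (fun r => r / s r) 2 ν) {I : Set ℝ} (hI : IsCompact I) (hI0 : I ⊆ Ioi 0)
    {u : EuclideanSpace ℝ (Fin n) → ℝ} (hu : ContDiff ℝ ∞ u) :
    ((n : ℝ) - 1) * ∫ θ, ((∫ r in I, u (polarMap (θ, r)) ∂ν) -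
        ∫ η, (∫ r in I, u (polarMap (η, r)) ∂ν) ∂(sphereLaw (EuclideanSpace ℝ (Fin n)))) ^ 2
        ∂(sphereLaw (EuclideanSpace ℝ (Fin n))) ≤
      (∫ r, (r / s r) ^ 2 ∂ν) *
      ∫ z : Metric.sphere (0 : EuclideanSpace ℝ (Fin n)) 1 × ℝ,
        ‖s z.2 • tangential (z.1 : EuclideanSpace ℝ (Fin n)) (∇ u (polarMap z))‖ ^ 2
        ∂((sphereLaw (EuclideanSpace ℝ (Fin n))).prod (ν.restrict I)) := by
  set m := ν.restrict I with hm
  have hmI : ∀ᵐ r ∂m, r ∈ I := ae_restrict_mem hI.measurableSet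
  -- The angular average, extended to be homogeneous of degree zero as the spherical inequality
  -- requires.
  set F : EuclideanSpace ℝ (Fin n) → ℝ := fun x => ∫ r, u (r • (‖x‖⁻¹ • x)) ∂m with hF
  have hgc := continuous_gradient hu
  have hFθ : ∀ θ : Metric.sphere (0 : EuclideanSpace ℝ (Fin n)) 1,
      F θ = ∫ r, u (polarMap (θ, r)) ∂m := fun θ => by simp [hF, polarMap]
  have hhom : ∀ r : ℝ, 0 < r → ∀ x, F (r • x) = F x := by
    intro r hr x
    have : ‖r • x‖⁻¹ • (r • x) = ‖x‖⁻¹ • x := by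
      rw [norm_smul, Real.norm_of_nonneg hr.le, smul_smul, mul_inv, mul_assoc, mul_comm,
        mul_assoc, mul_inv_cancel₀ hr.ne', mul_one]
    simp only [hF, this]
  obtain ⟨B, hB⟩ := (hI.prod (isCompact_closedBall (0 : EuclideanSpace ℝ (Fin n)) 1)
    ).exists_bound_of_continuousOn
    (f := fun z : ℝ × EuclideanSpace ℝ (Fin n) => u (z.1 • z.2))
    (hu.continuous.comp (by fun_prop)).continuousOn
  obtain ⟨B', hB'⟩ := ((isCompact_univ (X := Metric.sphere (0 : EuclideanSpace ℝ (Fin n)) 1)).prod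
    hI).exists_bound_of_continuousOn (f := fun z => z.2 *
      ‖tangential (z.1 : EuclideanSpace ℝ (Fin n)) (∇ u (polarMap z))‖)
    (Continuous.continuousOn (by unfold tangential polarMap; fun_prop))
  have hbnd : ∀ {g : ℝ → ℝ} {C : ℝ}, (∀ r ∈ I, ‖g r‖ ≤ C) → ‖∫ r, g r ∂m‖ ≤ |C| := by
    intro g C hg
    refine (norm_integral_le_of_norm_le_const (C := |C|) ?_).trans ?_
    · filter_upwards [hmI] with r hr
      exact (hg r hr).trans (le_abs_self C)
    · refine mul_le_of_le_one_right (abs_nonneg C) ?_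
      have : m univ ≤ 1 := (Measure.restrict_le_self _).trans prob_le_one
      exact ENNReal.toReal_mono ENNReal.one_ne_top this
  have hFB : ∀ x, |F x| ≤ |B| := by
    intro x
    refine hbnd fun r hr => hB (r, ‖x‖⁻¹ • x) ⟨hr, ?_⟩
    rw [mem_closedBall_zero_iff, norm_smul, norm_inv, norm_norm]
    exact inv_mul_le_one
  have hgr : ∀ θ : Metric.sphere (0 : EuclideanSpace ℝ (Fin n)) 1, ‖∇ F θ‖ ≤
      ∫ r, r * ‖tangential (θ : EuclideanSpace ℝ (Fin n)) (∇ u (polarMap (θ, r)))‖ ∂m := fun θ =>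
    norm_gradient_integral_le hI hI0 hmI hu (norm_sphere θ)
  have hgB : ∀ θ : Metric.sphere (0 : EuclideanSpace ℝ (Fin n)) 1, ‖∇ F θ‖ ≤ |B'| := fun θ =>
    (hgr θ).trans ((le_abs_self _).trans (hbnd fun r hr => hB' (θ, r) ⟨mem_univ _, hr⟩))
  have key := variance_le_integral_gradient_sq_sphereLaw hhom
    (fun x hx => differentiableAt_integral_radial hI hmI hu hx) (B := max |B| |B'|)
    (fun x => (hFB x).trans (le_max_left _ _)) (fun θ => (hgB θ).trans (le_max_right _ _))
  simp_rw [hFθ] at key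
  refine key.trans ?_
  have hT := h.memLp_tangential_of_continuous hI hI0 hgc
  have hTi := hT.norm.integrable_sq
  rw [integral_prod _ hTi, ← integral_const_mul]
  refine integral_mono_ae ?_ (hTi.integral_prod_left.const_mul _) ?_
  · refine Integrable.of_bound ((((measurable_gradient F).comp
      measurable_subtype_coe).norm.pow_const 2).aestronglyMeasurable) (|B'| ^ 2)
      (Eventually.of_forall fun θ => ?_)
    rw [norm_pow]
    gcongr
    simpa using hgB θ
  filter_upwards [ae_memLp_slice hT.norm] with θ hθ
  have hMm : MemLp (fun r => r / s r) 2 m := hM.restrict I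
  have hcs := sq_integral_mul_le hMm hθ
  calc ‖∇ F θ‖ ^ 2 ≤
      (∫ r, r * ‖tangential (θ : EuclideanSpace ℝ (Fin n)) (∇ u (polarMap (θ, r)))‖ ∂m) ^ 2 :=
        pow_le_pow_left₀ (norm_nonneg _) (hgr θ) 2
    -- The split `r = (r / s) s` makes Cauchy–Schwarz produce the moment of the statement and the
    -- weighted tangential energy.
    _ = (∫ r, r / s r *
        ‖s r • tangential (θ : EuclideanSpace ℝ (Fin n)) (∇ u (polarMap (θ, r)))‖ ∂m) ^ 2 := by
        congr 1
        refine integral_congr_ae ?_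
        filter_upwards [hmI] with r hr
        have hs := h.radial.pos r (hI0 hr)
        rw [norm_smul, Real.norm_of_nonneg hs.le]
        field_simp
    _ ≤ _ := hcs.trans (mul_le_mul_of_nonneg_right
        (integral_mono_measure Measure.restrict_le_self (Eventually.of_forall fun r => sq_nonneg _)
          hM.integrable_sq) (integral_nonneg fun r => sq_nonneg _))

/-- The spherical Poincaré inequality for the angular average of a Sobolev function over an
annulus. -/
theorem variance_angular_le_of_isCompact (h : PolarFactorization μ ν σ s)
    (hM : MemLp (fun r => r / s r) 2 ν) {I : Set ℝ} (hI : IsCompact I) (hI0 : I ⊆ Ioi 0)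
    {f : EuclideanSpace ℝ (Fin n) → ℝ}
    {G : EuclideanSpace ℝ (Fin n) → EuclideanSpace ℝ (Fin n)}
    (hf : MemLp f 2 μ) (hG : HasWeakGradient univ f G) (hσG : MemLp (fun x => σ x • G x) 2 μ) :
    ((n : ℝ) - 1) * ∫ θ, ((∫ r in I, f (polarMap (θ, r)) ∂ν) -
        ∫ η, (∫ r in I, f (polarMap (η, r)) ∂ν) ∂(sphereLaw (EuclideanSpace ℝ (Fin n)))) ^ 2
        ∂(sphereLaw (EuclideanSpace ℝ (Fin n))) ≤
      (∫ r, (r / s r) ^ 2 ∂ν) *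
      ∫ z : Metric.sphere (0 : EuclideanSpace ℝ (Fin n)) 1 × ℝ,
        ‖s z.2 • tangential (z.1 : EuclideanSpace ℝ (Fin n)) (G (polarMap z))‖ ^ 2
        ∂((sphereLaw (EuclideanSpace ℝ (Fin n))).prod ν) := by
  obtain ⟨u, hu, m1, m2, l1, l2⟩ := h.exists_smooth_approx_polar hf hG hσG hI
  set κ := sphereLaw (EuclideanSpace ℝ (Fin n)) with hκ
  have hle : κ.prod (ν.restrict I) ≤ κ.prod ν := Measure.prod_mono le_rfl Measure.restrict_le_self
  have hfI : MemLp (fun z => f (polarMap z)) 2 (κ.prod (ν.restrict I)) :=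
    (h.memLp_polar hf).mono_measure hle
  have hI1 : ν.restrict I univ ≤ 1 := (Measure.restrict_le_self _).trans prob_le_one
  have huI : ∀ j, MemLp (fun z => u j (polarMap z)) 2 (κ.prod (ν.restrict I)) := by
    intro j
    have hc : Continuous fun z : Metric.sphere (0 : EuclideanSpace ℝ (Fin n)) 1 × ℝ =>
        u j (polarMap z) := (hu j).continuous.comp (by unfold polarMap; fun_prop)
    obtain ⟨C, hC⟩ := ((isCompact_univ
      (X := Metric.sphere (0 : EuclideanSpace ℝ (Fin n)) 1)).prod
      hI).exists_bound_of_continuousOn hc.continuousOn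
    refine MemLp.of_bound hc.aestronglyMeasurable C ?_
    have : ∀ᵐ z ∂(κ.prod (ν.restrict I)), z.2 ∈ I :=
      Measure.quasiMeasurePreserving_snd.ae (ae_restrict_mem hI.measurableSet)
    filter_upwards [this] with z hz
    exact hC z ⟨mem_univ _, hz⟩
  have a1 : ∀ j, MemLp (fun θ => ∫ r in I, u j (polarMap (θ, r)) ∂ν) 2 κ := fun j =>
    memLp_integral_prod (w := fun z => u j (polarMap z)) hI1 (huI j)
  have a2 : MemLp (fun θ => ∫ r in I, f (polarMap (θ, r)) ∂ν) 2 κ := 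
    memLp_integral_prod (w := fun z => f (polarMap z)) hI1 hfI
  have a3 : Tendsto (fun j => eLpNorm ((fun θ => ∫ r in I, u j (polarMap (θ, r)) ∂ν) -
      fun θ => ∫ r in I, f (polarMap (θ, r)) ∂ν) 2 κ) atTop (𝓝 0) :=
    tendsto_eLpNorm_integral_prod (w := fun j z => u j (polarMap z))
      (w₀ := fun z => f (polarMap z)) hI1 huI hfI l1
  have t1 := tendsto_integral_sub_integral_sq a1 a2 a3
  have hT := fun j => h.memLp_tangential_of_continuous hI hI0 (continuous_gradient (hu j))
  have hT₀ := (h.memLp_tangential hσG).mono_measure hle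
  obtain ⟨C, hC⟩ := hI.exists_bound_of_continuousOn (h.radial.continuousOn.mono hI0)
  -- On the compact set `I` the weight is bounded by `C`, and projection is a contraction, so
  -- convergence of gradients gives convergence of weighted tangential parts.
  have t2 := tendsto_integral_norm_sq hT hT₀ (by
    have hl := ENNReal.Tendsto.const_mul (a := ENNReal.ofReal C) l2 (Or.inr ENNReal.ofReal_ne_top)
    rw [mul_zero] at hl
    refine tendsto_of_tendsto_of_tendsto_of_le_of_le tendsto_const_nhds hl (fun _ => zero_le)
      fun j => eLpNorm_le_mul_eLpNorm_of_ae_le_mul ?_ 2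
    have : ∀ᵐ z ∂(κ.prod (ν.restrict I)), z.2 ∈ I :=
      Measure.quasiMeasurePreserving_snd.ae (ae_restrict_mem hI.measurableSet)
    filter_upwards [this] with z hz
    rw [Pi.sub_apply, ← smul_sub, ← tangential_sub, norm_smul]
    exact mul_le_mul (hC _ hz) (norm_tangential_le (norm_sphere z.1) _) (norm_nonneg _)
      ((norm_nonneg _).trans (hC _ hz)))
  have h1 := le_of_tendsto_of_tendsto' (t1.const_mul ((n : ℝ) - 1))
    (t2.const_mul (∫ r, (r / s r) ^ 2 ∂ν))
    fun j => h.variance_angular_le_of_smooth hM hI hI0 (hu j)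
  refine h1.trans (mul_le_mul_of_nonneg_left ?_ (integral_nonneg fun r => sq_nonneg _))
  exact integral_mono_measure hle (Eventually.of_forall fun z => sq_nonneg _)
    (h.memLp_tangential hσG).norm.integrable_sq

/-- The spherical Poincaré inequality for the angular average of a Sobolev function. -/
theorem variance_angular_le (h : PolarFactorization μ ν σ s)
    (hM : MemLp (fun r => r / s r) 2 ν)
    {f : EuclideanSpace ℝ (Fin n) → ℝ}
    {G : EuclideanSpace ℝ (Fin n) → EuclideanSpace ℝ (Fin n)}
    (hf : MemLp f 2 μ) (hG : HasWeakGradient univ f G) (hσG : MemLp (fun x => σ x • G x) 2 μ) :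
    ((n : ℝ) - 1) * ∫ θ, ((∫ r, f (polarMap (θ, r)) ∂ν) -
        ∫ η, (∫ r, f (polarMap (η, r)) ∂ν) ∂(sphereLaw (EuclideanSpace ℝ (Fin n)))) ^ 2
        ∂(sphereLaw (EuclideanSpace ℝ (Fin n))) ≤
      (∫ r, (r / s r) ^ 2 ∂ν) *
      ∫ z : Metric.sphere (0 : EuclideanSpace ℝ (Fin n)) 1 × ℝ,
        ‖s z.2 • tangential (z.1 : EuclideanSpace ℝ (Fin n)) (G (polarMap z))‖ ^ 2
        ∂((sphereLaw (EuclideanSpace ℝ (Fin n))).prod ν) := by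
  obtain ⟨J, hJm, hJ, hJU, -⟩ := h.radial.exhaustion
  set κ := sphereLaw (EuclideanSpace ℝ (Fin n)) with hκ
  have hfp := h.memLp_polar hf
  have hν1 : ν univ ≤ 1 := prob_le_one
  -- Truncation to the annuli of the exhaustion. The compact-annulus bound has a right-hand side
  -- independent of `k`, so only the left side has to converge.
  set w : ℕ → Metric.sphere (0 : EuclideanSpace ℝ (Fin n)) 1 × ℝ → ℝ := fun k =>
    (univ ×ˢ J k).indicator fun z => f (polarMap z) with hw
  have hJmeas : ∀ k, MeasurableSet (univ ×ˢ J k :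
      Set (Metric.sphere (0 : EuclideanSpace ℝ (Fin n)) 1 × ℝ)) := fun k =>
    MeasurableSet.univ.prod (hJ k).1.measurableSet
  have hwm : ∀ k, MemLp (w k) 2 (κ.prod ν) := fun k => hfp.indicator (hJmeas k)
  have hwi : ∀ k θ, ∫ r, w k (θ, r) ∂ν = ∫ r in J k, f (polarMap (θ, r)) ∂ν := by
    intro k θ
    rw [← integral_indicator (hJ k).1.measurableSet]
    refine integral_congr_ae (Eventually.of_forall fun r => ?_)
    by_cases hr : r ∈ J k
    · simp [hw, hr]
    · simp [hw, hr]
  have hpos : ∀ᵐ z ∂(κ.prod ν), 0 < z.2 :=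
    (ae_norm_polarMap (E := EuclideanSpace ℝ (Fin n)) h.ae_pos).mono fun z hz => hz.1
  have hlim : Tendsto (fun k => eLpNorm (fun z => w k z - f (polarMap z)) 2 (κ.prod ν))
      atTop (𝓝 0) := by
    refine tendsto_eLpNorm_of_tendsto_lintegral ?_
    have h0 : ∫⁻ z, (0 : ℝ≥0∞) ∂(κ.prod ν) = 0 := lintegral_zero
    rw [← h0]
    refine tendsto_lintegral_of_dominated_convergence'
      (fun z => ‖f (polarMap z)‖ₑ ^ 2) (fun k => ((hwm k).1.sub hfp.1).enorm.pow_const 2)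
      (fun k => Eventually.of_forall fun z => ?_) ?_ ?_
    · by_cases hz : z ∈ univ ×ˢ J k
      · simp [hw, indicator_of_mem hz]
      · simp [hw, indicator_of_notMem hz]
    · rw [← eLpNorm_two_sq]
      exact (ENNReal.pow_lt_top hfp.2).ne
    · filter_upwards [hpos] with z hz
      obtain ⟨k, hk⟩ := mem_iUnion.1 (hJU hz)
      refine tendsto_const_nhds.congr' ?_
      filter_upwards [eventually_ge_atTop k] with i hi
      have hmem : z ∈ univ ×ˢ J i := ⟨mem_univ _, hJm hi hk⟩
      simp [hw, indicator_of_mem hmem]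
  have a1 : ∀ k, MemLp (fun θ => ∫ r, w k (θ, r) ∂ν) 2 κ := fun k =>
    memLp_integral_prod (w := w k) hν1 (hwm k)
  have a2 : MemLp (fun θ => ∫ r, f (polarMap (θ, r)) ∂ν) 2 κ := 
    memLp_integral_prod (w := fun z => f (polarMap z)) hν1 hfp
  have a3 : Tendsto (fun k => eLpNorm ((fun θ => ∫ r, w k (θ, r) ∂ν) -
      fun θ => ∫ r, f (polarMap (θ, r)) ∂ν) 2 κ) atTop (𝓝 0) :=
    tendsto_eLpNorm_integral_prod (w := w) (w₀ := fun z => f (polarMap z)) hν1 hwm hfp hlim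
  have t1 := tendsto_integral_sub_integral_sq a1 a2 a3
  refine le_of_tendsto' (t1.const_mul ((n : ℝ) - 1)) fun k => ?_
  simp_rw [hwi]
  exact h.variance_angular_le_of_isCompact hM (hJ k).1 (hJ k).2.2 hf hG hσG

/-- The Poincaré inequality for `μ` follows from that for `ν` and that on the sphere. -/
theorem poincareInequality_full [IsProbabilityMeasure μ] (h : PolarFactorization μ ν σ s)
    (hn : 2 ≤ n) {l : ℝ} (hl : 0 ≤ l)
    (hP : PoincareInequality (Ioi 0) ν s l) (hM : MemLp (fun r => r / s r) 2 ν)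
    (hlM : l * ∫ r, (r / s r) ^ 2 ∂ν ≤ (n : ℝ) - 1) : PoincareInequality univ μ σ l := by
  intro f G hf hG hσG
  have hfp := h.memLp_polar hf
  have hF := memLp_integral_prod (m' := ν) (w := fun z => f (polarMap z)) prob_le_one hfp
  have h1 := h.mul_integral_slice_variance_le hP hf hG hσG hF
  have h2 := h.variance_angular_le hM hf hG hσG
  have hr := h.memLp_radial hσG
  have ht := h.memLp_tangential hσG
  have hr2 : Integrable (fun z : Metric.sphere (0 : EuclideanSpace ℝ (Fin n)) 1 × ℝ =>
      s z.2 ^ 2 * ⟪G (polarMap z), (z.1 : EuclideanSpace ℝ (Fin n))⟫_ℝ ^ 2)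
      ((sphereLaw (EuclideanSpace ℝ (Fin n))).prod ν) := by
    refine hr.integrable_sq.congr (Eventually.of_forall fun z => ?_)
    simp [mul_pow]
  have e1 : ∫ x, σ x ^ 2 * ‖G x‖ ^ 2 ∂μ =
      (∫ z : Metric.sphere (0 : EuclideanSpace ℝ (Fin n)) 1 × ℝ,
        s z.2 ^ 2 * ⟪G (polarMap z), (z.1 : EuclideanSpace ℝ (Fin n))⟫_ℝ ^ 2
        ∂((sphereLaw (EuclideanSpace ℝ (Fin n))).prod ν)) +
      ∫ z : Metric.sphere (0 : EuclideanSpace ℝ (Fin n)) 1 × ℝ,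
        ‖s z.2 • tangential (z.1 : EuclideanSpace ℝ (Fin n)) (G (polarMap z))‖ ^ 2
        ∂((sphereLaw (EuclideanSpace ℝ (Fin n))).prod ν) := by
    have hm : AEStronglyMeasurable (fun x => σ x ^ 2 * ‖G x‖ ^ 2) μ := by
      refine (hσG.1.norm.pow 2).congr (Eventually.of_forall fun x => ?_)
      simp [norm_smul, mul_pow]
    rw [← integral_add hr2 ht.norm.integrable_sq, h.polar.integral_map_eq hm]
    refine integral_congr_ae ?_
    filter_upwards [ae_norm_polarMap (E := EuclideanSpace ℝ (Fin n)) h.ae_pos] with z hz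
    rw [norm_smul, mul_pow, norm_tangential_sq (norm_sphere z.1), h.weight, hz.2,
      Real.norm_eq_abs, sq_abs]
    ring
  have e2 : ∫ x, f x ∂μ = ∫ θ, (∫ r, f (polarMap (θ, r)) ∂ν)
      ∂(sphereLaw (EuclideanSpace ℝ (Fin n))) := by
    rw [h.polar.integral_map_eq hf.1, integral_prod _ (hfp.integrable (by norm_num))]
  rw [integral_sub_integral_sq hF, ← e2] at h2
  rw [e1]
  set R := ∫ z : Metric.sphere (0 : EuclideanSpace ℝ (Fin n)) 1 × ℝ,
        ‖s z.2 • tangential (z.1 : EuclideanSpace ℝ (Fin n)) (G (polarMap z))‖ ^ 2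
        ∂((sphereLaw (EuclideanSpace ℝ (Fin n))).prod ν) with hR
  set A := ∫ θ, (∫ r, f (polarMap (θ, r)) ∂ν) ^ 2 ∂(sphereLaw (EuclideanSpace ℝ (Fin n)))
  set M := ∫ r, (r / s r) ^ 2 ∂ν
  have hR0 : 0 ≤ R := integral_nonneg fun z => sq_nonneg _
  have hn' : (0 : ℝ) < (n : ℝ) - 1 := by
    have : (2 : ℝ) ≤ n := by exact_mod_cast hn
    linarith
  -- Here `A - (∫ f)²` is the variance of the angular average. Dividing by `n - 1 > 0` after using
  -- `l M ≤ n - 1` leaves exactly the tangential energy, which adds to the radial one.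
  have h3 : l * (A - (∫ x, f x ∂μ) ^ 2) ≤ R := by
    refine le_of_mul_le_mul_left ?_ hn'
    calc ((n : ℝ) - 1) * (l * (A - (∫ x, f x ∂μ) ^ 2))
        = l * (((n : ℝ) - 1) * (A - (∫ x, f x ∂μ) ^ 2)) := by ring
      _ ≤ l * (M * R) := mul_le_mul_of_nonneg_left h2 hl
      _ = (l * M) * R := by ring
      _ ≤ ((n : ℝ) - 1) * R := mul_le_mul_of_nonneg_right hlM hR0
  linarith

end PolarFactorization

end LowerBound

end


/-! ### Assembly of the two bounds. -/

noncomputable section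

theorem measurePreserving_neg_withDensity_norm {E : Type*} [NormedAddCommGroup E]
    [InnerProductSpace ℝ E] [FiniteDimensional ℝ E] [MeasurableSpace E] [BorelSpace E]
    (w : ℝ → ℝ≥0∞) :
    MeasurePreserving (fun x : E => -x) ((volume : Measure E).withDensity fun x => w ‖x‖)
      ((volume : Measure E).withDensity fun x => w ‖x‖) := by
  refine ⟨measurable_neg, Measure.ext fun S hS => ?_⟩
  rw [Measure.map_apply measurable_neg hS, withDensity_apply _ (measurable_neg hS),
    withDensity_apply _ hS]
  have := (Measure.measurePreserving_neg (volume : Measure E)).setLIntegral_comp_preimage_emb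
    (MeasurableEquiv.neg E).measurableEmbedding (fun x => w ‖x‖) S
  simpa using this

namespace PolarFactorization

theorem lintegral_norm_sq_div {E : Type*} [NormedAddCommGroup E] [InnerProductSpace ℝ E]
    [FiniteDimensional ℝ E] [MeasurableSpace E] [BorelSpace E] [Nontrivial E] {μ : Measure E}
    {ν : Measure ℝ} [IsProbabilityMeasure ν] {σ : E → ℝ} {s : ℝ → ℝ}
    (h : PolarFactorization μ ν σ s) :
    ∫⁻ x, ENNReal.ofReal (‖x‖ ^ 2 / σ x ^ 2) ∂μ = ∫⁻ r, ENNReal.ofReal ((r / s r) ^ 2) ∂ν ∧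
      AEStronglyMeasurable (fun r => r / s r) ν := by
  have hs : AEMeasurable s ν :=
    (h.radial.continuousOn.aemeasurable measurableSet_Ioi).mono_ac
      h.radial.absolutelyContinuous_volume
  have hq : AEMeasurable (fun r => r / s r) ν := aemeasurable_id.div hs
  refine ⟨?_, hq.aestronglyMeasurable⟩
  have hm : AEMeasurable (fun r => ENNReal.ofReal ((r / s r) ^ 2)) ν :=
    (hq.pow_const 2).ennreal_ofReal
  rw [← h.norm.map_eq, lintegral_map' (by rwa [h.norm.map_eq]) h.norm.measurable.aemeasurable]
  simp only [h.weight, div_pow]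

/-- Only constants `l` strictly below the minimum need testing. Such an `l` exists only when the
moment is finite, since an infinite moment makes the quotient zero; the extended inequality then
becomes the real one needed for the Poincaré bound. -/
theorem min_le_spectralGap {n : ℕ} [NeZero n] {μ : Measure (EuclideanSpace ℝ (Fin n))}
    [IsProbabilityMeasure μ] {ν : Measure ℝ} [IsProbabilityMeasure ν]
    {σ : EuclideanSpace ℝ (Fin n) → ℝ} {s : ℝ → ℝ} (h : PolarFactorization μ ν σ s)
    (hn : 2 ≤ n) :
    min (spectralGap (Ioi 0) ν s)
      (((n : ℝ≥0∞) - 1) / ∫⁻ x, ENNReal.ofReal (‖x‖ ^ 2 / σ x ^ 2) ∂μ) ≤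
        spectralGap univ μ σ := by
  obtain ⟨hMeq, hmeas⟩ := h.lintegral_norm_sq_div
  rw [hMeq]
  set M := ∫⁻ r, ENNReal.ofReal ((r / s r) ^ 2) ∂ν with hMdef
  refine ENNReal.le_of_forall_nnreal_lt fun l hl => ?_
  obtain ⟨hlν, hlM⟩ := lt_min_iff.1 hl
  have hMtop : M ≠ ⊤ := by
    intro hM
    rw [hM, ENNReal.div_top] at hlM
    exact not_lt_zero hlM
  have hint : Integrable (fun r => (r / s r) ^ 2) ν := by
    refine ⟨hmeas.pow 2, ?_⟩
    rw [hasFiniteIntegral_iff_ofReal (Eventually.of_forall fun r => sq_nonneg _)]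
    exact hMtop.lt_top
  have hMemLp : MemLp (fun r => r / s r) 2 ν := (memLp_two_iff_integrable_sq hmeas).2 hint
  have hMreal : M = ENNReal.ofReal (∫ r, (r / s r) ^ 2 ∂ν) :=
    (ofReal_integral_eq_lintegral_ofReal hint (Eventually.of_forall fun r => sq_nonneg _)).symm
  have hlM' : (l : ℝ) * ∫ r, (r / s r) ^ 2 ∂ν ≤ (n : ℝ) - 1 := by
    have h1 : (l : ℝ≥0∞) * M ≤ (n : ℝ≥0∞) - 1 := ENNReal.mul_le_of_le_div hlM.le
    have hn1 : (0 : ℝ) ≤ (n : ℝ) - 1 := by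
      have : (2 : ℝ) ≤ n := by exact_mod_cast hn
      linarith
    have h2 : (n : ℝ≥0∞) - 1 = ENNReal.ofReal ((n : ℝ) - 1) := by
      rw [ENNReal.ofReal_sub _ zero_le_one, ENNReal.ofReal_natCast, ENNReal.ofReal_one]
    rw [h2, hMreal, ← ENNReal.ofReal_coe_nnreal, ← ENNReal.ofReal_mul l.coe_nonneg] at h1
    exact (ENNReal.ofReal_le_ofReal_iff hn1).1 h1
  exact h.full.le_spectralGap (h.poincareInequality_full hn l.coe_nonneg
    (h.radial.poincareInequality_of_lt_spectralGap hlν) hMemLp hlM')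

end PolarFactorization

end

theorem theorem6 (n : ℕ) (hn : 2 ≤ n)
    (V : ℝ → ℝ) (hV0 : ContinuousOn V (Ici 0)) (hV : ContDiffOn ℝ ∞ V (Ioi 0))
    (μ : Measure (EuclideanSpace ℝ (Fin n))) [IsProbabilityMeasure μ] (c : ℝ)
    (hμ : μ = volume.withDensity (fun x => ENNReal.ofReal (c * Real.exp (-V ‖x‖))))
    (ν : Measure ℝ) [IsProbabilityMeasure ν] (c' : ℝ)
    (hν : ν = (volume.restrict (Ioi 0)).withDensity
      (fun r => ENNReal.ofReal (c' * (r ^ (n - 1) * Real.exp (-V r)))))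
    (σ : EuclideanSpace ℝ (Fin n) → ℝ) (hσ : AdmissibleWeight σ)
    (s : ℝ → ℝ) (hs : ∀ x, σ x = s ‖x‖) :
    min (radialGap ν s)
        (((n : ℝ≥0∞) - 1) / ∫⁻ x, ENNReal.ofReal (‖x‖ ^ 2 / σ x ^ 2) ∂μ) ≤ fullGap n μ σ ∧
      fullGap n μ σ ≤ radialGap ν s ∧
      ((∫⁻ x, ENNReal.ofReal (σ x ^ 2) ∂μ ≠ ⊤ ∨ ∫⁻ x, ENNReal.ofReal (‖x‖ ^ 2) ∂μ ≠ ⊤) →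
        fullGap n μ σ ≤ min (radialGap ν s)
          ((n : ℝ≥0∞) * (∫⁻ x, ENNReal.ofReal (σ x ^ 2) ∂μ) /
            ∫⁻ x, ENNReal.ofReal (‖x‖ ^ 2) ∂μ)) := by
  have : NeZero n := ⟨by omega⟩
  have h : PolarFactorization μ ν σ s :=
    polarFactorization_of_density hn hV0 hμ hν hσ.smooth.continuous hσ.elliptic hs
  have hdim : Module.finrank ℝ (EuclideanSpace ℝ (Fin n)) = n := by simp
  have hneg : MeasurePreserving (fun x : EuclideanSpace ℝ (Fin n) => -x) μ μ := by
    rw [hμ]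
    exact measurePreserving_neg_withDensity_norm fun r =>
      ENNReal.ofReal (c * Real.exp (-V r))
  have hrad : fullGap n μ σ ≤ radialGap ν s := h.spectralGap_le_radial (hdim.symm ▸ hn)
  refine ⟨h.min_le_spectralGap hn, hrad, fun hfin => le_min hrad ?_⟩
  have hle := spectralGap_le_div (by omega) h.full hneg hfin
  rwa [hdim] at hle
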